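/- Let $X$ be a smooth surface over an algebraically closed field $k$ of characteristic $0$ (an integral separated scheme of finite type over $k$, smooth of relative dimension $2$), let $K=k(X)$ be its function field, and let $a,b\in K^*$. Let $V\subset X$ be the union of the (finitely many) irreducible curves on $X$ along which $a$ or $b$ has a zero or a pole, and let $U=X\setminus V$. Then $a$ and $b$ restrict to invertible regular functions on $U$, and we let $\mathcal A_{a,b}$ be the sheaf of $\mathcal O_U$-algebras $$\mathcal A_{a,b}(W)=\mathcal O_X(W)\oplus i\,\mathcal O_X(W)\oplus j\,\mathcal O_X(W)\oplus l\,\mathcal O_X(W)\qquad (W\subseteq U \text{ open}),$$ with $i^2=a|_W$, $j^2=b|_W$, $ij=-ji=l$, which extends the quaternion algebra $(a,b)$ over $K$ to $U$. Let $C$ be an irreducible component of $V$ with generic point $\eta$, let $v$ be the valuation of the discrete valuation ring $\mathcal O_{X,\eta}$, and let $k(C)$ be the residue field of $\mathcal O_{X,\eta}$, that is, the function field of $C$. Let $U_C$ be the largest open subset of $X$ contained in $U\cup C$, that is, the complement in $X$ of the components of $V$ other than $C$. The element $$(-1)^{v(a)v(b)}\,a^{v(b)}\,b^{-v(a)}\in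 K^*$$ is a unit of $\mathcal O_{X,\eta}$; let $c\in k(C)^*$ be its residue class (the tame symbol). Then $\mathcal A_{a,b}$ extends to an Azumaya algebra over $U_C$, that is, there is an Azumaya algebra $\mathcal D$ on $U_C$ with $\mathcal D|_U\cong\mathcal A_{a,b}$ as sheaves of $\mathcal O_U$-algebras, if and only if $c$ is a square in $k(C)^*$. -/

import Mathlib

open CategoryTheory AlgebraicGeometry TopologicalSpace Opposite
open scoped Quaternion

universe u

/-! ### Smooth surfaces -/

/-- A smooth surface over a field `k`: an integral separated scheme of finite type over `k`
which is smooth of relative dimension `2` over `k`. -/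
structure SmoothSurface (k : Type u) [Field k] where
  /-- the underlying scheme -/
  toScheme : Scheme.{u}
  /-- the structure morphism -/
  structureMap : toScheme ⟶ Spec (CommRingCat.of k)
  isIntegral : IsIntegral toScheme
  isSeparated : IsSeparated structureMap
  locallyOfFiniteType : LocallyOfFiniteType structureMap
  quasiCompact : QuasiCompact structureMap
  smooth : SmoothOfRelativeDimension 2 structureMap

namespace SmoothSurface

variable {k : Type u} [Field k]

instance (X : SmoothSurface k) : IsIntegral X.toScheme := X.isIntegral

instance (X : SmoothSurface k) : IsLocallyNoetherian X.toScheme :=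
  haveI := X.locallyOfFiniteType
  LocallyOfFiniteType.isLocallyNoetherian X.structureMap

instance (X : SmoothSurface k) : CompactSpace X.toScheme :=
  haveI := X.quasiCompact
  (quasiCompact_iff_compactSpace X.structureMap).mp inferInstance

instance (X : SmoothSurface k) : IsNoetherian X.toScheme where

end SmoothSurface

/-! ### Sheaves of algebras and Azumaya algebras -/

/-- A sheaf of (associative, unital) `𝒪_Y`-algebras on a scheme `Y`: a sheaf of rings together
with a morphism of sheaves of rings from `𝒪_Y` to it with central image. -/
structure SheafOfAlgebras (Y : Scheme.{u}) where
  /-- the underlying presheaf of rings -/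
  presheaf : TopCat.Presheaf RingCat.{u} Y
  isSheaf : presheaf.IsSheaf
  /-- the structure morphism -/
  structureHom : Y.presheaf ⋙ forget₂ CommRingCat RingCat ⟶ presheaf
  central : ∀ (W : Y.Opens) (r : Γ(Y, W)) (x : presheaf.obj (op W)),
    (structureHom.app (op W)).hom r * x = x * (structureHom.app (op W)).hom r

namespace SheafOfAlgebras

variable {Y Z : Scheme.{u}}

/-- The ring of sections over an open subset. -/
abbrev sections (A : SheafOfAlgebras Y) (W : Y.Opens) : Type u := A.presheaf.obj (op W)

/-- The sections of `A` over `W` form an algebra over `Γ(Y, W)`. -/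
instance (A : SheafOfAlgebras Y) (W : Y.Opens) : Algebra Γ(Y, W) (A.sections W) :=
  RingHom.toAlgebra' (A.structureHom.app (op W)).hom (A.central W)

/-- Restriction of sections. -/
def res (A : SheafOfAlgebras Y) {W' W : Y.Opens} (h : W' ≤ W) :
    A.sections W →+* A.sections W' :=
  (A.presheaf.map (homOfLE h).op).hom

/-- `A` is, as a sheaf of `𝒪_Y`-modules, free of finite rank over the open subset `W`: finitely many
sections over `W` restrict to a basis of the sections over every smaller open subset. -/
def IsFreeOn (A : SheafOfAlgebras Y) (W : Y.Opens) : Prop :=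
  ∃ (n : ℕ) (e : Fin n → A.sections W), ∀ (W' : Y.Opens) (h : W' ≤ W),
    LinearIndependent Γ(Y, W') (fun i => A.res h (e i)) ∧
      Submodule.span Γ(Y, W') (Set.range fun i => A.res h (e i)) = ⊤

/-- `A` is an Azumaya algebra on `Y`: it is locally free of finite rank as an `𝒪_Y`-module, and
locally (on open subsets over which it is free) the canonical map `A ⊗ Aᵒᵖ → End(A)` is an
isomorphism and the rank is not zero. The last two conditions are `IsAzumaya` for the algebra of
sections. -/
def IsAzumayaAlgebra (A : SheafOfAlgebras Y) : Prop :=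
  ∀ y : Y, ∃ W : Y.Opens, y ∈ W ∧ A.IsFreeOn W ∧ IsAzumaya Γ(Y, W) (A.sections W)

/-- The restriction of a sheaf of algebras along an open immersion. -/
noncomputable def restrict (A : SheafOfAlgebras Z) (j : Y ⟶ Z) [IsOpenImmersion j] :
    SheafOfAlgebras Y where
  presheaf := j.opensFunctor.op ⋙ A.presheaf
  isSheaf := TopCat.Presheaf.isSheaf_of_isOpenEmbedding j.isOpenEmbedding A.isSheaf
  structureHom :=
    { app := fun W => (forget₂ CommRingCat RingCat).map (j.appIso W.unop).inv ≫
        A.structureHom.app (op (j ''ᵁ W.unop))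
      naturality := by
        intro V W i
        have h := A.structureHom.naturality (j.opensFunctor.op.map i)
        have h' := congrArg (forget₂ CommRingCat RingCat).map (j.appIso_inv_naturality i)
        simp only [Functor.map_comp] at h'
        simp only [Functor.comp_map, Category.assoc] at h ⊢
        erw [reassoc_of% h', h]
        rfl }
  central := fun W r x => A.central (j ''ᵁ W) ((j.appIso W).inv.hom r) x

/-- An isomorphism of sheaves of `𝒪_Y`-algebras. -/
structure Iso (A B : SheafOfAlgebras Y) where
  /-- the underlying isomorphism of sheaves of rings -/
  iso : A.presheaf ≅ B.presheaf
  comm : A.structureHom ≫ iso.hom = B.structureHom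

/-- For open subsets `U ≤ W` of a scheme `Z`, the sheaf of algebras `A` on `U` extends to an
Azumaya algebra over `W`. -/
def ExtendsToAzumaya {U W : Z.Opens} (h : U ≤ W) (A : SheafOfAlgebras U.toScheme) : Prop :=
  ∃ D : SheafOfAlgebras W.toScheme,
    D.IsAzumayaAlgebra ∧ Nonempty (Iso (D.restrict (Z.homOfLE h)) A)

end SheafOfAlgebras

/-! ### The quaternion sheaf -/

/-- The ring homomorphism of quaternion algebras induced by a homomorphism of the base rings. -/
def quaternionMap {R S : Type u} [CommRing R] [CommRing S] (φ : R →+* S) {a b : R} {a' b' : S}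
    (ha : φ a = a') (hb : φ b = b') : ℍ[R, a, 0, b] →+* ℍ[S, a', 0, b'] where
  toFun q := ⟨φ q.re, φ q.imI, φ q.imJ, φ q.imK⟩
  map_one' := by ext <;> simp
  map_zero' := by ext <;> simp
  map_add' x y := by ext <;> simp
  map_mul' x y := by subst ha hb; ext <;> simp

/-- The presheaf of rings `W ↦ 𝒪(W) ⊕ i 𝒪(W) ⊕ j 𝒪(W) ⊕ l 𝒪(W)` with `i² = a|_W`, `j² = b|_W`
and `ij = -ji = l`, where `a` and `b` are global functions on `Y`. -/
noncomputable def quaternionPresheaf (Y : Scheme.{u}) (a b : Γ(Y, ⊤)) :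
    TopCat.Presheaf RingCat.{u} Y where
  obj W := RingCat.of
    ℍ[Γ(Y, W.unop), Y.presheaf.map (homOfLE le_top).op a, 0, Y.presheaf.map (homOfLE le_top).op b]
  map {V W} i := RingCat.ofHom (quaternionMap (Y.presheaf.map i).hom
    (by rw [← CommRingCat.comp_apply, ← Functor.map_comp]; rfl)
    (by rw [← CommRingCat.comp_apply, ← Functor.map_comp]; rfl))
  map_id V := by
    refine RingCat.hom_ext (RingHom.ext fun q => ?_)
    apply QuaternionAlgebra.ext <;> simp [quaternionMap]
  map_comp {U V W} i j := by
    refine RingCat.hom_ext (RingHom.ext fun q => ?_)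
    apply QuaternionAlgebra.ext <;> simp [quaternionMap]

theorem quaternionPresheaf_isSheaf (Y : Scheme.{u}) (a b : Γ(Y, ⊤)) :
    (quaternionPresheaf Y a b).IsSheaf := by
  rw [TopCat.Presheaf.isSheaf_iff_isSheafUniqueGluing]
  intro ι U sf hsf
  have key : ∀ c : (∀ W : Y.Opens, (quaternionPresheaf Y a b).obj (op W) → Γ(Y, W)),
      (∀ (V W : Y.Opens) (i : W ⟶ V) x, c W ((quaternionPresheaf Y a b).map i.op x) =
        Y.presheaf.map i.op (c V x)) →
      ∃! s : Γ(Y, iSup U), ∀ i, Y.presheaf.map (Opens.leSupr U i).op s = c (U i) (sf i) := by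
    intro c hc
    refine Y.sheaf.existsUnique_gluing U (fun i => c (U i) (sf i)) fun i j => ?_
    exact (hc _ _ _ _).symm.trans ((congrArg (c _) (hsf i j)).trans (hc _ _ _ _))
  obtain ⟨s₀, h₀, u₀⟩ := key (fun W q => QuaternionAlgebra.re q) (fun _ _ _ _ => rfl)
  obtain ⟨s₁, h₁, u₁⟩ := key (fun W q => QuaternionAlgebra.imI q) (fun _ _ _ _ => rfl)
  obtain ⟨s₂, h₂, u₂⟩ := key (fun W q => QuaternionAlgebra.imJ q) (fun _ _ _ _ => rfl)
  obtain ⟨s₃, h₃, u₃⟩ := key (fun W q => QuaternionAlgebra.imK q) (fun _ _ _ _ => rfl)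
  refine ⟨(⟨s₀, s₁, s₂, s₃⟩ : QuaternionAlgebra _ _ _ _), fun i => ?_, fun t ht => ?_⟩
  · exact QuaternionAlgebra.ext (h₀ i) (h₁ i) (h₂ i) (h₃ i)
  · exact QuaternionAlgebra.ext
      (u₀ _ fun i => congrArg QuaternionAlgebra.re (ht i))
      (u₁ _ fun i => congrArg QuaternionAlgebra.imI (ht i))
      (u₂ _ fun i => congrArg QuaternionAlgebra.imJ (ht i))
      (u₃ _ fun i => congrArg QuaternionAlgebra.imK (ht i))

/-- The sheaf of `𝒪_Y`-algebras `W ↦ 𝒪(W) ⊕ i 𝒪(W) ⊕ j 𝒪(W) ⊕ l 𝒪(W)` with `i² = a|_W`,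
`j² = b|_W` and `ij = -ji = l`, where `a` and `b` are global functions on `Y`. -/
noncomputable def quaternionSheaf (Y : Scheme.{u}) (a b : Γ(Y, ⊤)) : SheafOfAlgebras Y where
  presheaf := quaternionPresheaf Y a b
  isSheaf := quaternionPresheaf_isSheaf Y a b
  structureHom :=
    { app := fun W => RingCat.ofHom (algebraMap Γ(Y, W.unop)
        ℍ[Γ(Y, W.unop), Y.presheaf.map (homOfLE le_top).op a, 0,
          Y.presheaf.map (homOfLE le_top).op b])
      naturality := by
        intro V W i
        refine RingCat.hom_ext (RingHom.ext fun r => ?_)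
        exact QuaternionAlgebra.ext rfl (map_zero (Y.presheaf.map i).hom).symm
          (map_zero (Y.presheaf.map i).hom).symm (map_zero (Y.presheaf.map i).hom).symm }
  central W r x := Algebra.commutes
    (A := ℍ[Γ(Y, W), Y.presheaf.map (homOfLE le_top).op a, 0,
      Y.presheaf.map (homOfLE le_top).op b]) r x

/-! ### Zeros and poles, and the tame symbol -/

namespace SmoothSurface

variable {k : Type u} [Field k] (X : SmoothSurface k)

/-- The field of rational functions. -/
noncomputable abbrev functionField : Type u := X.toScheme.functionField

/-- The union of the irreducible curves on `X` along which `a` or `b` has a zero or a pole. Curves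
are given by their generic points, the points of codimension one. -/
def zeroPoleLocus (a b : X.functionField) : Set X.toScheme :=
  ⋃ z ∈ {z : X.toScheme | Order.coheight z = 1 ∧
    (Scheme.ord a z ≠ 0 ∨ Scheme.ord b z ≠ 0)}, closure {z}

theorem finite_ord_ne_zero (f : X.functionField) :
    {z : X.toScheme | Order.coheight z = 1 ∧ Scheme.ord f z ≠ 0}.Finite := by
  by_cases hf : f = 0
  · simp [hf]
  obtain ⟨A, -, g, hA, rfl, hg⟩ := exists_isUnit_germ_eq (X := X.toScheme) f hf
  obtain ⟨S, hS, hSc, hSi, hSA⟩ :=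
    NoetherianSpace.exists_finite_set_isClosed_irreducible A.isOpen.isClosed_compl
  refine (hS.preimage (f := fun z => closure {z}) ?_).subset ?_
  · intro x _ y _ h
    exact (inseparable_iff_closure_eq.mpr h).eq
  · rintro z ⟨hz, hfz⟩
    have hzA : z ∈ (A : Set X.toScheme)ᶜ := fun h => hfz (Scheme.ord_of_isUnit hg h)
    rw [hSA] at hzA
    obtain ⟨t, ht, hzt⟩ := hzA
    have hξ := (hSi t ht).isGenericPoint_genericPoint (hSc t ht)
    set ξ := (hSi t ht).genericPoint
    have hsp : ξ ⤳ z := hξ.specializes hzt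
    have hξA : ξ ∉ A := by
      have : ξ ∈ ⋃₀ S := ⟨t, ht, hξ.mem⟩
      rwa [← hSA] at this
    have hle : z ≤ ξ := hsp
    have heq : closure {ξ} = closure {z} := by
      by_cases hge : ξ ≤ z
      · exact subset_antisymm (specializes_iff_closure_subset.mp hge)
          (specializes_iff_closure_subset.mp hsp)
      · exfalso
        have hlt : z < ξ := lt_of_le_not_ge hle hge
        have h0 : Order.coheight ξ + 1 ≤ 1 := hz ▸ Order.coheight_add_one_le hlt
        have h1 : Order.coheight ξ = 0 := by
          by_contra h
          have := Order.one_le_iff_pos.mpr (pos_iff_ne_zero.mpr h)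
          have h2 : (1 : ℕ∞) + 1 ≤ 1 := (add_le_add_left this 1).trans h0
          exact absurd h2 (by decide)
        have hη : ξ ≤ genericPoint X.toScheme := genericPoint_specializes ξ
        have h3 : genericPoint X.toScheme ≤ ξ := (Order.coheight_eq_zero.mp h1) hη
        have h4 : ξ ⤳ genericPoint X.toScheme := h3
        obtain ⟨p, hp⟩ := hA
        exact hξA (h4.mem_open A.isOpen
          (((genericPoint_spec X.toScheme).mem_open_set_iff A.isOpen).mpr ⟨p, trivial, hp⟩))
    show closure {z} ∈ S
    rw [← heq, hξ.def]
    exact ht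

theorem isClosed_zeroPoleLocus (a b : X.functionField) : IsClosed (X.zeroPoleLocus a b) := by
  refine Set.Finite.isClosed_biUnion ?_ fun _ _ => isClosed_closure
  refine ((X.finite_ord_ne_zero a).union (X.finite_ord_ne_zero b)).subset ?_
  rintro z ⟨h, h' | h'⟩
  · exact Or.inl ⟨h, h'⟩
  · exact Or.inr ⟨h, h'⟩

/-- The complement `U` of the curves along which `a` or `b` has a zero or a pole. -/
def regularLocus (a b : X.functionField) : X.toScheme.Opens :=
  ⟨(X.zeroPoleLocus a b)ᶜ, (X.isClosed_zeroPoleLocus a b).isOpen_compl⟩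

instance (a b : X.functionField) : Nonempty (X.regularLocus a b) := by
  refine ⟨⟨genericPoint X.toScheme, fun h => ?_⟩⟩
  obtain ⟨z, ⟨hz, -⟩, h⟩ := Set.mem_iUnion₂.mp h
  have h1 : genericPoint X.toScheme ≤ z := specializes_iff_mem_closure.mpr h
  have h2 := Order.coheight_anti h1
  have h3 : Order.coheight (genericPoint X.toScheme) = 0 :=
    Order.coheight_eq_zero.mpr fun y _ => genericPoint_specializes (α := X.toScheme) y
  rw [hz, h3] at h2
  exact absurd h2 (by decide)

/-- For a component `C` of the locus `V` of zeros and poles of `a` and `b`, with complement `U`, the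
largest open subset of `X` contained in `U ∪ C`. As `V` has finitely many components, it is the
complement of the union of the components of `V` other than `C`: it is obtained from `U ∪ C` by
removing the points at which `C` meets another component. -/
def regularLocusUnion (a b : X.functionField) (C : Set X.toScheme) : X.toScheme.Opens :=
  ⟨interior (X.regularLocus a b ∪ C), isOpen_interior⟩

theorem regularLocus_le (a b : X.functionField) (C : Set X.toScheme) :
    X.regularLocus a b ≤ X.regularLocusUnion a b C :=
  interior_maximal Set.subset_union_left (X.regularLocus a b).isOpen

/-- `c` is the tame symbol of `a` and `b` at the point `η` of codimension one: the element
`(-1)^(v(a)v(b)) a^(v(b)) b^(-v(a))` of the function field, with `v` the valuation of the local ring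
at `η` (the order of vanishing), is a unit of this local ring, with residue class `c`. -/
def IsTameSymbol (η : X.toScheme) (a b : X.functionField) (c : (X.toScheme.residueField η)ˣ) :
    Prop :=
  ∃ s : (X.toScheme.presheaf.stalk η)ˣ,
    algebraMap (X.toScheme.presheaf.stalk η) X.functionField s =
      (-1) ^ (Scheme.ord a η * Scheme.ord b η) * a ^ Scheme.ord b η * b ^ (-Scheme.ord a η) ∧
    (X.toScheme.residue η).hom s = c

/-- The sheaf of algebras `𝒜_{a,b}` on the complement `U` of the zeros and poles of `a` and `b`,
for functions `aU` and `bU` on `U` (the restrictions of `a` and `b`). -/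
noncomputable def quaternionSheafOn (U : X.toScheme.Opens) (aU bU : Γ(X.toScheme, U)) :
    SheafOfAlgebras U.toScheme :=
  quaternionSheaf U.toScheme (U.topIso.inv aU) (U.topIso.inv bU)

end SmoothSurface

/-!
# Extending a quaternion algebra across a curve on a smooth surface

Let `η` be the generic point of `C`, let `R` be the local ring at `η`, a discrete valuation ring
with uniformizer `π` and fraction field `K`, and let `c` be the tame symbol. Both implications pass
through orders over `R` in the quaternion algebra `(a, b)` over `K`. According to the parities of
the valuations of `a` and `b`, this algebra is isomorphic to some `(u, w)` with units `u` and `w` of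
`R`, and `c` is a square, or to some `(u π, w)`, and `c` is the class of `w` up to squares
(`quatIso_dichotomy`).

If an Azumaya algebra extends `𝒜_{a,b}`, then its stalk at `η` is an order `S` such that `S / π S`
is simple (`IsAzumayaOrder`, `SmoothSurface.exists_isAzumayaOrder_of_extendsToAzumaya`). In `(u π,
w)` with `w` not a square modulo `π`, there is no such order (`IsAzumayaOrder.isSquare_residue`):
the two halves `α² - w β²` and `-u π (γ² - w δ²)` of the norm form have valuations of different
parity, so the valuation of the norm of a quaternion bounds the valuations of its coordinates; the
elements of `S` of norm divisible by `π` therefore generate a proper ideal, so they lie in `π S`;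
then all norms from `S` have even valuation, unlike those of the multiples of `i`.

Conversely, if `c` is a square, there is an order `D` over `R` which is its own dual for the reduced
trace form (`exists_isSelfDualOrder_of_isSquare_residue_tameSymbol`). The extension of `𝒜_{a,b}`
consists of the sections of its direct image with germ at `η` in `D` (`SmoothSurface.quatSubring`).
The point is that this sheaf is locally free also at the closed points `y` of `C`. The local ring at
`y` is regular, so for one of two parameters the quotient is a principal ideal domain in which the
local equation `f` of `C` does not vanish. The stalk at `y`, which consists of the elements of `D`
with coordinates in `𝒪_y[1/f]`, is saturated with respect to this parameter, so it is free
(`Submodule.free_of_isSaturated`), and as `D` is self-dual and rational functions without poles in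
codimension one are regular, the stalk is self-dual too
(`IsSelfDualOrder.exists_dualBasis_lattice`). Finally, an algebra which has two bases `e` and `e'`
that are dual for the reduced trace form is Azumaya (`isAzumaya_of_isQuatDualBasis`), because of the
identity `∑ eᵢ x e'ᵢ = trd x`.
-/

/-! ### Regular local rings of dimension two -/

/-- A local ring whose maximal ideal is generated by two non-associated prime elements `x` and `y`
such that the quotients by `x` and by `y` are principal ideal domains. This is the shape in which
the regularity of a two-dimensional local ring is used below. -/
def HasPrimeParameters (R : Type*) [CommRing R] [IsLocalRing R] : Prop :=
  ∃ x y : R, Prime x ∧ Prime y ∧ ¬ x ∣ y ∧ IsLocalRing.maximalIdeal R = Ideal.span {x, y} ∧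
    IsPrincipalIdealRing (R ⧸ Ideal.span {x}) ∧ IsPrincipalIdealRing (R ⧸ Ideal.span {y})

/-- By Krull's intersection theorem, every nonzero element is a unit times a power of `y`. -/
theorem isDomain_and_isPrincipalIdealRing_of_maximalIdeal_eq_span {R : Type*} [CommRing R]
    [IsLocalRing R] [IsNoetherianRing R] {y : R}
    (hm : IsLocalRing.maximalIdeal R = Ideal.span {y}) (hy : ∀ n : ℕ, y ^ n ≠ 0) :
    IsDomain R ∧ IsPrincipalIdealRing R := by
  have key : ∀ r : R, r ≠ 0 → ∃ (n : ℕ) (v : R), IsUnit v ∧ r = y ^ n * v := by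
    intro r hr
    have h1 : r ∉ ⨅ n : ℕ, IsLocalRing.maximalIdeal R ^ n := by
      rwa [Ideal.iInf_pow_eq_bot_of_isLocalRing _ (IsLocalRing.maximalIdeal.isMaximal R).ne_top]
    simp only [Ideal.mem_iInf, not_forall] at h1
    classical
    have hn := Nat.find_spec h1
    have hn' := fun m => Nat.find_min h1 (m := m)
    rcases h : Nat.find h1 with _ | n
    · rw [h] at hn; simp at hn
    · have h2 := hn' n (by omega)
      rw [not_not, hm, Ideal.span_singleton_pow, Ideal.mem_span_singleton] at h2
      obtain ⟨v, hv⟩ := h2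
      refine ⟨n, v, ?_, hv⟩
      by_contra hv'
      have h3 : v ∈ IsLocalRing.maximalIdeal R := hv'
      rw [hm, Ideal.mem_span_singleton] at h3
      obtain ⟨w, rfl⟩ := h3
      apply hn
      rw [h, hm, Ideal.span_singleton_pow, Ideal.mem_span_singleton]
      exact ⟨w, by rw [hv]; ring⟩
  have hdom : IsDomain R := by
    refine @NoZeroDivisors.to_isDomain R _ inferInstance ⟨?_⟩
    intro a b hab
    by_contra! h
    obtain ⟨n, v, hv, rfl⟩ := key a h.1
    obtain ⟨m, w, hw, rfl⟩ := key b h.2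
    have h0 : y ^ (n + m) * (v * w) = 0 := by rw [← hab]; ring
    rw [(hv.mul hw).mul_left_eq_zero] at h0
    exact hy _ h0
  refine ⟨hdom, ?_⟩
  exact ((tfae_of_isNoetherianRing_of_isLocalRing_of_isDomain (R := R)).out 0 4).mpr
    ((⟨y, hm⟩ : (IsLocalRing.maximalIdeal R).IsPrincipal))

theorem isDomain_and_isPrincipalIdealRing_quotient {R : Type*} [CommRing R] [IsLocalRing R]
    [IsNoetherianRing R] {x y : R} (hm : IsLocalRing.maximalIdeal R = Ideal.span {x, y})
    (hxy : ∀ n : ℕ, ¬ x ∣ y ^ n) :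
    IsDomain (R ⧸ Ideal.span {x}) ∧ IsPrincipalIdealRing (R ⧸ Ideal.span {x}) := by
  have hx : x ∈ IsLocalRing.maximalIdeal R := by
    rw [hm]; exact Ideal.subset_span (by simp)
  have : Nontrivial (R ⧸ Ideal.span {x}) := Ideal.Quotient.nontrivial_iff.mpr
    ((Ideal.span_singleton_le_iff_mem _).mpr hx |>.trans_lt
      (IsLocalRing.maximalIdeal.isMaximal R).ne_top.lt_top).ne
  have hloc : IsLocalRing (R ⧸ Ideal.span {x}) :=
    .of_surjective' (Ideal.Quotient.mk _) Ideal.Quotient.mk_surjective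
  refine isDomain_and_isPrincipalIdealRing_of_maximalIdeal_eq_span
    (y := Ideal.Quotient.mk _ y) ?_ ?_
  · have := IsLocalRing.map_maximalIdeal_of_surjective (Ideal.Quotient.mk (Ideal.span {x}))
      Ideal.Quotient.mk_surjective
    rw [← this, hm, Ideal.map_span, Set.image_pair,
      Ideal.Quotient.eq_zero_iff_mem.mpr (Ideal.mem_span_singleton_self x), Ideal.span_insert_zero]
  · intro n h
    rw [← map_pow, Ideal.Quotient.eq_zero_iff_mem, Ideal.mem_span_singleton] at h
    exact hxy n h

theorem HasPrimeParameters.of_maximalIdeal_eq_span {R : Type*} [CommRing R] [IsLocalRing R]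
    [IsNoetherianRing R] {x y : R} (hm : IsLocalRing.maximalIdeal R = Ideal.span {x, y})
    (hxy : ∀ n : ℕ, ¬ x ∣ y ^ n) (hyx : ∀ n : ℕ, ¬ y ∣ x ^ n) : HasPrimeParameters R := by
  obtain ⟨h1, h2⟩ := isDomain_and_isPrincipalIdealRing_quotient hm hxy
  obtain ⟨h3, h4⟩ := isDomain_and_isPrincipalIdealRing_quotient (hm.trans (by rw [Set.pair_comm]))
    hyx
  have hx0 : x ≠ 0 := by rintro rfl; exact hyx 1 (by simp)
  have hy0 : y ≠ 0 := by rintro rfl; exact hxy 1 (by simp)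
  refine ⟨x, y, ?_, ?_, by simpa using hxy 1, hm, h2, h4⟩
  · rw [← Ideal.span_singleton_prime hx0]
    exact (Ideal.Quotient.isDomain_iff_prime _).mp h1
  · rw [← Ideal.span_singleton_prime hy0]
    exact (Ideal.Quotient.isDomain_iff_prime _).mp h3

theorem HasPrimeParameters.of_ringEquiv {R S : Type*} [CommRing R] [IsDomain R] [IsLocalRing R]
    [CommRing S] [IsLocalRing S] [IsNoetherianRing S] (e : R ≃+* S) (h : HasPrimeParameters R) :
    HasPrimeParameters S := by
  obtain ⟨x, y, hx, hy, hxy, hm, -, -⟩ := h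
  have hyx : ¬ y ∣ x := fun h => hxy ((hy.associated_of_dvd hx h).symm.dvd)
  refine HasPrimeParameters.of_maximalIdeal_eq_span (x := e x) (y := e y) ?_ ?_ ?_
  · rw [← IsLocalRing.map_ringEquiv_maximalIdeal e, hm]
    change Ideal.map (e : R →+* S) _ = _
    rw [Ideal.map_span, Set.image_pair]
    rfl
  · intro n h
    rw [← map_pow, map_dvd_iff] at h
    exact hxy (hx.dvd_of_dvd_pow h)
  · intro n h
    rw [← map_pow, map_dvd_iff] at h
    exact hyx (hy.dvd_of_dvd_pow h)

open Pointwise in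
/-- If `R / x` is a principal ideal domain, then a submodule `M` of a finite free module that is
saturated with respect to `x` is free: `M / x M` is torsion-free, hence free, over `R / x`. -/
theorem Submodule.free_of_isSaturated {R : Type*} [CommRing R] [IsDomain R] [IsLocalRing R]
    [IsNoetherianRing R] {x : R} (hx : Prime x) (hxm : x ∈ IsLocalRing.maximalIdeal R)
    [IsPrincipalIdealRing (R ⧸ Ideal.span {x})] {ι : Type*} [Finite ι]
    (M : Submodule R (ι → R)) (hM : ∀ v : ι → R, x • v ∈ M → v ∈ M) : Module.Free R M := by
  have hprime : (Ideal.span {x}).IsPrime := (Ideal.span_singleton_prime hx.ne_zero).mpr hx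
  have : IsDomain (R ⧸ Ideal.span {x}) := Ideal.Quotient.isDomain _
  have : Module.Finite R M := inferInstance
  have : Module.FinitePresentation R M := Module.finitePresentation_of_finite R M
  have hreg : IsSMulRegular M x := by
    intro a b hab
    exact smul_right_injective M hx.ne_zero hab
  rw [← Module.free_quotSMulTop_iff_free R M (x := x) _ hreg]
  · have : Module.Finite R (QuotSMulTop x M) := inferInstance
    have hfin : Module.Finite (R ⧸ Ideal.span {x}) (QuotSMulTop x M) :=
      Module.Finite.of_restrictScalars_finite R _ _
    have : Module.IsTorsionFree (R ⧸ Ideal.span {x}) (QuotSMulTop x M) := by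
      rw [Module.isTorsionFree_iff_smul_eq_zero]
      intro r m hrm
      obtain ⟨r, rfl⟩ := Ideal.Quotient.mk_surjective r
      obtain ⟨m, rfl⟩ := Submodule.mkQ_surjective _ m
      rw [or_iff_not_imp_left]
      intro hr
      rw [Ideal.Quotient.eq_zero_iff_mem, Ideal.mem_span_singleton] at hr
      have h1 : Submodule.mkQ (x • (⊤ : Submodule R M)) (r • m) = 0 := hrm
      rw [Submodule.mkQ_apply, Submodule.Quotient.mk_eq_zero] at h1
      rw [Submodule.mkQ_apply, Submodule.Quotient.mk_eq_zero]
      obtain ⟨m', -, hm'⟩ := (Submodule.mem_smul_pointwise_iff_exists _ _ _).mp h1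
      have h2 : ∀ i, x ∣ m.1 i := by
        intro i
        have h3 : x * m'.1 i = r * m.1 i := congrArg (fun z : M => z.1 i) hm'
        exact (hx.dvd_or_dvd ⟨_, h3.symm⟩).resolve_left hr
      choose w hw using h2
      have hw' : x • w = m.1 := by ext i; simp [hw]
      refine (Submodule.mem_smul_pointwise_iff_exists _ _ _).mpr
        ⟨⟨w, hM w (hw' ▸ m.2)⟩, trivial, Subtype.ext hw'⟩
    exact Module.free_of_finite_type_torsion_free'
  · rw [IsLocalRing.jacobson_eq_maximalIdeal _ bot_ne_top]; exact hxm

theorem Ideal.isPrincipal_of_free {R : Type*} [CommRing R] [IsDomain R] (I : Ideal R)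
    [Module.Free R I] : I.IsPrincipal := by
  let b := Module.Free.chooseBasis R I
  have hsub : Subsingleton (Module.Free.ChooseBasisIndex R I) := by
    refine ⟨fun i j => ?_⟩
    by_contra hij
    have h1 : (b j).1 • b i = (b i).1 • b j := Subtype.ext (mul_comm _ _)
    have h2 := congrArg (fun z => b.repr z i) h1
    simp only [map_smul, Module.Basis.repr_self, Finsupp.smul_apply, Finsupp.single_eq_same,
      smul_eq_mul, mul_one] at h2
    rw [Finsupp.single_eq_of_ne hij, mul_zero] at h2
    exact b.ne_zero j (Subtype.ext h2)
  rcases isEmpty_or_nonempty (Module.Free.ChooseBasisIndex R I) with h | ⟨⟨i⟩⟩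
  · have : Subsingleton I := b.repr.toEquiv.subsingleton
    rw [(Submodule.subsingleton_iff_eq_bot).mp this]
    exact bot_isPrincipal
  · let _ : Unique (Module.Free.ChooseBasisIndex R I) := ⟨⟨i⟩, fun j => Subsingleton.elim _ _⟩
    refine ⟨(b i).1, le_antisymm ?_ ((Ideal.span_singleton_le_iff_mem _).mpr (b i).2)⟩
    intro r hr
    have h1 := b.sum_repr ⟨r, hr⟩
    rw [Fintype.sum_unique] at h1
    have h2 := congrArg Subtype.val h1
    rw [Subsingleton.elim (default : Module.Free.ChooseBasisIndex R I) i] at h2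
    exact Ideal.mem_span_singleton'.mpr ⟨_, h2⟩

/-- A regular local ring of dimension two is factorial: a prime ideal of height one which does not
contain the parameter `x` is saturated with respect to `x`, so it is free, hence principal. -/
theorem HasPrimeParameters.uniqueFactorizationMonoid {R : Type*} [CommRing R] [IsDomain R]
    [IsLocalRing R] [IsNoetherianRing R] (h : HasPrimeParameters R) :
    UniqueFactorizationMonoid R := by
  obtain ⟨x, y, hx, hy, hxy, hm, hPx, -⟩ := h
  refine UniqueFactorizationMonoid.of_forall_isPrincipal_of_height_eq_one fun p hp hp1 => ?_
  by_cases hxp : x ∈ p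
  · exact ⟨x, p.eq_span_singleton_of_height_eq_one hp1 hxp hx⟩
  · let M : Submodule R (Unit → R) := Submodule.comap (LinearMap.proj (φ := fun _ : Unit => R) ()) p
    have hfree : Module.Free R M := by
      refine Submodule.free_of_isSaturated hx ?_ M fun v hv => ?_
      · rw [hm]; exact Ideal.subset_span (by simp)
      · exact (hp.mem_or_mem (show x * v () ∈ p from hv)).resolve_left hxp
    let e : M ≃ₗ[R] p :=
      { toFun := fun v => ⟨v.1 (), v.2⟩
        invFun := fun r => ⟨fun _ => r.1, r.2⟩
        map_add' := fun _ _ => rfl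
        map_smul' := fun _ _ => rfl
        left_inv := fun _ => rfl
        right_inv := fun _ => rfl }
    have : Module.Free R p := Module.Free.of_equiv e
    exact p.isPrincipal_of_free

/-! ### Algebras étale over the affine plane -/

theorem MvPolynomial.prime_X_sub_C {F σ : Type*} [Field F] (i : σ) (c : F) :
    Prime (MvPolynomial.X i - MvPolynomial.C c : MvPolynomial σ F) := by
  classical
  have hcoeff : (MvPolynomial.X i - MvPolynomial.C c : MvPolynomial σ F).coeff
      (Finsupp.single i 1) = 1 := by
    rw [MvPolynomial.coeff_sub, MvPolynomial.coeff_C, if_neg, sub_zero, MvPolynomial.coeff_X,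
      if_pos rfl]
    exact (Finsupp.single_ne_zero.mpr one_ne_zero).symm
  refine (MvPolynomial.irreducible_of_totalDegree_eq_one ?_ ?_).prime
  · apply le_antisymm
    · refine (MvPolynomial.totalDegree_sub _ _).trans ?_
      simp
    · have := MvPolynomial.le_totalDegree (p := (MvPolynomial.X i - MvPolynomial.C c))
        (s := Finsupp.single i 1) (by rw [MvPolynomial.mem_support_iff, hcoeff]; exact one_ne_zero)
      simpa using this
  · intro x hx
    have := hx (Finsupp.single i 1)
    rw [hcoeff] at this
    exact isUnit_of_dvd_one this

open RingTheory.Sequence Pointwise in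
theorem not_dvd_pow_of_isWeaklyRegular {S : Type*} [CommRing S] {x y : S} (hx : ¬ IsUnit x)
    (h : IsWeaklyRegular S [x, y]) (n : ℕ) : ¬ x ∣ y ^ n := by
  induction n with
  | zero => simpa [← isUnit_iff_dvd_one] using hx
  | succ n ih =>
    rintro ⟨r, hr⟩
    apply ih
    rw [isWeaklyRegular_cons_iff, isWeaklyRegular_cons_iff] at h
    have h2 := h.2.1
    have h3 : Submodule.Quotient.mk (p := x • (⊤ : Submodule S S)) (y ^ n) = 0 := by
      apply h2.right_eq_zero_of_smul
      rw [← Submodule.Quotient.mk_smul, Submodule.Quotient.mk_eq_zero, smul_eq_mul, ← pow_succ', hr]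
      exact (Submodule.mem_smul_pointwise_iff_exists _ _ _).mpr ⟨r, trivial, rfl⟩
    rw [Submodule.Quotient.mk_eq_zero] at h3
    obtain ⟨s, -, hs⟩ := (Submodule.mem_smul_pointwise_iff_exists _ _ _).mp h3
    exact ⟨s, hs.symm⟩

open RingTheory.Sequence in
theorem isWeaklyRegular_pair_of_prime {A : Type*} [CommRing A] [IsDomain A] {x y : A} (hx : Prime x)
    (hxy : ¬ x ∣ y) : IsWeaklyRegular A [x, y] := by
  rw [isWeaklyRegular_cons_iff, isWeaklyRegular_cons_iff]
  refine ⟨fun a b hab => mul_left_cancel₀ hx.ne_zero hab, ?_, .nil _ _⟩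
  rw [isSMulRegular_iff_right_eq_zero_of_smul]
  intro m hm
  obtain ⟨m, rfl⟩ := Submodule.Quotient.mk_surjective _ m
  rw [← Submodule.Quotient.mk_smul, Submodule.Quotient.mk_eq_zero] at hm
  rw [Submodule.Quotient.mk_eq_zero]
  obtain ⟨s, -, hs⟩ := (Submodule.mem_smul_pointwise_iff_exists _ _ _).mp hm
  obtain ⟨t, rfl⟩ := (hx.dvd_or_dvd ⟨s, hs.symm⟩).resolve_left hxy
  exact (Submodule.mem_smul_pointwise_iff_exists _ _ _).mpr ⟨t, trivial, rfl⟩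

/-- A surface étale over the affine plane over an algebraically closed field has regular local
rings at its closed points: the coordinates of the plane, translated to vanish at the point, are
parameters. -/
theorem HasPrimeParameters.of_etale {F B : Type*} [Field F] [IsAlgClosed F] [CommRing B]
    [Algebra (MvPolynomial (Fin 2) F) B] [Algebra.Etale (MvPolynomial (Fin 2) F) B]
    (n : Ideal B) [n.IsMaximal] : HasPrimeParameters (Localization.AtPrime n) := by
  classical
  set A := MvPolynomial (Fin 2) F with hA
  let _ : Algebra F B := ((algebraMap A B).comp (algebraMap F A)).toAlgebra
  have _ : IsScalarTower F A B := IsScalarTower.of_algebraMap_eq fun _ => rfl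
  have : Algebra.FiniteType F A := inferInstance
  have : Algebra.FiniteType F B := Algebra.FiniteType.trans (S := A) inferInstance inferInstance
  have : IsNoetherianRing B := Algebra.FiniteType.isNoetherianRing F B
  let _ : Field (B ⧸ n) := Ideal.Quotient.field n
  have : Algebra.FiniteType F (B ⧸ n) :=
    Algebra.FiniteType.of_surjective (Ideal.Quotient.mkₐ F n) Ideal.Quotient.mk_surjective
  have : Module.Finite F (B ⧸ n) := finite_of_finite_type_of_isJacobsonRing F (B ⧸ n)
  have hbij : Function.Bijective (algebraMap F (B ⧸ n)) :=
    IsAlgClosed.algebraMap_bijective_of_isIntegral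
  have hc : ∀ i : Fin 2, ∃ c : F, algebraMap A B (MvPolynomial.X i - MvPolynomial.C c) ∈ n := by
    intro i
    obtain ⟨c, hc⟩ := hbij.2 (Ideal.Quotient.mk n (algebraMap A B (MvPolynomial.X i)))
    refine ⟨c, ?_⟩
    rw [← Ideal.Quotient.eq_zero_iff_mem, map_sub, map_sub, ← hc, sub_eq_zero]
    rfl
  choose c hc using hc
  let t : Fin 2 → A := fun i => MvPolynomial.X i - MvPolynomial.C (c i)
  let P : Ideal A := n.under A
  have hP : P = Ideal.span {t 0, t 1} := by
    have hle : Ideal.span {t 0, t 1} ≤ P := by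
      rw [Ideal.span_le]
      rintro _ (rfl | rfl)
      · exact hc 0
      · exact hc 1
    refine le_antisymm (fun p hp => ?_) hle
    have h1 : p - MvPolynomial.C (MvPolynomial.eval c p) ∈ Ideal.span {t 0, t 1} := by
      have h0 : Ideal.Quotient.mk (Ideal.span {t 0, t 1}) = (Ideal.Quotient.mk
          (Ideal.span {t 0, t 1})).comp (MvPolynomial.C.comp (MvPolynomial.eval c)) := by
        refine MvPolynomial.ringHom_ext (fun a => by simp) fun i => ?_
        rw [RingHom.comp_apply, RingHom.comp_apply, MvPolynomial.eval_X, ← sub_eq_zero, ← map_sub,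
          Ideal.Quotient.eq_zero_iff_mem]
        fin_cases i
        · exact Ideal.subset_span (by simp [t])
        · exact Ideal.subset_span (by simp [t])
      rw [← Ideal.Quotient.eq_zero_iff_mem, map_sub, sub_eq_zero]
      exact congrArg (fun f : A →+* _ => f p) h0
    have h2 : MvPolynomial.C (MvPolynomial.eval c p) ∈ P := by
      have := P.sub_mem hp (hle h1)
      rwa [sub_sub_cancel] at this
    have h3 : MvPolynomial.eval c p = 0 := by
      by_contra h0
      refine (Ideal.IsPrime.ne_top (I := P) inferInstance) (P.eq_top_of_isUnit_mem h2 ?_)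
      exact (isUnit_iff_ne_zero.mpr h0).map MvPolynomial.C
    rwa [h3, map_zero, sub_zero] at h1
  let _ := Localization.AtPrime.algebraOfLiesOver P n
  have hun : Algebra.IsUnramifiedAt A n := inferInstance
  have hmax := ((Algebra.isUnramifiedAt_iff_map_eq A P n).mp inferInstance).2
  rw [hP, Ideal.map_span, Set.image_pair] at hmax
  have hflat : Module.Flat A (Localization.AtPrime n) :=
    Module.Flat.trans A B (Localization.AtPrime n)
  have hnu : ∀ i, ¬ IsUnit (algebraMap A (Localization.AtPrime n) (t i)) := by
    intro i hi
    have h1 : algebraMap A (Localization.AtPrime n) (t i) ∈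
        IsLocalRing.maximalIdeal (Localization.AtPrime n) := by
      rw [← hmax]
      fin_cases i
      · exact Ideal.subset_span (by simp)
      · exact Ideal.subset_span (by simp)
    exact h1 hi
  have hnd : ∀ i j, i ≠ j → ¬ t i ∣ t j := by
    rintro i j hij ⟨s, hs⟩
    have := congrArg (MvPolynomial.eval (Function.update c j (c j + 1))) hs
    simp [t, Function.update_of_ne hij] at this
  have hreg : ∀ i j, i ≠ j → ∀ m : ℕ, ¬ algebraMap A (Localization.AtPrime n) (t i) ∣
      algebraMap A (Localization.AtPrime n) (t j) ^ m := by
    intro i j hij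
    refine not_dvd_pow_of_isWeaklyRegular (hnu i) ?_
    exact (isWeaklyRegular_pair_of_prime (MvPolynomial.prime_X_sub_C i (c i))
      (hnd i j hij)).of_flat (S := Localization.AtPrime n)
  exact HasPrimeParameters.of_maximalIdeal_eq_span hmax.symm (hreg 0 1 (by simp))
    (hreg 1 0 (by simp))

/-! ### Orders in quaternion algebras -/

/-- The reduced norm of the quaternion algebra `(a, b)`. -/
def quatNorm {K : Type*} [CommRing K] {a b : K} (q : ℍ[K, a, 0, b]) : K :=
  q.re ^ 2 - a * q.imI ^ 2 - b * q.imJ ^ 2 + a * b * q.imK ^ 2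

theorem quatNorm_mul {K : Type*} [CommRing K] {a b : K} (p q : ℍ[K, a, 0, b]) :
    quatNorm (p * q) = quatNorm p * quatNorm q := by
  simp [quatNorm]; ring

@[simp]
theorem quatNorm_one {K : Type*} [CommRing K] {a b : K} : quatNorm (1 : ℍ[K, a, 0, b]) = 1 := by
  simp [quatNorm]

theorem quatNorm_pow {K : Type*} [CommRing K] {a b : K} (q : ℍ[K, a, 0, b]) (n : ℕ) :
    quatNorm (q ^ n) = quatNorm q ^ n := by
  induction n with
  | zero => simp
  | succ n ih => rw [pow_succ, quatNorm_mul, ih, pow_succ]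

theorem quatNorm_smul {K : Type*} [CommRing K] {a b : K} (c : K) (q : ℍ[K, a, 0, b]) :
    quatNorm (c • q) = c ^ 2 * quatNorm q := by
  simp [quatNorm]; ring

/-- A finitely generated submodule of a vector space can be multiplied into any full lattice. -/
theorem Submodule.FG.exists_smul_mem {R V : Type*} [CommRing R] [IsDomain R] [AddCommGroup V]
    [Module R V] {M : Submodule R V} (hM : M.FG) (L : Submodule R V)
    (h : ∀ v : V, ∃ d : R, d ≠ 0 ∧ d • v ∈ L) : ∃ d : R, d ≠ 0 ∧ ∀ v ∈ M, d • v ∈ L := by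
  induction M, hM using Submodule.fg_induction with
  | singleton x =>
    obtain ⟨d, hd, hx⟩ := h x
    refine ⟨d, hd, fun v hv => ?_⟩
    obtain ⟨r, rfl⟩ := Submodule.mem_span_singleton.mp hv
    rw [smul_comm]
    exact L.smul_mem r hx
  | sup M₁ M₂ _ _ h₁ h₂ =>
    obtain ⟨d₁, hd₁, h₁⟩ := h₁
    obtain ⟨d₂, hd₂, h₂⟩ := h₂
    refine ⟨d₁ * d₂, mul_ne_zero hd₁ hd₂, fun v hv => ?_⟩
    obtain ⟨y, hy, z, hz, rfl⟩ := Submodule.mem_sup.mp hv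
    rw [smul_add]
    refine L.add_mem ?_ ?_
    · rw [mul_comm, mul_smul]; exact L.smul_mem _ (h₁ y hy)
    · rw [mul_smul]; exact L.smul_mem _ (h₂ z hz)

/-- The lattice of quaternions with coordinates in `R`. -/
def quatLattice (R : Type*) {K : Type*} [CommRing R] [CommRing K] [Algebra R K] (a b : K) :
    Submodule R ℍ[K, a, 0, b] where
  carrier := {q | q.re ∈ (algebraMap R K).range ∧ q.imI ∈ (algebraMap R K).range ∧
    q.imJ ∈ (algebraMap R K).range ∧ q.imK ∈ (algebraMap R K).range}
  zero_mem' := ⟨zero_mem _, zero_mem _, zero_mem _, zero_mem _⟩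
  add_mem' h h' := ⟨add_mem h.1 h'.1, add_mem h.2.1 h'.2.1, add_mem h.2.2.1 h'.2.2.1,
    add_mem h.2.2.2 h'.2.2.2⟩
  smul_mem' r q h := by
    have key : ∀ c ∈ (algebraMap R K).range, r • c ∈ (algebraMap R K).range := fun c hc => by
      rw [Algebra.smul_def]; exact mul_mem ⟨r, rfl⟩ hc
    exact ⟨key _ h.1, key _ h.2.1, key _ h.2.2.1, key _ h.2.2.2⟩

theorem exists_smul_mem_quatLattice (R : Type*) {K : Type*} [CommRing R] [IsDomain R] [Field K]
    [Algebra R K] [IsFractionRing R K] {a b : K} (q : ℍ[K, a, 0, b]) :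
    ∃ d : R, d ≠ 0 ∧ d • q ∈ quatLattice R a b := by
  classical
  obtain ⟨d, hd⟩ := IsLocalization.exist_integer_multiples_of_finset (nonZeroDivisors R)
    ({q.re, q.imI, q.imJ, q.imK} : Finset K)
  refine ⟨d, nonZeroDivisors.ne_zero d.2, hd _ ?_, hd _ ?_, hd _ ?_, hd _ ?_⟩ <;> simp

/-- An order `S` in a ring `Q`, over a ring `R` with a distinguished element `π` (a uniformizer):
a finitely generated subalgebra which spans `Q`, and in which every element outside `π S` generates
the unit ideal. Azumaya algebras over a discrete valuation ring are of this form. -/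
structure IsAzumayaOrder {R Q : Type*} [CommRing R] [Ring Q] [Algebra R Q] (π : R)
    (S : Subalgebra R Q) : Prop where
  fg : (Subalgebra.toSubmodule S).FG
  exists_smul_mem : ∀ q : Q, ∃ r : R, r ≠ 0 ∧ r • q ∈ S
  simple : ∀ q ∈ S, (∃ q' ∈ S, q = π • q') ∨
    (1 : Q) ∈ AddSubmonoid.closure {z | ∃ s ∈ S, ∃ t ∈ S, z = s * q * t}

/-- An order in a quaternion algebra which is its own dual for the trace form
`(p, q) ↦ trd (p q)`. -/
structure IsSelfDualOrder {R K : Type*} [CommRing R] [CommRing K] [Algebra R K] {a b : K}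
    (S : Subalgebra R ℍ[K, a, 0, b]) : Prop where
  fg : (Subalgebra.toSubmodule S).FG
  mem_iff : ∀ q, q ∈ S ↔ ∀ s ∈ S, 2 * (q * s).re ∈ (algebraMap R K).range

/-- The quaternion algebras `(a, b)` and `(a', b')` are isomorphic, by an isomorphism which
preserves the real part. -/
def QuatIso {K : Type*} [Field K] (a b a' b' : K) : Prop :=
  ∃ φ : ℍ[K, a, 0, b] ≃ₐ[K] ℍ[K, a', 0, b'], ∀ q, (φ q).re = q.re

namespace QuatIso

variable {K : Type*} [Field K] {a b a' b' a'' b'' : K}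

theorem symm (h : QuatIso a b a' b') : QuatIso a' b' a b := by
  obtain ⟨φ, hφ⟩ := h
  exact ⟨φ.symm, fun q => by rw [← hφ, φ.apply_symm_apply]⟩

theorem trans (h : QuatIso a b a' b') (h' : QuatIso a' b' a'' b'') : QuatIso a b a'' b'' := by
  obtain ⟨φ, hφ⟩ := h
  obtain ⟨ψ, hψ⟩ := h'
  exact ⟨φ.trans ψ, fun q => by rw [AlgEquiv.trans_apply, hψ, hφ]⟩

theorem swap (a b : K) : QuatIso a b b a :=
  ⟨QuaternionAlgebra.swapEquiv a b, fun _ => rfl⟩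

theorem scale (a b : K) {c d : K} (hc : c ≠ 0) (hd : d ≠ 0) :
    QuatIso (c ^ 2 * a) (d ^ 2 * b) a b := by
  refine ⟨AlgEquiv.ofBijective
    { toFun := fun q => ⟨q.re, c * q.imI, d * q.imJ, c * d * q.imK⟩
      map_one' := by ext <;> simp
      map_zero' := by ext <;> simp
      map_add' := fun x y => by ext <;> simp [mul_add]
      map_mul' := fun x y => by ext <;> simp <;> ring
      commutes' := fun r => by ext <;> simp } ⟨?_, ?_⟩, fun _ => rfl⟩
  · intro x y h
    have h1 := congrArg QuaternionAlgebra.re h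
    have h2 := congrArg QuaternionAlgebra.imI h
    have h3 := congrArg QuaternionAlgebra.imJ h
    have h4 := congrArg QuaternionAlgebra.imK h
    exact QuaternionAlgebra.ext h1 (mul_left_cancel₀ hc h2) (mul_left_cancel₀ hd h3)
      (mul_left_cancel₀ (mul_ne_zero hc hd) h4)
  · intro q
    refine ⟨⟨q.re, c⁻¹ * q.imI, d⁻¹ * q.imJ, (c * d)⁻¹ * q.imK⟩, ?_⟩
    apply QuaternionAlgebra.ext <;> simp [hc, hd]
    field_simp

theorem neg_mul (b : K) (ha : a ≠ 0) : QuatIso a (-(a * b)) a b := by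
  refine ⟨AlgEquiv.ofBijective
    { toFun := fun q => ⟨q.re, q.imI, a * q.imK, q.imJ⟩
      map_one' := by ext <;> simp
      map_zero' := by ext <;> simp
      map_add' := fun x y => by ext <;> simp [mul_add]
      map_mul' := fun x y => by ext <;> simp <;> ring
      commutes' := fun r => by ext <;> simp } ⟨?_, ?_⟩, fun _ => rfl⟩
  · intro x y h
    have h1 := congrArg QuaternionAlgebra.re h
    have h2 := congrArg QuaternionAlgebra.imI h
    have h3 := congrArg QuaternionAlgebra.imJ h
    have h4 := congrArg QuaternionAlgebra.imK h
    exact QuaternionAlgebra.ext h1 h2 h4 (mul_left_cancel₀ ha h3)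
  · intro q
    refine ⟨⟨q.re, q.imI, q.imK, a⁻¹ * q.imJ⟩, ?_⟩
    apply QuaternionAlgebra.ext <;> simp [ha]

end QuatIso

section Transport

variable {R K : Type*} [CommRing R] [Field K] [Algebra R K] {a b a' b' : K}

theorem IsAzumayaOrder.of_quatIso (h : QuatIso a b a' b') {π : R} {S : Subalgebra R ℍ[K, a, 0, b]}
    (hS : IsAzumayaOrder π S) : ∃ S' : Subalgebra R ℍ[K, a', 0, b'], IsAzumayaOrder π S' := by
  obtain ⟨φ, -⟩ := h
  refine ⟨S.map (φ.restrictScalars R).toAlgHom, ?_, ?_, ?_⟩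
  · rw [Subalgebra.map_toSubmodule]
    exact hS.fg.map _
  · intro q
    obtain ⟨r, hr, hrq⟩ := hS.exists_smul_mem (φ.symm q)
    refine ⟨r, hr, r • φ.symm q, hrq, ?_⟩
    change (φ.restrictScalars R) (r • φ.symm q) = _
    rw [map_smul]
    exact congrArg (r • ·) (φ.apply_symm_apply q)
  · rintro _ ⟨q, hq, rfl⟩
    rcases hS.simple q hq with ⟨q', hq', rfl⟩ | h1
    · exact Or.inl ⟨_, ⟨q', hq', rfl⟩, map_smul (φ.restrictScalars R) π q'⟩
    · right
      have key : ∀ z ∈ AddSubmonoid.closure {z | ∃ s ∈ S, ∃ t ∈ S, z = s * q * t},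
          φ z ∈ AddSubmonoid.closure {z | ∃ s ∈ S.map (φ.restrictScalars R).toAlgHom,
            ∃ t ∈ S.map (φ.restrictScalars R).toAlgHom, z = s * φ q * t} := by
        intro z hz
        induction hz using AddSubmonoid.closure_induction with
        | mem z hz =>
          obtain ⟨s, hs, t, ht, rfl⟩ := hz
          exact AddSubmonoid.subset_closure ⟨φ s, ⟨s, hs, rfl⟩, φ t, ⟨t, ht, rfl⟩, by simp⟩
        | zero => rw [map_zero]; exact zero_mem _
        | add x y _ _ hx hy => rw [map_add]; exact add_mem hx hy
      have := key 1 h1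
      rwa [map_one] at this

theorem IsSelfDualOrder.of_quatIso (h : QuatIso a b a' b') {S : Subalgebra R ℍ[K, a, 0, b]}
    (hS : IsSelfDualOrder S) : ∃ S' : Subalgebra R ℍ[K, a', 0, b'], IsSelfDualOrder S' := by
  obtain ⟨φ, hφ⟩ := h
  refine ⟨S.map (φ.restrictScalars R).toAlgHom, ?_, ?_⟩
  · rw [Subalgebra.map_toSubmodule]
    exact hS.fg.map _
  · intro q
    obtain ⟨q, rfl⟩ := φ.surjective q
    have h1 : φ q ∈ S.map (φ.restrictScalars R).toAlgHom ↔ q ∈ S := by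
      constructor
      · rintro ⟨q', hq', h⟩
        rwa [← φ.injective h]
      · exact fun h => ⟨q, h, rfl⟩
    rw [h1, hS.mem_iff]
    constructor
    · rintro h _ ⟨s, hs, rfl⟩
      change 2 * (φ q * φ s).re ∈ _
      rw [← map_mul, hφ]
      exact h s hs
    · intro h s hs
      rw [← hφ, map_mul]
      exact h (φ s) ⟨s, hs, rfl⟩

end Transport

/-! ### Azumaya orders over a discrete valuation ring -/

section DVR

variable {R K : Type*} [CommRing R] [IsDomain R] [IsDiscreteValuationRing R] [Field K] [Algebra R K]
  [IsFractionRing R K] {π : R}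

omit [IsDomain R] [IsDiscreteValuationRing R] in
theorem algebraMap_uniformizer_ne_zero (hπ : Irreducible π) : algebraMap R K π ≠ 0 := by
  simpa using hπ.ne_zero

omit [IsDomain R] [IsDiscreteValuationRing R] in
theorem nonneg_of_unit_mul_zpow_mem_range (hπ : Irreducible π) (ε : Rˣ) (r : ℤ)
    (h : algebraMap R K ε * algebraMap R K π ^ r ∈ (algebraMap R K).range) : 0 ≤ r := by
  by_contra! hr
  obtain ⟨x, hx⟩ := h
  obtain ⟨n, rfl⟩ : ∃ n : ℕ, r = -((n : ℤ) + 1) := ⟨(-r - 1).toNat, by omega⟩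
  have hπ0 := algebraMap_uniformizer_ne_zero (K := K) hπ
  have h1 : algebraMap R K (x * π ^ (n + 1)) = algebraMap R K ε := by
    rw [map_mul, hx, map_pow, mul_assoc, zpow_neg, ← Nat.cast_succ, zpow_natCast,
      inv_mul_cancel₀ (pow_ne_zero _ hπ0), mul_one]
  have h2 := IsFractionRing.injective R K h1
  refine hπ.not_isUnit (isUnit_of_dvd_unit ⟨x * π ^ n, ?_⟩ ε.isUnit)
  rw [← h2]; ring

omit [IsDomain R] [IsDiscreteValuationRing R] [IsFractionRing R K] in
theorem zpow_mul_mem_range (x : R) {r : ℤ} (hr : 0 ≤ r) :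
    algebraMap R K π ^ r * algebraMap R K x ∈ (algebraMap R K).range := by
  obtain ⟨n, rfl⟩ := Int.eq_ofNat_of_zero_le hr
  exact ⟨π ^ n * x, by simp⟩

/-- A nonzero vector of `K²` is a power of the uniformizer times a unimodular vector of `R²`. -/
theorem exists_eq_zpow_mul_pair (hπ : Irreducible π) {α β : K} (h : α ≠ 0 ∨ β ≠ 0) :
    ∃ (t : ℤ) (x y : R), α = algebraMap R K π ^ t * algebraMap R K x ∧
      β = algebraMap R K π ^ t * algebraMap R K y ∧ (IsUnit x ∨ IsUnit y) := by
  have hπ0 := algebraMap_uniformizer_ne_zero (K := K) hπ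
  have key : ∀ α β : K, α ≠ 0 → (β ≠ 0 → ∃ (n m : ℤ) (u v : Rˣ), n ≤ m ∧
      α = algebraMap R K u * algebraMap R K π ^ n ∧
      β = algebraMap R K v * algebraMap R K π ^ m) →
      ∃ (t : ℤ) (x y : R), α = algebraMap R K π ^ t * algebraMap R K x ∧
      β = algebraMap R K π ^ t * algebraMap R K y ∧ IsUnit x := by
    intro α β hα hβ
    by_cases hβ0 : β = 0
    · obtain ⟨n, u, hu⟩ :=
        IsDiscreteValuationRing.exists_units_eq_smul_zpow_of_irreducible hπ hα
      refine ⟨n, u, 0, ?_, by simp [hβ0], u.isUnit⟩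
      rw [hu, Units.smul_def, Algebra.smul_def, mul_comm]
    · obtain ⟨n, m, u, v, hnm, h1, h2⟩ := hβ hβ0
      obtain ⟨d, hd⟩ := Int.eq_ofNat_of_zero_le (sub_nonneg.mpr hnm)
      refine ⟨n, u, v * π ^ d, by rw [h1, mul_comm], ?_, u.isUnit⟩
      obtain rfl : m = n + d := by omega
      rw [h2, zpow_add₀ hπ0, map_mul, map_pow, zpow_natCast]; ring
  by_cases hα : α = 0
  · obtain ⟨t, x, y, h1, h2, h3⟩ := key β α (h.resolve_left (by simpa using hα)) (by simp [hα])
    exact ⟨t, y, x, h2, h1, Or.inr h3⟩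
  by_cases hβ : β = 0
  · obtain ⟨t, x, y, h1, h2, h3⟩ := key α β hα (by simp [hβ])
    exact ⟨t, x, y, h1, h2, Or.inl h3⟩
  obtain ⟨n, u, hu⟩ := IsDiscreteValuationRing.exists_units_eq_smul_zpow_of_irreducible hπ hα
  obtain ⟨m, v, hv⟩ := IsDiscreteValuationRing.exists_units_eq_smul_zpow_of_irreducible hπ hβ
  rw [Units.smul_def, Algebra.smul_def] at hu hv
  rcases le_total n m with hnm | hnm
  · obtain ⟨t, x, y, h1, h2, h3⟩ := key α β hα fun _ => ⟨n, m, u, v, hnm, hu, hv⟩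
    exact ⟨t, x, y, h1, h2, Or.inl h3⟩
  · obtain ⟨t, x, y, h1, h2, h3⟩ := key β α hβ fun _ => ⟨m, n, v, u, hnm, hv, hu⟩
    exact ⟨t, y, x, h2, h1, Or.inr h3⟩

open IsLocalRing in
/-- If the residue class of `w` is not a square, the binary form `α² - w β²` is anisotropic modulo
the maximal ideal. -/
theorem isUnit_sq_sub_of_not_isSquare {w : Rˣ} (hw : ¬ IsSquare (residue R w)) {x y : R}
    (h : IsUnit x ∨ IsUnit y) : IsUnit (x ^ 2 - w * y ^ 2) := by
  rw [← residue_ne_zero_iff_isUnit]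
  intro h0
  rw [map_sub, map_mul, map_pow, map_pow, sub_eq_zero] at h0
  by_cases hy : IsUnit y
  · apply hw
    have hy0 := (residue_ne_zero_iff_isUnit y).mpr hy
    refine ⟨residue R x / residue R y, ?_⟩
    field_simp
    exact h0.symm
  · have hx := (residue_ne_zero_iff_isUnit x).mpr (h.resolve_right hy)
    have hy0 : residue R y = 0 := by
      by_contra hne
      exact hy ((residue_ne_zero_iff_isUnit y).mp hne)
    rw [hy0] at h0
    simp [hx] at h0

/-- If the residue class of `w` is not a square, the valuation of the reduced norm of the
quaternion algebra `(uπ, w)` is determined by the valuations of the coordinates, the two halves of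
the norm form having valuations of different parity. -/
theorem exists_quatNorm_eq (hπ : Irreducible π) {u w : Rˣ}
    (hw : ¬ IsSquare (IsLocalRing.residue R w))
    {q : ℍ[K, algebraMap R K (u * π), 0, algebraMap R K w]} (hq : q ≠ 0) :
    ∃ (r t s : ℤ) (ε : Rˣ) (x₀ x₁ x₂ x₃ : R),
      quatNorm q = algebraMap R K ε * algebraMap R K π ^ r ∧ r ≤ 2 * t ∧ r ≤ 2 * s + 1 ∧
      q.re = algebraMap R K π ^ t * algebraMap R K x₀ ∧
      q.imI = algebraMap R K π ^ s * algebraMap R K x₁ ∧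
      q.imJ = algebraMap R K π ^ t * algebraMap R K x₂ ∧
      q.imK = algebraMap R K π ^ s * algebraMap R K x₃ := by
  have hπ0 := algebraMap_uniformizer_ne_zero (K := K) hπ
  have hN : quatNorm q = (q.re ^ 2 - algebraMap R K w * q.imJ ^ 2) -
      algebraMap R K u * algebraMap R K π * (q.imI ^ 2 - algebraMap R K w * q.imK ^ 2) := by
    rw [quatNorm]
    linear_combination (algebraMap R K w * q.imK ^ 2 - q.imI ^ 2) *
      map_mul (algebraMap R K) (u : R) π
  by_cases h1 : q.re ≠ 0 ∨ q.imJ ≠ 0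
  · obtain ⟨t, x₀, x₂, h0, h2, hu⟩ := exists_eq_zpow_mul_pair (R := R) hπ h1
    have hε := isUnit_sq_sub_of_not_isSquare hw hu
    by_cases h3 : q.imI ≠ 0 ∨ q.imK ≠ 0
    · obtain ⟨s, x₁, x₃, h4, h5, hu'⟩ := exists_eq_zpow_mul_pair (R := R) hπ h3
      have hε' := isUnit_sq_sub_of_not_isSquare hw hu'
      rcases lt_or_ge (2 * t) (2 * s + 1) with hlt | hge
      · obtain ⟨d, hd⟩ : ∃ d : ℕ, 2 * s + 1 = 2 * t + ((d : ℤ) + 1) :=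
          ⟨(2 * s - 2 * t).toNat, by omega⟩
        have hunit : IsUnit (x₀ ^ 2 - w * x₂ ^ 2 - π * (u * π ^ d * (x₁ ^ 2 - w * x₃ ^ 2))) := by
          by_contra hnu
          have hmem := IsLocalRing.mem_maximalIdeal _ |>.mpr hnu
          have hmem2 : π * (u * π ^ d * (x₁ ^ 2 - w * x₃ ^ 2)) ∈ IsLocalRing.maximalIdeal R :=
            Ideal.mul_mem_right _ _ (IsLocalRing.mem_maximalIdeal _ |>.mpr hπ.not_isUnit)
          have := Ideal.add_mem _ hmem hmem2
          rw [sub_add_cancel] at this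
          exact this hε
        refine ⟨2 * t, t, s, hunit.unit, x₀, x₁, x₂, x₃, ?_, le_rfl, hlt.le, h0, h4, h2, h5⟩
        have e1 : algebraMap R K π * (algebraMap R K π ^ s) ^ 2 =
            (algebraMap R K π ^ t) ^ 2 * algebraMap R K π ^ (d + 1) := by
          rw [← zpow_natCast, ← zpow_natCast, ← zpow_natCast, ← zpow_mul, ← zpow_mul,
            ← zpow_one_add₀ hπ0, ← zpow_add₀ hπ0]
          congr 1; push_cast; omega
        rw [hN, h0, h2, h4, h5, IsUnit.unit_spec, show (2 : ℤ) * t = t * (2 : ℕ) by push_cast; ring,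
          zpow_mul, zpow_natCast]
        simp only [map_sub, map_mul, map_pow]
        linear_combination (- algebraMap R K u *
          (algebraMap R K x₁ ^ 2 - algebraMap R K w * algebraMap R K x₃ ^ 2)) * e1
      · obtain ⟨d, hd⟩ : ∃ d : ℕ, 2 * t = 2 * s + 1 + ((d : ℤ) + 1) :=
          ⟨(2 * t - 2 * s - 2).toNat, by omega⟩
        have hunit : IsUnit (π * (π ^ d * (x₀ ^ 2 - w * x₂ ^ 2)) - u * (x₁ ^ 2 - w * x₃ ^ 2)) := by
          by_contra hnu
          have hmem := IsLocalRing.mem_maximalIdeal _ |>.mpr hnu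
          have hmem2 : π * (π ^ d * (x₀ ^ 2 - w * x₂ ^ 2)) ∈ IsLocalRing.maximalIdeal R :=
            Ideal.mul_mem_right _ _ (IsLocalRing.mem_maximalIdeal _ |>.mpr hπ.not_isUnit)
          have := Ideal.sub_mem _ hmem2 hmem
          rw [sub_sub_cancel] at this
          exact this (u.isUnit.mul hε')
        refine ⟨2 * s + 1, t, s, hunit.unit, x₀, x₁, x₂, x₃, ?_, hge, le_rfl, h0, h4, h2, h5⟩
        have e1 : (algebraMap R K π ^ t) ^ 2 =
            algebraMap R K π * (algebraMap R K π ^ s) ^ 2 * algebraMap R K π ^ (d + 1) := by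
          rw [← zpow_natCast, ← zpow_natCast, ← zpow_natCast, ← zpow_mul, ← zpow_mul,
            ← zpow_one_add₀ hπ0, ← zpow_add₀ hπ0]
          congr 1; push_cast; omega
        rw [hN, h0, h2, h4, h5, IsUnit.unit_spec,
          show (2 : ℤ) * s + 1 = 1 + s * (2 : ℕ) by push_cast; ring,
          zpow_one_add₀ hπ0, zpow_mul, zpow_natCast]
        simp only [map_sub, map_mul, map_pow]
        linear_combination
          (algebraMap R K x₀ ^ 2 - algebraMap R K w * algebraMap R K x₂ ^ 2) * e1
    · push Not at h3
      -- the coordinates `i` and `l` vanish, so any exponent `s ≥ t` does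
      refine ⟨2 * t, t, |t|, hε.unit, x₀, 0, x₂, 0, ?_, le_rfl,
        by have := le_abs_self t; omega, h0, by simp [h3.1], h2, by simp [h3.2]⟩
      rw [hN, h0, h2, h3.1, h3.2, IsUnit.unit_spec,
        show (2 : ℤ) * t = t * (2 : ℕ) by push_cast; ring, zpow_mul, zpow_natCast]
      simp only [map_sub, map_mul, map_pow]
      ring
  · push Not at h1
    have h3 : q.imI ≠ 0 ∨ q.imK ≠ 0 := by
      by_contra! h3
      exact hq (QuaternionAlgebra.ext h1.1 h3.1 h1.2 h3.2)
    obtain ⟨s, x₁, x₃, h4, h5, hu'⟩ := exists_eq_zpow_mul_pair (R := R) hπ h3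
    have hε' := isUnit_sq_sub_of_not_isSquare hw hu'
    refine ⟨2 * s + 1, |s| + 1, s, - (u * hε'.unit), 0, x₁, 0, x₃, ?_,
      by have := le_abs_self s; omega, le_rfl, by simp [h1.1], h4, by simp [h1.2], h5⟩
    rw [hN, h1.1, h1.2, h4, h5, Units.val_neg, Units.val_mul, IsUnit.unit_spec,
      show (2 : ℤ) * s + 1 = 1 + s * (2 : ℕ) by push_cast; ring,
      zpow_one_add₀ hπ0, zpow_mul, zpow_natCast]
    simp only [map_sub, map_mul, map_pow, map_neg]
    ring

/-- In the quaternion algebra `(uπ, w)`, with `w` a nonsquare modulo `π`, the elements of integral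
norm have integral coordinates, so they form the unique maximal order. An Azumaya order `S` would be
contained in it, and the elements of `S` of norm divisible by `π` would form an ideal of `S`, equal
to `πS`. Then all norms of elements of `S` would have even valuation, which the multiples of `i` in
`S` contradict. -/
theorem IsAzumayaOrder.isSquare_residue (hπ : Irreducible π) {u w : Rˣ}
    {S : Subalgebra R ℍ[K, algebraMap R K (u * π), 0, algebraMap R K w]}
    (hS : IsAzumayaOrder π S) : IsSquare (IsLocalRing.residue R w) := by
  by_contra hw
  have hπ0 := algebraMap_uniformizer_ne_zero (K := K) hπ
  obtain ⟨d, hd0, hd⟩ := hS.fg.exists_smul_mem (quatLattice R _ _)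
    (exists_smul_mem_quatLattice R)
  obtain ⟨m, δ, hδ⟩ := IsDiscreteValuationRing.eq_unit_mul_pow_irreducible hd0 hπ
  -- the norms of the elements of `S` have bounded denominators, and `S` is closed under powers
  have hint : ∀ q ∈ S, ∀ (r : ℤ) (ε : Rˣ),
      quatNorm q = algebraMap R K ε * algebraMap R K π ^ r → 0 ≤ r := by
    intro q hq r ε hr
    have h1 : ∀ n : ℕ, 0 ≤ 2 * m + n * r := by
      intro n
      have h2 := hd (q ^ n) (pow_mem hq n)
      have h3 : quatNorm (d • q ^ n) ∈ (algebraMap R K).range :=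
        add_mem (sub_mem (sub_mem (pow_mem h2.1 _) (mul_mem ⟨_, rfl⟩ (pow_mem h2.2.1 _)))
          (mul_mem ⟨_, rfl⟩ (pow_mem h2.2.2.1 _)))
          (mul_mem (mul_mem ⟨_, rfl⟩ ⟨_, rfl⟩) (pow_mem h2.2.2.2 _))
      rw [← algebraMap_smul K d, quatNorm_smul, quatNorm_pow, hr, hδ] at h3
      refine nonneg_of_unit_mul_zpow_mem_range (K := K) hπ (δ ^ 2 * ε ^ n) _ ?_
      convert h3 using 1
      rw [zpow_add₀ hπ0, mul_comm (n : ℤ), zpow_mul, zpow_mul, zpow_natCast, zpow_natCast]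
      push_cast
      rw [show algebraMap R K π ^ (2 : ℤ) = algebraMap R K π ^ 2 from zpow_ofNat _ 2]
      ring
    by_contra! hneg
    have := h1 (2 * m + 1)
    push_cast at this
    nlinarith
  -- if `q` has norm divisible by `π`, then so have all `s q t`, which makes their real parts
  -- divisible by `π`: sums of such elements are never `1`
  have hJ : ∀ q ∈ S, ∀ (r : ℤ) (ε : Rˣ),
      quatNorm q = algebraMap R K ε * algebraMap R K π ^ r → 1 ≤ r → ∃ q' ∈ S, q = π • q' := by
    intro q hq r ε hr hr1
    refine (hS.simple q hq).resolve_right fun h1 => ?_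
    have key : ∀ z ∈ AddSubmonoid.closure {z | ∃ s ∈ S, ∃ t ∈ S, z = s * q * t},
        (∃ x : R, z.re = algebraMap R K (π * x)) ∧ z.imI ∈ (algebraMap R K).range ∧
        (∃ x : R, z.imJ = algebraMap R K (π * x)) ∧ z.imK ∈ (algebraMap R K).range := by
      intro z hz
      induction hz using AddSubmonoid.closure_induction with
      | mem z hz =>
        obtain ⟨s, hs, t, ht, rfl⟩ := hz
        by_cases h0 : s * q * t = 0
        · rw [h0]
          exact ⟨⟨0, by simp⟩, zero_mem _, ⟨0, by simp⟩, zero_mem _⟩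
        have ht0 : t ≠ 0 := by rintro rfl; simp at h0
        have hs0 : s ≠ 0 := by rintro rfl; simp at h0
        obtain ⟨rs, -, -, εs, -, -, -, -, hNs, -⟩ := exists_quatNorm_eq hπ hw hs0
        obtain ⟨rt, -, -, εt, -, -, -, -, hNt, -⟩ := exists_quatNorm_eq hπ hw ht0
        obtain ⟨r', a, b, ε', x₀, x₁, x₂, x₃, hN, ha, hb, h0, h1, h2, h3⟩ :=
          exists_quatNorm_eq hπ hw h0
        have hrs := hint s hs _ _ hNs
        have hrt := hint t ht _ _ hNt
        have hr' : 0 ≤ r' - 1 := by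
          refine nonneg_of_unit_mul_zpow_mem_range (K := K) hπ ε' _ ?_
          rw [zpow_sub_one₀ hπ0, ← mul_assoc, ← hN, quatNorm_mul, quatNorm_mul, hNs, hNt, hr]
          have := zpow_mul_mem_range (K := K) (π := π) (εs * ε * εt : R)
            (show 0 ≤ rs + (r - 1) + rt by omega)
          convert this using 1
          rw [zpow_add₀ hπ0, zpow_add₀ hπ0, zpow_sub_one₀ hπ0]
          simp only [map_mul]
          ring
        have hpi : ∀ x : R, algebraMap R K π ^ a * algebraMap R K x =
            algebraMap R K (π * (π ^ (a - 1).toNat * x)) := by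
          intro x
          obtain ⟨n, rfl⟩ : ∃ n : ℕ, a = n + 1 := ⟨(a - 1).toNat, by omega⟩
          rw [zpow_add_one₀ hπ0]
          simp
          ring
        rw [h0, h1, h2, h3]
        exact ⟨⟨_, hpi _⟩, zpow_mul_mem_range _ (by omega), ⟨_, hpi _⟩,
          zpow_mul_mem_range _ (by omega)⟩
      | zero => exact ⟨⟨0, by simp⟩, zero_mem _, ⟨0, by simp⟩, zero_mem _⟩
      | add x y _ _ hx hy =>
        obtain ⟨⟨x₀, hx₀⟩, hx₁, ⟨x₂, hx₂⟩, hx₃⟩ := hx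
        obtain ⟨⟨y₀, hy₀⟩, hy₁, ⟨y₂, hy₂⟩, hy₃⟩ := hy
        refine ⟨⟨x₀ + y₀, ?_⟩, add_mem hx₁ hy₁, ⟨x₂ + y₂, ?_⟩, add_mem hx₃ hy₃⟩
        · rw [QuaternionAlgebra.re_add, hx₀, hy₀, ← map_add, mul_add]
        · rw [QuaternionAlgebra.imJ_add, hx₂, hy₂, ← map_add, mul_add]
    obtain ⟨⟨x, hx⟩, -⟩ := key 1 h1
    rw [QuaternionAlgebra.re_one, ← map_one (algebraMap R K)] at hx
    exact hπ.not_isUnit (IsUnit.of_mul_eq_one _ (IsFractionRing.injective R K hx).symm)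
  have hodd : ∀ (n : ℕ) (ε : Rˣ), ∀ q ∈ S,
      quatNorm q ≠ algebraMap R K ε * algebraMap R K π ^ (2 * n + 1 : ℤ) := by
    intro n ε
    induction n with
    | zero =>
      intro q hq h
      obtain ⟨q', hq', rfl⟩ := hJ q hq _ ε h (by simp)
      rw [← algebraMap_smul K π, quatNorm_smul] at h
      have h1 : quatNorm q' = algebraMap R K ε * algebraMap R K π ^ (-1 : ℤ) := by
        refine mul_left_cancel₀ (pow_ne_zero 2 hπ0) (h.trans ?_)
        simp
        field_simp
      have := hint q' hq' _ ε h1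
      omega
    | succ n ih =>
      intro q hq h
      obtain ⟨q', hq', rfl⟩ := hJ q hq _ ε h (by push_cast; omega)
      refine ih q' hq' (mul_left_cancel₀ (pow_ne_zero 2 hπ0) ?_)
      rw [← quatNorm_smul, algebraMap_smul, h, mul_left_comm, ← zpow_natCast, ← zpow_add₀ hπ0]
      congr 2
      push_cast
      ring
  obtain ⟨r, hr0, hr⟩ := hS.exists_smul_mem ⟨0, 1, 0, 0⟩
  obtain ⟨n, δ', hδ'⟩ := IsDiscreteValuationRing.eq_unit_mul_pow_irreducible hr0 hπ
  refine hodd n (-(δ' ^ 2 * u)) _ hr ?_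
  rw [← algebraMap_smul K r, quatNorm_smul, hδ', zpow_add₀ hπ0, zpow_mul, zpow_natCast, zpow_one,
    show algebraMap R K π ^ (2 : ℤ) = algebraMap R K π ^ 2 from zpow_ofNat _ 2]
  simp [quatNorm]
  ring

end DVR

/-! ### Self-dual orders over a discrete valuation ring -/

section Construction

variable {R K : Type*} [CommRing R] [Field K] [Algebra R K]

theorem mem_range_of_two_mul_unit_mul_mem (h2 : IsUnit (2 : R)) (v : Rˣ) {c : K}
    (h : 2 * (algebraMap R K v * c) ∈ (algebraMap R K).range) : c ∈ (algebraMap R K).range := by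
  obtain ⟨r, hr⟩ := h
  refine ⟨↑(h2.unit * v)⁻¹ * r, ?_⟩
  have hne : algebraMap R K ↑(h2.unit * v) ≠ 0 := ((h2.unit * v).isUnit.map _).ne_zero
  refine mul_left_cancel₀ hne ?_
  rw [← map_mul, Units.mul_inv_cancel_left, hr, Units.val_mul, IsUnit.unit_spec, map_mul,
    map_ofNat, mul_assoc]

/-- The order `R ⊕ Ri ⊕ Rj ⊕ Rl` in the quaternion algebra `(u, w)` over the fraction field, for
units `u` and `w`. -/
theorem exists_isSelfDualOrder_of_units (h2 : IsUnit (2 : R)) (u w : Rˣ) :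
    ∃ S : Subalgebra R ℍ[K, algebraMap R K u, 0, algebraMap R K w], IsSelfDualOrder S := by
  let φ : ℍ[R, (u : R), 0, (w : R)] →ₐ[R] ℍ[K, algebraMap R K u, 0, algebraMap R K w] :=
    { toFun := fun q => ⟨algebraMap R K q.re, algebraMap R K q.imI, algebraMap R K q.imJ,
        algebraMap R K q.imK⟩
      map_one' := by ext <;> simp
      map_zero' := by ext <;> simp
      map_add' := fun x y => by ext <;> simp
      map_mul' := fun x y => by ext <;> simp
      commutes' := fun r => by
        rw [IsScalarTower.algebraMap_apply R K ℍ[K, algebraMap R K u, 0, algebraMap R K w]]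
        ext <;> simp }
  refine ⟨φ.range, ?_, fun q => ⟨?_, fun h => ?_⟩⟩
  · change (LinearMap.range φ.toLinearMap).FG
    exact Module.Finite.iff_fg.mp inferInstance
  · rintro ⟨q, rfl⟩ _ ⟨s, rfl⟩
    refine ⟨2 * (q * s).re, ?_⟩
    rw [map_mul, map_ofNat]
    congr 1
    exact congrArg QuaternionAlgebra.re (map_mul φ q s)
  · have hunit : ∀ (c : K) (v : Rˣ), 2 * (algebraMap R K v * c) ∈ (algebraMap R K).range →
        c ∈ (algebraMap R K).range := fun c v => mem_range_of_two_mul_unit_mul_mem h2 v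
    obtain ⟨r₀, h₀⟩ := hunit q.re 1 (by
      have := h _ ⟨⟨1, 0, 0, 0⟩, rfl⟩
      simpa [φ] using this)
    obtain ⟨r₁, h₁⟩ := hunit q.imI u (by
      have := h _ ⟨⟨0, 1, 0, 0⟩, rfl⟩
      simpa [φ] using this)
    obtain ⟨r₂, h₂⟩ := hunit q.imJ w (by
      have := h _ ⟨⟨0, 0, 1, 0⟩, rfl⟩
      simpa [φ] using this)
    obtain ⟨r₃, h₃⟩ := hunit q.imK (-(u * w)) (by
      have := h _ ⟨⟨0, 0, 0, 1⟩, rfl⟩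
      simpa [φ] using this)
    exact ⟨⟨r₀, r₁, r₂, r₃⟩, QuaternionAlgebra.ext h₀ h₁ h₂ h₃⟩

/-- If `w ≡ s²` modulo `π`, the quaternions `1`, `j`, `i` and `i (j - s) / π` span a self-dual order
in the quaternion algebra `(uπ, w)`: the reduced norm of `i (j - s) / π` is `u (w - s²) / π`. -/
theorem exists_isSelfDualOrder_of_sq_add_mul (h2 : IsUnit (2 : R)) {π s t : R} {u w : Rˣ}
    (hπ : algebraMap R K π ≠ 0) (hs : IsUnit s) (hw : (w : R) = s ^ 2 + π * t) :
    ∃ S : Subalgebra R ℍ[K, algebraMap R K (u * π), 0, algebraMap R K w], IsSelfDualOrder S := by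
  let e : R × R × R × R →ₗ[R] ℍ[K, algebraMap R K (u * π), 0, algebraMap R K w] :=
    { toFun := fun v => ⟨algebraMap R K v.1,
        algebraMap R K v.2.1 - algebraMap R K (s * v.2.2.2) / algebraMap R K π,
        algebraMap R K v.2.2.1, algebraMap R K v.2.2.2 / algebraMap R K π⟩
      map_add' := fun x y => by ext <;> simp <;> ring
      map_smul' := fun r x => by
        apply QuaternionAlgebra.ext <;> refine Eq.trans ?_ (Algebra.smul_def r (_ : K)).symm <;>
          simp <;> ring }
  have hw' : algebraMap R K w = algebraMap R K s ^ 2 + algebraMap R K π * algebraMap R K t := by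
    rw [hw]; simp
  let S : Subalgebra R ℍ[K, algebraMap R K (u * π), 0, algebraMap R K w] :=
    { LinearMap.range e with
      mul_mem' := by
        rintro _ _ ⟨⟨r, x, y, d⟩, rfl⟩ ⟨⟨r', x', y', d'⟩, rfl⟩
        refine ⟨⟨r * r' + w * y * y' + u * (π * x * x' - s * (x * d' + x' * d) - t * d * d'),
          r * x' + r' * x + s * (x * y' - y * x') + t * (d * y' - y * d'),
          r * y' + y * r' + u * (x * d' - x' * d),
          r * d' + d * r' + π * (x * y' - y * x') - s * (d * y' - y * d')⟩, ?_⟩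
        apply QuaternionAlgebra.ext
        · simp [e, hw']; field_simp; ring
        · simp [e, hw']; field_simp; ring
        · simp [e]; field_simp; ring
        · simp [e]; field_simp; ring
      algebraMap_mem' := by
        intro r
        refine ⟨⟨r, 0, 0, 0⟩, ?_⟩
        rw [IsScalarTower.algebraMap_apply R K ℍ[K, algebraMap R K (u * π), 0, algebraMap R K w]]
        ext <;> simp [e] }
  refine ⟨S, ?_, fun q => ⟨?_, fun h => ?_⟩⟩
  · change (LinearMap.range e).FG
    exact Module.Finite.iff_fg.mp inferInstance
  · intro hq p hp
    obtain ⟨⟨r, x, y, d⟩, h⟩ := S.mul_mem hq hp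
    refine ⟨2 * r, ?_⟩
    rw [← h, map_mul, map_ofNat]
    rfl
  · have hunit : ∀ (c : K) (v : Rˣ), 2 * (algebraMap R K v * c) ∈ (algebraMap R K).range →
        c ∈ (algebraMap R K).range := fun c v => mem_range_of_two_mul_unit_mul_mem h2 v
    obtain ⟨r, h₀⟩ := hunit q.re 1 (by
      have := h _ ⟨⟨1, 0, 0, 0⟩, rfl⟩
      simpa [e] using this)
    obtain ⟨y, h₂⟩ := hunit q.imJ w (by
      have := h _ ⟨⟨0, 0, 1, 0⟩, rfl⟩
      simpa [e] using this)
    obtain ⟨g, h₁⟩ := hunit (algebraMap R K π * q.imI) u (by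
      have := h _ ⟨⟨0, 1, 0, 0⟩, rfl⟩
      simpa [e, mul_assoc] using this)
    obtain ⟨c, h₃⟩ := hunit (algebraMap R K s * q.imI + algebraMap R K w * q.imK) (-u) (by
      have := h _ ⟨⟨0, 0, 0, 1⟩, rfl⟩
      convert this using 2
      simp [e]
      field_simp
      ring)
    -- as `w` and `s` are units, the coordinates `x` and `d` of `q` at `i` and `i (j - s) / π` are
    -- integral
    have hd : algebraMap R K π * q.imK = algebraMap R K (↑w⁻¹ * (π * c - s * g)) := by
      have hne : algebraMap R K w ≠ 0 := (w.isUnit.map _).ne_zero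
      refine mul_left_cancel₀ hne ?_
      rw [← map_mul, Units.mul_inv_cancel_left, map_sub, map_mul _ π c, map_mul _ s g, h₃, h₁]
      ring
    have hx : q.imI + algebraMap R K s * q.imK =
        algebraMap R K (↑hs.unit⁻¹ * (c - t * (↑w⁻¹ * (π * c - s * g)))) := by
      have hne : algebraMap R K s ≠ 0 := (hs.map _).ne_zero
      refine mul_left_cancel₀ hne ?_
      rw [← map_mul, ← mul_assoc, hs.mul_val_inv, one_mul, map_sub, h₃, map_mul _ t, ← hd]
      linear_combination -q.imK * hw'
    refine ⟨⟨r, ↑hs.unit⁻¹ * (c - t * (↑w⁻¹ * (π * c - s * g))), y,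
      ↑w⁻¹ * (π * c - s * g)⟩, QuaternionAlgebra.ext h₀ ?_ h₂ ?_⟩
    · change algebraMap R K _ - algebraMap R K (s * _) / algebraMap R K π = _
      rw [map_mul _ s, ← hd, ← hx]
      field_simp
      ring
    · change algebraMap R K _ / algebraMap R K π = _
      rw [← hd]
      field_simp

end Construction

/-! ### The tame symbol and quaternion algebras over a discrete valuation ring -/

section Dichotomy

variable {R K : Type*} [CommRing R] [Field K] [Algebra R K]

/-- The unit that represents the tame symbol of `u π ^ m` and `w π ^ n`. -/
theorem algebraMap_units_eq_tameSymbol {π : R} (hπ : algebraMap R K π ≠ 0) {a b : K} {u w : Rˣ}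
    {m n : ℤ} (ha : a = algebraMap R K u * algebraMap R K π ^ m)
    (hb : b = algebraMap R K w * algebraMap R K π ^ n) :
    algebraMap R K ↑((-1) ^ (m * n) * u ^ n * w ^ (-m) : Rˣ) =
      (-1) ^ (m * n) * a ^ n * b ^ (-m) := by
  have h : ∀ v : Rˣ, algebraMap R K v = (Units.map (algebraMap R K : R →* K) v : Kˣ) :=
    fun _ => rfl
  rw [h, ha, hb]
  simp only [map_mul, map_zpow, Units.val_mul, Units.val_zpow_eq_zpow_val, Units.coe_map, mul_zpow]
  rw [← zpow_mul, ← zpow_mul, show (n * -m : ℤ) = -(m * n) by ring, zpow_neg _ (m * n)]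
  have h0 : algebraMap R K π ^ (m * n) ≠ 0 := zpow_ne_zero _ hπ
  have h1 : ((Units.map (algebraMap R K : R →* K) (-1 : Rˣ) : Kˣ) : K) = -1 := by simp
  simp only [Units.val_neg, Units.val_one] at h1 ⊢
  field_simp
  simp

/-- The tame symbol of `uπᵐ` and `wπⁿ` is the class of `(-1)^(mn) uⁿ w^(-m)`. According to the
parities of `m` and `n`, the quaternion algebra is isomorphic to one of the form `(u', w')`, and the
tame symbol is a square, or to one of the form `(u'π, w')`, and the tame symbol is `w'`, up to
squares. -/
theorem quatIso_dichotomy (hinj : Function.Injective (algebraMap R K)) {π : R} (hπ : π ≠ 0)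
    {u w : Rˣ} {m n : ℤ} {a b : K} (ha : a = algebraMap R K u * algebraMap R K π ^ m)
    (hb : b = algebraMap R K w * algebraMap R K π ^ n) {s : Rˣ}
    (hs : algebraMap R K s = (-1) ^ (m * n) * a ^ n * b ^ (-m)) :
    (∃ u' w' : Rˣ, QuatIso a b (algebraMap R K u') (algebraMap R K w') ∧ IsSquare s) ∨
    ∃ u' w' v : Rˣ, QuatIso a b (algebraMap R K (u' * π)) (algebraMap R K w') ∧
      s = v ^ 2 * w' := by
  have hπ0 : algebraMap R K π ≠ 0 := by rwa [Ne, map_eq_zero_iff _ hinj]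
  have hs' : s = (-1) ^ (m * n) * u ^ n * w ^ (-m) := by
    apply Units.map_injective (f := (algebraMap R K : R →* K)) hinj
    ext
    exact hs.trans (algebraMap_units_eq_tameSymbol hπ0 ha hb).symm
  have hsq : ∀ k : ℤ, algebraMap R K π ^ (2 * k) = (algebraMap R K π ^ k) ^ 2 := fun k => by
    rw [mul_comm, zpow_mul]; exact zpow_ofNat _ 2
  have hodd : ∀ k : ℤ, algebraMap R K π ^ (2 * k + 1) =
      (algebraMap R K π ^ k) ^ 2 * algebraMap R K π := fun k => by
    rw [zpow_add_one₀ hπ0, hsq]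
  have hk : ∀ k : ℤ, algebraMap R K π ^ k ≠ 0 := fun k => zpow_ne_zero _ hπ0
  obtain ⟨m, rfl | rfl⟩ := Int.even_or_odd' m <;> obtain ⟨n, rfl | rfl⟩ := Int.even_or_odd' n
  · refine Or.inl ⟨u, w, ?_, u ^ n * w ^ (-m), ?_⟩
    · rw [ha, hb, hsq, hsq, mul_comm, mul_comm (algebraMap R K w)]
      exact QuatIso.scale _ _ (hk m) (hk n)
    · rw [hs', Even.neg_one_zpow ⟨m * (2 * n), by ring⟩]
      rw [one_mul, mul_mul_mul_comm, ← zpow_add, ← zpow_add]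
      congr 2 <;> ring
  · refine Or.inr ⟨w, u, u ^ n * w ^ (-m), ?_, ?_⟩
    · rw [ha, hb, hsq, hodd, mul_comm, map_mul, mul_left_comm]
      exact (QuatIso.scale _ _ (hk m) (hk n)).trans (QuatIso.swap _ _)
    · rw [hs', Even.neg_one_zpow ⟨m * (2 * n + 1), by ring⟩]
      rw [mul_pow, ← zpow_natCast, ← zpow_natCast, ← zpow_mul, ← zpow_mul, one_mul,
        mul_right_comm, ← zpow_add_one]
      congr 2 <;> push_cast <;> ring
  · refine Or.inr ⟨u, w, u ^ n * w ^ (-m - 1), ?_, ?_⟩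
    · rw [ha, hb, hsq, hodd, mul_comm (algebraMap R K w), map_mul, mul_left_comm]
      exact QuatIso.scale _ _ (hk m) (hk n)
    · rw [hs', Even.neg_one_zpow ⟨(2 * m + 1) * n, by ring⟩]
      rw [mul_pow, ← zpow_natCast, ← zpow_natCast, ← zpow_mul, ← zpow_mul, one_mul, mul_assoc,
        ← zpow_add_one]
      congr 2 <;> push_cast <;> ring
  · refine Or.inr ⟨u, -(u * w), u ^ n * w ^ (-m - 1), ?_, ?_⟩
    · rw [ha, hb, hodd, hodd, map_mul, mul_left_comm, mul_left_comm (algebraMap R K w)]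
      refine (QuatIso.scale _ _ (hk m) (hk n)).trans ((QuatIso.neg_mul _ ?_).symm.trans ?_)
      · exact mul_ne_zero (u.isUnit.map _).ne_zero hπ0
      · have := QuatIso.scale (algebraMap R K u * algebraMap R K π)
          (algebraMap R K ↑(-(u * w))) one_ne_zero hπ0
        convert this using 1
        · ring
        · rw [Units.val_neg, Units.val_mul, map_neg, map_mul]; ring
    · rw [hs', Odd.neg_one_zpow ⟨2 * m * n + m + n, by ring⟩]
      rw [mul_pow, ← zpow_natCast, ← zpow_natCast, ← zpow_mul, ← zpow_mul, mul_neg,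
        mul_mul_mul_comm, ← zpow_add_one, ← zpow_add_one, mul_assoc, neg_one_mul]
      congr 3 <;> push_cast <;> ring

end Dichotomy

section DVR

variable {R K : Type*} [CommRing R] [IsDomain R] [IsDiscreteValuationRing R] [Field K] [Algebra R K]
  [IsFractionRing R K] {π : R} {u w s : Rˣ} {m n : ℤ} {a b : K}

/-- If the quaternion algebra `(a, b)` over the fraction field of a discrete valuation ring contains
an Azumaya order, then the tame symbol of `a` and `b` is a square. -/
theorem IsAzumayaOrder.isSquare_residue_tameSymbol (hπ : Irreducible π)
    (ha : a = algebraMap R K u * algebraMap R K π ^ m)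
    (hb : b = algebraMap R K w * algebraMap R K π ^ n)
    (hs : algebraMap R K s = (-1) ^ (m * n) * a ^ n * b ^ (-m)) {S : Subalgebra R ℍ[K, a, 0, b]}
    (hS : IsAzumayaOrder π S) : IsSquare (IsLocalRing.residue R s) := by
  obtain ⟨u', w', -, h⟩ | ⟨u', w', v, h, rfl⟩ :=
    quatIso_dichotomy (IsFractionRing.injective R K) hπ.ne_zero ha hb hs
  · exact (h.map (Units.coeHom R)).map (IsLocalRing.residue R)
  · obtain ⟨S', hS'⟩ := hS.of_quatIso h
    rw [Units.val_mul, map_mul, Units.val_pow_eq_pow_val, map_pow]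
    exact (Even.isSquare_pow ⟨1, rfl⟩ _).mul (hS'.isSquare_residue hπ)

/-- If the tame symbol of `a` and `b` is a square, then the quaternion algebra `(a, b)` over the
fraction field of a discrete valuation ring in which `2` is invertible contains a self-dual
order. -/
theorem exists_isSelfDualOrder_of_isSquare_residue_tameSymbol (h2 : IsUnit (2 : R))
    (hπ : Irreducible π) (ha : a = algebraMap R K u * algebraMap R K π ^ m)
    (hb : b = algebraMap R K w * algebraMap R K π ^ n)
    (hs : algebraMap R K s = (-1) ^ (m * n) * a ^ n * b ^ (-m))
    (hsq : IsSquare (IsLocalRing.residue R s)) :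
    ∃ S : Subalgebra R ℍ[K, a, 0, b], IsSelfDualOrder S := by
  obtain ⟨u', w', h, -⟩ | ⟨u', w', v, h, rfl⟩ :=
    quatIso_dichotomy (IsFractionRing.injective R K) hπ.ne_zero ha hb hs
  · obtain ⟨S, hS⟩ := exists_isSelfDualOrder_of_units (K := K) h2 u' w'
    exact hS.of_quatIso h.symm
  · obtain ⟨c, hc⟩ := hsq
    obtain ⟨c, rfl⟩ := IsLocalRing.residue_surjective c
    have hmem : (w' : R) - (↑v⁻¹ * c) ^ 2 ∈ IsLocalRing.maximalIdeal R := by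
      have h1 : (w' : R) - (↑v⁻¹ * c) ^ 2 = ↑v⁻¹ ^ 2 * (↑(v ^ 2 * w') - c * c) := by
        rw [mul_sub, Units.val_mul, Units.val_pow_eq_pow_val, ← mul_assoc, ← mul_pow,
          Units.inv_mul, one_pow, one_mul, ← pow_two, ← mul_pow]
      rw [h1]
      refine Ideal.mul_mem_left _ _ ?_
      rw [← IsLocalRing.residue_eq_zero_iff, map_sub, hc, map_mul, sub_self]
    rw [hπ.maximalIdeal_eq, Ideal.mem_span_singleton] at hmem
    obtain ⟨t, ht⟩ := hmem
    have hu : IsUnit (↑v⁻¹ * c) := by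
      by_contra hn
      rw [← mem_nonunits_iff, ← IsLocalRing.mem_maximalIdeal, hπ.maximalIdeal_eq,
        Ideal.mem_span_singleton] at hn
      refine hπ.not_isUnit (isUnit_of_dvd_unit ?_ w'.isUnit)
      rw [sub_eq_iff_eq_add.mp ht]
      exact dvd_add (dvd_mul_right _ _) (hn.trans (dvd_pow_self _ two_ne_zero))
    obtain ⟨S, hS⟩ := exists_isSelfDualOrder_of_sq_add_mul (u := u') (w := w') h2
      (algebraMap_uniformizer_ne_zero (K := K) hπ) hu
      ((sub_eq_iff_eq_add.mp ht).trans (add_comm _ _))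
    exact hS.of_quatIso h.symm

end DVR

/-! ### Dual bases for the reduced trace form -/

section Casimir

variable {K : Type*} [Field K] {a b : K}

theorem re_mul_comm (p q : ℍ[K, a, 0, b]) : (p * q).re = (q * p).re := by
  simp; ring

theorem quat_eq_zero_of_re_mul_eq_zero (h2 : (2 : K) ≠ 0) (ha : a ≠ 0) (hb : b ≠ 0)
    {q : ℍ[K, a, 0, b]} (h : ∀ p, 2 * (p * q).re = 0) : q = 0 := by
  have h0 := h ⟨1, 0, 0, 0⟩
  have h1 := h ⟨0, 1, 0, 0⟩
  have h3 := h ⟨0, 0, 1, 0⟩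
  have h4 := h ⟨0, 0, 0, 1⟩
  apply QuaternionAlgebra.ext
  · simpa [h2] using h0
  · simpa [h2, ha] using h1
  · simpa [h2, hb] using h3
  · simpa [h2, ha, hb] using h4

/-- The families `e` and `e'` are dual bases of the quaternion algebra `(a, b)` for the reduced
trace form `(x, y) ↦ 2 re (xy)`. -/
structure IsQuatDualBasis {ι : Type*} [Fintype ι] [DecidableEq ι] (e e' : ι → ℍ[K, a, 0, b]) :
    Prop where
  expand : ∀ x, ∑ i, (2 * (x * e' i).re) • e i = x
  pairing : ∀ i j, 2 * (e i * e' j).re = if i = j then 1 else 0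

theorem isQuatDualBasis_standard (h2 : (2 : K) ≠ 0) (ha : a ≠ 0) (hb : b ≠ 0) :
    IsQuatDualBasis (K := K) (a := a) (b := b)
      ![⟨1, 0, 0, 0⟩, ⟨0, 1, 0, 0⟩, ⟨0, 0, 1, 0⟩, ⟨0, 0, 0, 1⟩]
      ![⟨2⁻¹, 0, 0, 0⟩, ⟨0, (2 * a)⁻¹, 0, 0⟩, ⟨0, 0, (2 * b)⁻¹, 0⟩, ⟨0, 0, 0, -(2 * a * b)⁻¹⟩] where
  expand x := by
    rw [Fin.sum_univ_four]
    apply QuaternionAlgebra.ext <;> simp <;> field_simp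
  pairing i j := by
    fin_cases i <;> fin_cases j <;> simp <;> field_simp

namespace IsQuatDualBasis

variable {ι : Type*} [Fintype ι] [DecidableEq ι] {e e' : ι → ℍ[K, a, 0, b]}

/-- The trace form is symmetric, so `e'` is a basis with dual basis `e`. -/
theorem expand_dual (h : IsQuatDualBasis e e') (h2 : (2 : K) ≠ 0) (ha : a ≠ 0) (hb : b ≠ 0)
    (x : ℍ[K, a, 0, b]) : ∑ i, (2 * (x * e i).re) • e' i = x := by
  rw [← sub_eq_zero]
  refine quat_eq_zero_of_re_mul_eq_zero h2 ha hb fun p => ?_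
  have hre : ∀ (f : ι → ℍ[K, a, 0, b]), (∑ i, f i).re = ∑ i, (f i).re := fun f =>
    map_sum (AddMonoidHom.mk' (fun q : ℍ[K, a, 0, b] => q.re) fun _ _ => rfl) f _
  have h1 : (x * p).re = ∑ i, (2 * (p * e' i).re) * (x * e i).re := by
    conv_lhs => rw [← h.expand p, Finset.mul_sum, hre]
    simp only [mul_smul_comm, QuaternionAlgebra.re_smul, smul_eq_mul]
  rw [mul_sub, QuaternionAlgebra.re_sub, re_mul_comm p x, h1, Finset.mul_sum, hre, sub_eq_zero.mpr,
    mul_zero]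
  refine Finset.sum_congr rfl fun i _ => ?_
  rw [mul_smul_comm, QuaternionAlgebra.re_smul, smul_eq_mul]
  ring

/-- The Casimir element `∑ eᵢ ⊗ e'ᵢ` does not depend on the choice of the dual bases, and it acts on
the quaternion algebra as the reduced trace. -/
theorem sum_mul_mul (h : IsQuatDualBasis e e') (h2 : (2 : K) ≠ 0) (ha : a ≠ 0) (hb : b ≠ 0)
    (x : ℍ[K, a, 0, b]) : ∑ i, e i * x * e' i = algebraMap K _ (2 * x.re) := by
  have hstd := isQuatDualBasis_standard h2 ha hb
  set f : Fin 4 → ℍ[K, a, 0, b] := ![⟨1, 0, 0, 0⟩, ⟨0, 1, 0, 0⟩, ⟨0, 0, 1, 0⟩, ⟨0, 0, 0, 1⟩] with hf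
  set f' : Fin 4 → ℍ[K, a, 0, b] := ![⟨2⁻¹, 0, 0, 0⟩, ⟨0, (2 * a)⁻¹, 0, 0⟩, ⟨0, 0, (2 * b)⁻¹, 0⟩,
    ⟨0, 0, 0, -(2 * a * b)⁻¹⟩] with hf'
  have h1 : ∑ i, e i * x * e' i = ∑ k, f k * x * f' k := by
    calc ∑ i, e i * x * e' i
        = ∑ i, ∑ k, ((2 * (e i * f' k).re) • f k) * x * e' i := by
          refine Finset.sum_congr rfl fun i _ => ?_
          rw [← Finset.sum_mul, ← Finset.sum_mul, hstd.expand]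
      _ = ∑ k, f k * x * ∑ i, (2 * (f' k * e i).re) • e' i := by
          rw [Finset.sum_comm]
          refine Finset.sum_congr rfl fun k _ => ?_
          rw [Finset.mul_sum]
          refine Finset.sum_congr rfl fun i _ => ?_
          rw [re_mul_comm, smul_mul_assoc, smul_mul_assoc, mul_smul_comm]
      _ = ∑ k, f k * x * f' k := by
          refine Finset.sum_congr rfl fun k _ => ?_
          rw [h.expand_dual h2 ha hb]
  rw [h1, Fin.sum_univ_four]
  generalize ht : 2 * x.re = t
  apply QuaternionAlgebra.ext <;> simp [hf, hf'] <;> (try rw [← ht]) <;> field_simp <;> ring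

end IsQuatDualBasis

end Casimir

section Azumaya

open scoped TensorProduct

variable {R A K : Type*} [CommRing R] [Ring A] [Algebra R A] [Field K] {a b : K}
  {ι : Type*} [Fintype ι] [DecidableEq ι]

/-- A family in an `R`-algebra `A` that maps to one of two dual bases in a quaternion algebra is an
`R`-basis of `A`, provided that the traces with the other basis lie in `R`. -/
theorem linearIndependent_and_span_eq_top_of_isQuatDualBasis {g : R →+* K}
    (hg : Function.Injective g) {ψ : A →+* ℍ[K, a, 0, b]} (hψ : Function.Injective ψ)
    (hgψ : ∀ r, ψ (algebraMap R A r) = algebraMap K _ (g r)) {e e' : ι → A}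
    (h : IsQuatDualBasis (fun i => ψ (e i)) (fun i => ψ (e' i)))
    (hint : ∀ x i, ∃ r, g r = 2 * (ψ x * ψ (e' i)).re) :
    LinearIndependent R e ∧ Submodule.span R (Set.range e) = ⊤ := by
  have hsm : ∀ (r : R) (x : A), ψ (r • x) = g r • ψ x := fun r x => by
    rw [Algebra.smul_def, map_mul, hgψ, ← Algebra.smul_def]
  constructor
  · rw [Fintype.linearIndependent_iff]
    intro r hr j
    have h1 : ∑ i, g (r i) • ψ (e i) = 0 := by
      rw [← map_zero ψ, ← hr, map_sum]
      exact Finset.sum_congr rfl fun i _ => (hsm _ _).symm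
    have h2 : (2 * ((∑ i, g (r i) • ψ (e i)) * ψ (e' j)).re) = g (r j) := by
      have hre : ∀ (f : ι → ℍ[K, a, 0, b]), (∑ i, f i).re = ∑ i, (f i).re := fun f =>
        map_sum (AddMonoidHom.mk' (fun q : ℍ[K, a, 0, b] => q.re) fun _ _ => rfl) f _
      rw [Finset.sum_mul, hre, Finset.mul_sum]
      rw [Finset.sum_eq_single j]
      · rw [smul_mul_assoc, QuaternionAlgebra.re_smul, smul_eq_mul, mul_left_comm, h.pairing,
          if_pos rfl, mul_one]
      · intro i _ hij
        rw [smul_mul_assoc, QuaternionAlgebra.re_smul, smul_eq_mul, mul_left_comm, h.pairing,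
          if_neg hij, mul_zero]
      · simp
    rw [h1, zero_mul, QuaternionAlgebra.re_zero, mul_zero] at h2
    exact hg (by rw [← h2, map_zero])
  · refine eq_top_iff.mpr fun x _ => ?_
    choose r hr using hint x
    have h1 : x = ∑ i, r i • e i := by
      apply hψ
      rw [map_sum, ← h.expand (ψ x)]
      exact Finset.sum_congr rfl fun i _ => by rw [hsm, hr]
    rw [h1]
    exact Submodule.sum_mem _ fun i _ => Submodule.smul_mem _ _ (Submodule.subset_span ⟨i, rfl⟩)

theorem isAzumaya_of_surjective_mulLeftRight [FaithfulSMul R A] (e : Module.Basis ι R A)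
    (h : Function.Surjective (AlgHom.mulLeftRight R A)) : IsAzumaya R A := by
  have : Module.Free R A := .of_basis e
  have : Module.Finite R A := .of_basis e
  refine { bij := ⟨?_, h⟩ }
  let e₁ : Module.Basis (ι × ι) R (A ⊗[R] Aᵐᵒᵖ) :=
    e.tensorProduct (e.map (MulOpposite.opLinearEquiv R))
  let e₂ : Module.Basis (ι × ι) R (Module.End R A) := Module.Basis.end e
  let φ : Module.End R A ≃ₗ[R] A ⊗[R] Aᵐᵒᵖ := e₂.equiv e₁ (Equiv.refl _)
  have : Module.Finite R (A ⊗[R] Aᵐᵒᵖ) := .of_basis e₁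
  have hinj := OrzechProperty.injective_of_surjective_endomorphism
    (φ.toLinearMap ∘ₗ (AlgHom.mulLeftRight R A).toLinearMap) (φ.surjective.comp h)
  exact fun x y hxy => hinj (congrArg φ hxy)

/-- In the situation of `linearIndependent_and_span_eq_top_of_isQuatDualBasis`, if both families
lie in `A`, then `A` is an Azumaya algebra: an endomorphism `φ` of `A` is given by
`x ↦ ∑ eⱼ x e'ᵢ e'ⱼ φ(eᵢ)`. -/
theorem isAzumaya_of_isQuatDualBasis (h2 : (2 : K) ≠ 0) (ha : a ≠ 0) (hb : b ≠ 0) {g : R →+* K}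
    (hg : Function.Injective g) {ψ : A →+* ℍ[K, a, 0, b]} (hψ : Function.Injective ψ)
    (hgψ : ∀ r, ψ (algebraMap R A r) = algebraMap K _ (g r)) {e e' : ι → A}
    (h : IsQuatDualBasis (fun i => ψ (e i)) (fun i => ψ (e' i)))
    (hint : ∀ x i, ∃ r, g r = 2 * (ψ x * ψ (e' i)).re) : IsAzumaya R A := by
  obtain ⟨hli, hsp⟩ := linearIndependent_and_span_eq_top_of_isQuatDualBasis hg hψ hgψ h hint
  have : FaithfulSMul R A := by
    rw [faithfulSMul_iff_algebraMap_injective]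
    refine Function.Injective.of_comp (f := ψ) ?_
    have : ψ ∘ algebraMap R A = algebraMap K ℍ[K, a, 0, b] ∘ g := funext hgψ
    rw [this]
    exact (algebraMap K ℍ[K, a, 0, b]).injective.comp hg
  refine isAzumaya_of_surjective_mulLeftRight (Module.Basis.mk hli hsp.ge) fun φ => ?_
  refine ⟨∑ i, ∑ j, e j ⊗ₜ MulOpposite.op (e' i * e' j * φ (e i)), LinearMap.ext fun x => ?_⟩
  choose r hr using hint x
  have hsm : ∀ (r : R) (x : A), ψ (r • x) = g r • ψ x := fun r x => by
    rw [Algebra.smul_def, map_mul, hgψ, ← Algebra.smul_def]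
  have h1 : x = ∑ i, r i • e i := by
    apply hψ
    rw [map_sum, ← h.expand (ψ x)]
    exact Finset.sum_congr rfl fun i _ => by rw [hsm, hr]
  have h3 : ∀ i, ∑ j, e j * (x * e' i) * e' j = algebraMap R A (r i) := fun i => by
    apply hψ
    rw [hgψ, hr, ← map_mul, ← h.sum_mul_mul h2 ha hb, map_sum]
    simp only [map_mul]
  conv_rhs => rw [h1, map_sum]
  simp only [map_sum, LinearMap.sum_apply, AlgHom.mulLeftRight_apply, MulOpposite.unop_op]
  refine Finset.sum_congr rfl fun i _ => ?_
  rw [map_smul, Algebra.smul_def, ← h3, Finset.sum_mul]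
  refine Finset.sum_congr rfl fun j _ => ?_
  simp only [mul_assoc]

end Azumaya

/-! ### Self-dual orders over regular local rings of dimension two -/

section SelfDual

variable {S K : Type*} [CommRing S] [IsDomain S] [Field K] [Algebra S K] [IsFractionRing S K]
  {a b : K}

/-- Every quaternion has a multiple in a given self-dual order. -/
theorem IsSelfDualOrder.exists_smul_mem {D : Subalgebra S ℍ[K, a, 0, b]} (hD : IsSelfDualOrder D)
    (q : ℍ[K, a, 0, b]) : ∃ d : S, d ≠ 0 ∧ d • q ∈ D := by
  let τ : ℍ[K, a, 0, b] →ₗ[S] K :=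
    { toFun := fun s => 2 * (q * s).re
      map_add' := fun x y => by rw [mul_add, QuaternionAlgebra.re_add, mul_add]
      map_smul' := fun r x => by
        rw [RingHom.id_apply, mul_smul_comm, QuaternionAlgebra.re_smul, mul_smul_comm] }
  obtain ⟨d, hd0, hd⟩ := (hD.fg.map τ).exists_smul_mem (LinearMap.range (Algebra.linearMap S K))
    (fun c => by
      obtain ⟨x, y, hy, rfl⟩ := IsFractionRing.div_surjective (A := S) c
      refine ⟨y, nonZeroDivisors.ne_zero hy, x, ?_⟩
      rw [Algebra.smul_def, mul_div_cancel₀]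
      · rfl
      · rw [Ne, map_eq_zero_iff _ (IsFractionRing.injective S K)]
        exact nonZeroDivisors.ne_zero hy)
  refine ⟨d, hd0, (hD.mem_iff _).mpr fun s hs => ?_⟩
  obtain ⟨r, hr⟩ := hd (τ s) ⟨s, hs, rfl⟩
  refine ⟨r, hr.trans ?_⟩
  rw [smul_mul_assoc, QuaternionAlgebra.re_smul, mul_smul_comm]
  rfl

end SelfDual

/-- The reduced trace form is nondegenerate, so every basis has a dual basis. -/
theorem exists_isQuatDualBasis {K : Type*} [Field K] {a b : K} (h2 : (2 : K) ≠ 0) (ha : a ≠ 0)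
    (hb : b ≠ 0) {ι : Type*} [Fintype ι] [DecidableEq ι] (e : Module.Basis ι K ℍ[K, a, 0, b]) :
    ∃ e' : ι → ℍ[K, a, 0, b], IsQuatDualBasis e e' := by
  let B : LinearMap.BilinForm K ℍ[K, a, 0, b] := LinearMap.mk₂ K (fun x y => 2 * (x * y).re)
    (fun x y z => by rw [add_mul, QuaternionAlgebra.re_add, mul_add])
    (fun c x y => by rw [smul_mul_assoc, QuaternionAlgebra.re_smul, mul_smul_comm])
    (fun x y z => by rw [mul_add, QuaternionAlgebra.re_add, mul_add])
    (fun c x y => by rw [mul_smul_comm, QuaternionAlgebra.re_smul, mul_smul_comm])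
  have hsymm : B.IsSymm := ⟨fun x y => by
    change 2 * (x * y).re = 2 * (y * x).re
    rw [re_mul_comm]⟩
  have hB : B.Nondegenerate := by
    refine ⟨fun x hx => ?_, fun x hx => quat_eq_zero_of_re_mul_eq_zero h2 ha hb hx⟩
    refine quat_eq_zero_of_re_mul_eq_zero h2 ha hb fun p => ?_
    rw [re_mul_comm]
    exact hx p
  have hpair : ∀ i j, 2 * (e i * B.dualBasis hB e j).re = if i = j then 1 else 0 := fun i j =>
    B.apply_dualBasis_right hB hsymm e i j
  refine ⟨B.dualBasis hB e, fun x => ?_, hpair⟩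
  refine e.ext_elem fun i => ?_
  rw [map_sum, Finsupp.finsetSum_apply, Finset.sum_eq_single i]
  · rw [map_smul, e.repr_self, Finsupp.smul_single, Finsupp.single_eq_same, smul_eq_mul, mul_one]
    change B x (B.dualBasis hB e i) = _
    conv_lhs => rw [← e.sum_repr x, map_sum, LinearMap.sum_apply]
    rw [Finset.sum_eq_single i]
    · rw [map_smul, LinearMap.smul_apply, B.apply_dualBasis_right hB hsymm, if_pos rfl, smul_eq_mul,
        mul_one]
    · intro j _ hij
      rw [map_smul, LinearMap.smul_apply, B.apply_dualBasis_right hB hsymm, if_neg hij, smul_zero]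
    · simp
  · intro j _ hij
    rw [map_smul, e.repr_self, Finsupp.smul_single, Finsupp.single_eq_of_ne hij.symm]
  · simp

section ReflexiveLattice

variable {R S K : Type*} [CommRing R] [IsDomain R] [IsLocalRing R] [IsNoetherianRing R]
  [CommRing S] [IsDomain S] [Field K] [Algebra R K] [Algebra S K] [IsFractionRing R K]
  [IsFractionRing S K]
  {a b : K} {f : R}

/-- Over a two-dimensional regular local ring `R`, let `D` be a self-dual order over the
localization `S` of `R` at a prime element `f`, in a quaternion algebra `(a, b)` such that `a` and
`b` become units when `f` is inverted. Then the elements of `D` with coordinates in `R[1/f]` form a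
free `R`-module, with a basis the dual basis of which consists of elements of the same kind.

The hypothesis `hS` says that `S` is this localization. The powers `f ^ N` clear the denominators
which are powers of `f`. -/
theorem IsSelfDualOrder.exists_dualBasis_lattice (hR : HasPrimeParameters R) (h2 : IsUnit (2 : R))
    (hf : Prime f)
    (hS : ∀ c : K, c ∈ (algebraMap S K).range ↔
      ∃ r d : R, ¬ f ∣ d ∧ algebraMap R K d * c = algebraMap R K r)
    {u w : Rˣ} {m n : ℤ} (ha : a = algebraMap R K u * algebraMap R K f ^ m)
    (hb : b = algebraMap R K w * algebraMap R K f ^ n)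
    {D : Subalgebra S ℍ[K, a, 0, b]} (hD : IsSelfDualOrder D) :
    ∃ (d : ℕ) (e e' : Fin d → ℍ[K, a, 0, b]), IsQuatDualBasis e e' ∧ (∀ i, e i ∈ D) ∧
      (∀ i, e' i ∈ D) ∧ ∃ N : ℕ, (∀ i, f ^ N • e i ∈ quatLattice R a b) ∧
        ∀ i, f ^ N • e' i ∈ quatLattice R a b := by
  have hinj := IsFractionRing.injective R K
  have hf0 : algebraMap R K f ≠ 0 := by rw [Ne, map_eq_zero_iff _ hinj]; exact hf.ne_zero
  have ha0 : a ≠ 0 := by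
    rw [ha]; exact mul_ne_zero (u.isUnit.map _).ne_zero (zpow_ne_zero _ hf0)
  have hb0 : b ≠ 0 := by
    rw [hb]; exact mul_ne_zero (w.isUnit.map _).ne_zero (zpow_ne_zero _ hf0)
  have h20 : (2 : K) ≠ 0 := by
    have := (h2.map (algebraMap R K)).ne_zero
    rwa [map_ofNat] at this
  have := hR.uniqueFactorizationMonoid
  -- facts on the image of `S` in `K`
  have hRS : ∀ r : R, algebraMap R K r ∈ (algebraMap S K).range := fun r =>
    (hS _).mpr ⟨r, 1, fun h => hf.not_isUnit (isUnit_of_dvd_one h), by simp⟩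
  have hinvS : ∀ d : R, ¬ f ∣ d → (algebraMap R K d)⁻¹ ∈ (algebraMap S K).range := fun d hd =>
    (hS _).mpr ⟨1, d, hd, by
      rw [map_one, mul_inv_cancel₀]
      rw [Ne, map_eq_zero_iff _ hinj]
      rintro rfl
      exact hd (dvd_zero f)⟩
  have hpow : ∀ c ∈ (algebraMap S K).range, c ≠ 0 →
      ∃ N : ℕ, ∃ t ∈ (algebraMap S K).range, t * c = algebraMap R K f ^ N := by
    intro c hc hc0
    obtain ⟨r, d, hd, hrd⟩ := (hS c).mp hc
    have hd0 : algebraMap R K d ≠ 0 := by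
      rw [Ne, map_eq_zero_iff _ hinj]; rintro rfl; exact hd (dvd_zero f)
    have hr0 : r ≠ 0 := by
      rintro rfl
      rw [map_zero] at hrd
      exact mul_ne_zero hd0 hc0 hrd
    obtain ⟨N, r', hr', rfl⟩ := WfDvdMonoid.max_power_factor hr0 hf.irreducible
    refine ⟨N, algebraMap R K d * (algebraMap R K r')⁻¹, mul_mem (hRS d) (hinvS r' hr'), ?_⟩
    have hr0' : algebraMap R K r' ≠ 0 := by
      rw [Ne, map_eq_zero_iff _ hinj]; rintro rfl; exact hr' (dvd_zero f)
    rw [mul_right_comm, hrd, map_mul, map_pow, mul_assoc, mul_inv_cancel₀ hr0', mul_one]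
  have hmemD : ∀ c ∈ (algebraMap S K).range, ∀ q ∈ D, c • q ∈ D := by
    rintro _ ⟨s, rfl⟩ q hq
    rw [algebraMap_smul]
    exact D.smul_mem hq s
  -- a common exponent for the denominators of elements of `D`
  obtain ⟨N, hN⟩ : ∃ N : ℕ, ∀ q ∈ D, algebraMap R K f ^ N • q ∈ quatLattice S a b := by
    obtain ⟨d, hd0, hd⟩ := hD.fg.exists_smul_mem (quatLattice S a b)
      (exists_smul_mem_quatLattice S)
    obtain ⟨N, _, ⟨t, rfl⟩, ht⟩ := hpow (algebraMap S K d) ⟨d, rfl⟩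
      (by rwa [Ne, map_eq_zero_iff _ (IsFractionRing.injective S K)])
    refine ⟨N, fun q hq => ?_⟩
    rw [← ht, mul_smul, algebraMap_smul, algebraMap_smul]
    exact Submodule.smul_mem _ _ (hd q hq)
  -- some multiple `f ^ N • q` of a given quaternion lies in `D`
  have hclear : ∀ q : ℍ[K, a, 0, b], ∃ N : ℕ, f ^ N • q ∈ D := by
    intro q
    obtain ⟨d, hd0, hd⟩ := hD.exists_smul_mem q
    obtain ⟨N, t, ht, htd⟩ := hpow (algebraMap S K d) ⟨d, rfl⟩
      (by rwa [Ne, map_eq_zero_iff _ (IsFractionRing.injective S K)])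
    refine ⟨N, ?_⟩
    rw [← algebraMap_smul K (f ^ N) q, map_pow, ← htd, mul_smul, algebraMap_smul]
    exact hmemD t ht _ hd
  -- the lattice of elements of `D` with coordinates in `f ^ (-N) R`
  let Φ : (Fin 4 → R) →ₗ[R] ℍ[K, a, 0, b] :=
    { toFun := fun v => ((algebraMap R K f ^ N)⁻¹ : K) • ⟨algebraMap R K (v 0),
        algebraMap R K (v 1), algebraMap R K (v 2), algebraMap R K (v 3)⟩
      map_add' := fun v v' => by
        rw [← smul_add]; congr 1; apply QuaternionAlgebra.ext <;> simp
      map_smul' := fun r v => by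
        rw [RingHom.id_apply, smul_comm r]; congr 1
        apply QuaternionAlgebra.ext <;> refine Eq.trans ?_ (Algebra.smul_def r (_ : K)).symm <;>
          simp }
  have hΦ : ∀ v, f ^ N • Φ v ∈ quatLattice R a b := fun v => by
    change f ^ N • (((algebraMap R K f ^ N)⁻¹ : K) • (_ : ℍ[K, a, 0, b])) ∈ _
    rw [← algebraMap_smul K (f ^ N), map_pow, smul_inv_smul₀ (pow_ne_zero N hf0)]
    exact ⟨⟨_, rfl⟩, ⟨_, rfl⟩, ⟨_, rfl⟩, ⟨_, rfl⟩⟩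
  have hΦinj : Function.Injective Φ := by
    intro v v' h
    have h1 := smul_right_injective _ (inv_ne_zero (pow_ne_zero N hf0)) h
    ext i
    fin_cases i
    · exact hinj (congrArg QuaternionAlgebra.re h1)
    · exact hinj (congrArg QuaternionAlgebra.imI h1)
    · exact hinj (congrArg QuaternionAlgebra.imJ h1)
    · exact hinj (congrArg QuaternionAlgebra.imK h1)
  have hΦsurj : ∀ q, f ^ N • q ∈ quatLattice R a b → ∃ v, Φ v = q := by
    rintro q ⟨⟨r₀, h₀⟩, ⟨r₁, h₁⟩, ⟨r₂, h₂⟩, ⟨r₃, h₃⟩⟩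
    refine ⟨![r₀, r₁, r₂, r₃], ?_⟩
    change ((algebraMap R K f ^ N)⁻¹ : K) • (_ : ℍ[K, a, 0, b]) = q
    rw [inv_smul_eq_iff₀ (pow_ne_zero N hf0), ← map_pow, algebraMap_smul]
    exact QuaternionAlgebra.ext h₀ h₁ h₂ h₃
  let M : Submodule R (Fin 4 → R) :=
    { carrier := {v | Φ v ∈ D}
      zero_mem' := by
        change Φ 0 ∈ D
        rw [map_zero]; exact D.zero_mem
      add_mem' := fun {v v'} h h' => by
        change Φ (v + v') ∈ D
        rw [map_add]; exact D.add_mem h h'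
      smul_mem' := fun r v h => by
        change Φ (r • v) ∈ D
        rw [map_smul, ← algebraMap_smul K r]
        exact hmemD _ (hRS r) _ h }
  -- `M` is saturated with respect to a parameter `p` not divisible by `f`, as `p` is invertible
  -- in `S`
  have hMfree : Module.Free R M := by
    obtain ⟨p, hp, hpm, hPp, hfp⟩ : ∃ p : R, Prime p ∧ p ∈ IsLocalRing.maximalIdeal R ∧
        IsPrincipalIdealRing (R ⧸ Ideal.span {p}) ∧ ¬ f ∣ p := by
      obtain ⟨x, y, hx, hy, hxy, hm, hPx, hPy⟩ := hR
      by_cases hfx : f ∣ x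
      · refine ⟨y, hy, hm ▸ Ideal.subset_span (by simp), hPy, fun hfy => hxy ?_⟩
        exact (hf.associated_of_dvd hx hfx).symm.dvd.trans hfy
      · exact ⟨x, hx, hm ▸ Ideal.subset_span (by simp), hPx, hfx⟩
    refine Submodule.free_of_isSaturated hp hpm M fun v hv => ?_
    have h1 : Φ v = (algebraMap R K p)⁻¹ • Φ (p • v) := by
      rw [map_smul, ← algebraMap_smul K p, inv_smul_smul₀]
      rw [Ne, map_eq_zero_iff _ hinj]
      exact hp.ne_zero
    change Φ v ∈ D
    rw [h1]
    exact hmemD _ (hinvS p hfp) _ hv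
  let β := Module.finBasis R M
  set d := Module.finrank R M with hd
  let e : Fin d → ℍ[K, a, 0, b] := fun i => Φ (β i).1
  have heD : ∀ i, e i ∈ D := fun i => (β i).2
  have hexp : ∀ v : M, Φ v.1 = ∑ i, algebraMap R K (β.repr v i) • e i := by
    intro v
    conv_lhs => rw [← β.sum_repr v]
    simp only [Submodule.coe_sum, Submodule.coe_smul, map_sum, map_smul, algebraMap_smul, e]
  have hindep : LinearIndependent K e := by
    rw [← LinearIndependent.iff_fractionRing R K]
    exact (β.linearIndependent.map' M.subtype (Submodule.ker_subtype M)).map' Φ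
      (LinearMap.ker_eq_bot.mpr hΦinj)
  have hspan : ⊤ ≤ Submodule.span K (Set.range e) := by
    have key : ∀ q ∈ quatLattice R a b, q ∈ Submodule.span K (Set.range e) := by
      intro q hq
      obtain ⟨N', hN'⟩ := hclear q
      obtain ⟨v, hv⟩ := hΦsurj (f ^ N' • q) (by
        exact Submodule.smul_mem _ _ (Submodule.smul_mem _ _ hq))
      have h1 : q = (algebraMap R K f ^ N')⁻¹ • Φ v := by
        rw [hv, ← map_pow, eq_inv_smul_iff₀ (by rw [map_pow]; exact pow_ne_zero _ hf0),
          algebraMap_smul]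
      have hvM : v ∈ M := by
        change Φ v ∈ D
        rwa [hv]
      rw [h1, hexp ⟨v, hvM⟩]
      exact Submodule.smul_mem _ _ (Submodule.sum_mem _ fun i _ => Submodule.smul_mem _ _
        (Submodule.subset_span ⟨i, rfl⟩))
    intro q _
    obtain ⟨r, hr, hq⟩ := exists_smul_mem_quatLattice R q
    have h1 : q = (algebraMap R K r)⁻¹ • r • q := by
      rw [← algebraMap_smul K r q, inv_smul_smul₀]
      rwa [Ne, map_eq_zero_iff _ hinj]
    rw [h1]
    exact Submodule.smul_mem _ _ (key _ hq)
  obtain ⟨e', hee'⟩ := exists_isQuatDualBasis h20 ha0 hb0 (Module.Basis.mk hindep hspan)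
  simp only [Module.Basis.coe_mk] at hee'
  -- traces of products of the dual basis and elements of the lattice
  have htr : ∀ i, ∀ v : M, 2 * (e' i * Φ v.1).re ∈ (algebraMap R K).range := by
    intro i v
    have hre : ∀ (f : Fin d → ℍ[K, a, 0, b]), (∑ i, f i).re = ∑ i, (f i).re := fun f =>
      map_sum (AddMonoidHom.mk' (fun q : ℍ[K, a, 0, b] => q.re) fun _ _ => rfl) f _
    refine ⟨β.repr v i, ?_⟩
    rw [re_mul_comm, hexp, Finset.sum_mul, hre, Finset.mul_sum, Finset.sum_eq_single i]
    · rw [smul_mul_assoc, QuaternionAlgebra.re_smul, smul_eq_mul, mul_left_comm, hee'.pairing,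
        if_pos rfl, mul_one]
    · intro j _ hij
      rw [smul_mul_assoc, QuaternionAlgebra.re_smul, smul_eq_mul, mul_left_comm, hee'.pairing,
        if_neg hij, mul_zero]
    · simp
  -- every element of `D` has a multiple in the lattice by some `c` which is invertible in `S`
  have heD' : ∀ i, e' i ∈ D := by
    intro i
    rw [hD.mem_iff]
    intro s hs
    obtain ⟨c, hc, hcs⟩ : ∃ c : R, ¬ f ∣ c ∧ f ^ N • c • s ∈ quatLattice R a b := by
      obtain ⟨h₀, h₁, h₂, h₃⟩ := hN s hs
      obtain ⟨r₀, d₀, hd₀, h₀⟩ := (hS _).mp h₀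
      obtain ⟨r₁, d₁, hd₁, h₁⟩ := (hS _).mp h₁
      obtain ⟨r₂, d₂, hd₂, h₂⟩ := (hS _).mp h₂
      obtain ⟨r₃, d₃, hd₃, h₃⟩ := (hS _).mp h₃
      have hnd : ∀ {x y}, ¬ f ∣ x → ¬ f ∣ y → ¬ f ∣ x * y := fun hx hy h =>
        (hf.dvd_or_dvd h).elim hx hy
      have hsm : ∀ (r : R) (q : ℍ[K, a, 0, b]), r • q = algebraMap R K r • q := fun r q =>
        (algebraMap_smul K r q).symm
      refine ⟨d₀ * d₁ * d₂ * d₃, hnd (hnd (hnd hd₀ hd₁) hd₂) hd₃, ?_, ?_, ?_, ?_⟩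
      · refine ⟨d₁ * d₂ * d₃ * r₀, ?_⟩
        rw [map_mul, ← h₀, hsm, hsm]; simp; ring
      · refine ⟨d₀ * d₂ * d₃ * r₁, ?_⟩
        rw [map_mul, ← h₁, hsm, hsm]; simp; ring
      · refine ⟨d₀ * d₁ * d₃ * r₂, ?_⟩
        rw [map_mul, ← h₂, hsm, hsm]; simp; ring
      · refine ⟨d₀ * d₁ * d₂ * r₃, ?_⟩
        rw [map_mul, ← h₃, hsm, hsm]; simp; ring
    obtain ⟨v, hv⟩ := hΦsurj _ hcs
    have hvM : v ∈ M := by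
      change Φ v ∈ D
      rw [hv, ← algebraMap_smul K c]
      exact hmemD _ (hRS c) _ hs
    have h1 := htr i ⟨v, hvM⟩
    obtain ⟨r, hr⟩ := h1
    refine (hS _).mpr ⟨r, c, hc, ?_⟩
    rw [hr]
    change _ = 2 * (e' i * Φ v).re
    rw [hv, ← algebraMap_smul K c, mul_smul_comm, QuaternionAlgebra.re_smul, smul_eq_mul]
    ring
  refine ⟨d, e, e', hee', heD, heD', ?_⟩
  -- the coordinates of the dual basis are, up to units of `R[1/f]`, traces of products with
  -- `1`, `i`, `j` and `l`; the predicate `P` is membership in `R[1/f]`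
  have hN' : ∀ i, ∃ N' : ℕ, f ^ N' • e' i ∈ quatLattice R a b := by
    intro i
    let P : K → Prop := fun c => ∃ l : ℕ, algebraMap R K f ^ l * c ∈ (algebraMap R K).range
    have hPmul : ∀ x y, P x → P y → P (x * y) := fun x y ⟨l, hx⟩ ⟨l', hy⟩ => ⟨l + l', by
      rw [pow_add, mul_mul_mul_comm]; exact mul_mem hx hy⟩
    have hPR : ∀ r : R, P (algebraMap R K r) := fun r => ⟨0, by simp⟩
    have hPz : ∀ z : ℤ, P (algebraMap R K f ^ z) := fun z => by
      obtain ⟨l, rfl | rfl⟩ := z.eq_nat_or_neg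
      · rw [zpow_natCast, ← map_pow]; exact hPR _
      · exact ⟨l, 1, by rw [zpow_neg, zpow_natCast, mul_inv_cancel₀ (pow_ne_zero l hf0), map_one]⟩
    have hPinv : ∀ (v : Rˣ), P (algebraMap R K v)⁻¹ := fun v => by
      have : (algebraMap R K v)⁻¹ = algebraMap R K ↑v⁻¹ := by
        rw [inv_eq_of_mul_eq_one_right]
        rw [← map_mul, Units.mul_inv, map_one]
      rw [this]; exact hPR _
    have hPa : P a⁻¹ := by
      rw [ha, mul_inv, ← zpow_neg]; exact hPmul _ _ (hPinv u) (hPz _)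
    have hPb : P b⁻¹ := by
      rw [hb, mul_inv, ← zpow_neg]; exact hPmul _ _ (hPinv w) (hPz _)
    have hP2 : P 2⁻¹ := by
      have := hPinv h2.unit
      rwa [IsUnit.unit_spec, map_ofNat] at this
    have hPtr : ∀ p ∈ quatLattice R a b, P (2 * (e' i * p).re) := by
      intro p hp
      obtain ⟨l, hl⟩ := hclear p
      obtain ⟨v, hv⟩ := hΦsurj (f ^ l • p)
        (Submodule.smul_mem _ _ (Submodule.smul_mem _ _ hp))
      have hvM : v ∈ M := by
        change Φ v ∈ D
        rwa [hv]
      have h1 := htr i ⟨v, hvM⟩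
      change 2 * (e' i * Φ v).re ∈ _ at h1
      rw [hv, ← algebraMap_smul K (f ^ l), mul_smul_comm, QuaternionAlgebra.re_smul, smul_eq_mul,
        mul_left_comm, map_pow] at h1
      exact ⟨l, h1⟩
    have h0R : (0 : K) ∈ (algebraMap R K).range := zero_mem _
    have h1R : (1 : K) ∈ (algebraMap R K).range := one_mem _
    obtain ⟨l₀, h₀⟩ : P (e' i).re := by
      convert hPmul _ _ hP2 (hPtr ⟨1, 0, 0, 0⟩ ⟨h1R, h0R, h0R, h0R⟩) using 1
      simp; field_simp
    obtain ⟨l₁, h₁⟩ : P (e' i).imI := by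
      convert hPmul _ _ (hPmul _ _ hP2 hPa) (hPtr ⟨0, 1, 0, 0⟩ ⟨h0R, h1R, h0R, h0R⟩) using 1
      simp; field_simp
    obtain ⟨l₂, h₂⟩ : P (e' i).imJ := by
      convert hPmul _ _ (hPmul _ _ hP2 hPb) (hPtr ⟨0, 0, 1, 0⟩ ⟨h0R, h0R, h1R, h0R⟩) using 1
      simp; field_simp
    obtain ⟨l₃, h₃⟩ : P (e' i).imK := by
      convert hPmul _ _ (hPmul _ _ hP2 (hPmul _ _ hPa hPb))
        (hPtr ⟨0, 0, 0, -1⟩ ⟨h0R, h0R, h0R, neg_mem h1R⟩) using 1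
      simp; field_simp
    have hadd : ∀ (l l' : ℕ) (c : K), algebraMap R K f ^ l * c ∈ (algebraMap R K).range →
        algebraMap R K f ^ (l' + l) * c ∈ (algebraMap R K).range := fun l l' c h => by
      rw [pow_add, mul_assoc, ← map_pow]
      exact mul_mem ⟨_, rfl⟩ h
    refine ⟨l₀ + l₁ + l₂ + l₃, ?_⟩
    rw [← algebraMap_smul K (f ^ _), map_pow]
    refine ⟨?_, ?_, ?_, ?_⟩
    · rw [show l₀ + l₁ + l₂ + l₃ = l₁ + l₂ + l₃ + l₀ by ring]; exact hadd _ _ _ h₀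
    · rw [show l₀ + l₁ + l₂ + l₃ = l₀ + l₂ + l₃ + l₁ by ring]; exact hadd _ _ _ h₁
    · rw [show l₀ + l₁ + l₂ + l₃ = l₀ + l₁ + l₃ + l₂ by ring]; exact hadd _ _ _ h₂
    · exact hadd _ _ _ h₃
  choose N' hN' using hN'
  refine ⟨N + ∑ i, N' i, fun i => ?_, fun i => ?_⟩
  · rw [pow_add, mul_comm, mul_smul]
    exact Submodule.smul_mem _ _ (hΦ _)
  · rw [pow_add, mul_smul, ← Finset.prod_pow_eq_pow_sum,
      ← Finset.prod_erase_mul _ _ (Finset.mem_univ i), mul_smul]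
    exact Submodule.smul_mem _ _ (Submodule.smul_mem _ _ (hN' i))

end ReflexiveLattice

/-! ### Local rings of an integral scheme inside its function field -/

namespace AlgebraicGeometry.Scheme

variable {X : Scheme.{u}}

/-- For a specialization `z ⤳ x`, the prime ideal of the local ring at `x` corresponding to `z`. -/
noncomputable def idealOfSpecializes {z x : X} (h : z ⤳ x) : Ideal (X.presheaf.stalk x) :=
  (IsLocalRing.maximalIdeal (X.presheaf.stalk z)).comap (X.presheaf.stalkSpecializes h).hom

instance {z x : X} (h : z ⤳ x) : (idealOfSpecializes h).IsPrime :=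
  Ideal.IsPrime.comap _

theorem isUnit_stalkSpecializes_iff {z x : X} (h : z ⤳ x) (d : X.presheaf.stalk x) :
    IsUnit (X.presheaf.stalkSpecializes h d) ↔ d ∉ idealOfSpecializes h := by
  rw [idealOfSpecializes, Ideal.mem_comap, IsLocalRing.mem_maximalIdeal, mem_nonunits_iff, not_not]

theorem exists_idealOfSpecializes_eq {x : X} (p : Ideal (X.presheaf.stalk x)) [hp : p.IsPrime] :
    ∃ (z : X) (h : z ⤳ x), idealOfSpecializes h = p := by
  let P : Spec (X.presheaf.stalk x) := ⟨p, hp⟩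
  have h : X.fromSpecStalk x P ⤳ x := by
    have : X.fromSpecStalk x P ∈ Set.range (X.fromSpecStalk x) := ⟨P, rfl⟩
    rwa [range_fromSpecStalk] at this
  refine ⟨X.fromSpecStalk x P, h, ?_⟩
  have h1 : Spec.map (X.presheaf.stalkSpecializes h) (IsLocalRing.closedPoint _) = P := by
    apply (IsPreimmersion.isEmbedding (X.fromSpecStalk x)).injective
    refine (Scheme.Hom.comp_apply _ _ _).symm.trans ?_
    rw [SpecMap_stalkSpecializes_fromSpecStalk]
    exact fromSpecStalk_closedPoint
  exact congrArg PrimeSpectrum.asIdeal h1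

theorem eq_of_idealOfSpecializes_eq {z z' x : X} (h : z ⤳ x) (h' : z' ⤳ x)
    (hzz : idealOfSpecializes h = idealOfSpecializes h') : z = z' := by
  have key : ∀ {w : X} (hw : w ⤳ x),
      X.fromSpecStalk x (Spec.map (X.presheaf.stalkSpecializes hw) (IsLocalRing.closedPoint _)) =
        w := fun hw => by
    refine (Scheme.Hom.comp_apply _ _ _).symm.trans ?_
    rw [SpecMap_stalkSpecializes_fromSpecStalk]
    exact fromSpecStalk_closedPoint
  rw [← key h, ← key h']
  exact congrArg _ (PrimeSpectrum.ext hzz)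

variable [IsIntegral X]

theorem algebraMap_stalkSpecializes {z x : X} (h : z ⤳ x) (r : X.presheaf.stalk x) :
    algebraMap (X.presheaf.stalk z) X.functionField (X.presheaf.stalkSpecializes h r) =
      algebraMap (X.presheaf.stalk x) X.functionField r := by
  simp only [RingHom.algebraMap_toAlgebra]
  change (X.presheaf.stalkSpecializes h ≫ X.presheaf.stalkSpecializes _) r = _
  rw [TopCat.Presheaf.stalkSpecializes_comp]

/-- The local ring at `z` is the localization of the local ring at any specialization `x`. -/
theorem isLocalization_stalkSpecializes {z x : X} (h : z ⤳ x) :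
    letI := (X.presheaf.stalkSpecializes h).hom.toAlgebra
    IsLocalization.AtPrime (X.presheaf.stalk z) (idealOfSpecializes h) := by
  let _ := (X.presheaf.stalkSpecializes h).hom.toAlgebra
  obtain ⟨_, ⟨V, hV, rfl⟩, hxV, -⟩ :=
    X.isBasis_affineOpens.exists_subset_of_mem_open (Set.mem_univ x) isOpen_univ
  have hzV : z ∈ V := h.mem_open V.2 hxV
  let _ := X.presheaf.algebra_section_stalk ⟨z, hzV⟩
  have hloc := hV.isLocalization_stalk ⟨z, hzV⟩
  have hgerm : ∀ s : Γ(X, V), algebraMap (X.presheaf.stalk x) (X.presheaf.stalk z)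
      (X.presheaf.germ V x hxV s) = algebraMap Γ(X, V) (X.presheaf.stalk z) s := fun s => by
    change (X.presheaf.germ V x hxV ≫ X.presheaf.stalkSpecializes h) s = _
    rw [TopCat.Presheaf.germ_stalkSpecializes]
    rfl
  have hinj : Function.Injective (algebraMap (X.presheaf.stalk x) (X.presheaf.stalk z)) := by
    refine Function.Injective.of_comp (f := algebraMap (X.presheaf.stalk z) X.functionField) ?_
    convert IsFractionRing.injective (X.presheaf.stalk x) X.functionField using 1
    exact funext fun r => algebraMap_stalkSpecializes h r
  constructor
  constructor
  · rintro ⟨d, hd⟩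
    exact (isUnit_stalkSpecializes_iff h d).mpr hd
  · intro c
    obtain ⟨⟨r, s⟩, hrs⟩ := IsLocalization.surj (hV.primeIdealOf ⟨z, hzV⟩).asIdeal.primeCompl c
    refine ⟨⟨X.presheaf.germ V x hxV r, X.presheaf.germ V x hxV s.1, ?_⟩, ?_⟩
    · refine (isUnit_stalkSpecializes_iff h _).mp ?_
      have := IsLocalization.map_units (X.presheaf.stalk z) s
      rwa [← hgerm] at this
    · exact (congrArg (c * ·) (hgerm s.1)).trans (hrs.trans (hgerm r).symm)
  · intro r s hrs
    exact ⟨1, by rw [hinj hrs]⟩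

theorem height_idealOfSpecializes {z x : X} (h : z ⤳ x) :
    (idealOfSpecializes h).height = Order.coheight z := by
  let _ := (X.presheaf.stalkSpecializes h).hom.toAlgebra
  have := isLocalization_stalkSpecializes h
  have h1 := IsLocalization.AtPrime.ringKrullDim_eq_height (idealOfSpecializes h)
    (X.presheaf.stalk z)
  rw [ringKrullDim_stalk_eq_coheight] at h1
  exact_mod_cast h1.symm

theorem mem_range_stalk_of_specializes {z x : X} (h : z ⤳ x) {f : X.functionField}
    (hf : f ∈ (algebraMap (X.presheaf.stalk x) X.functionField).range) :
    f ∈ (algebraMap (X.presheaf.stalk z) X.functionField).range := by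
  obtain ⟨r, rfl⟩ := hf
  exact ⟨_, algebraMap_stalkSpecializes h r⟩

/-- The rational functions regular at `z` are the fractions of functions regular at `x` whose
denominators do not vanish at `z`. -/
theorem mem_range_stalk_iff {z x : X} (h : z ⤳ x) (f : X.functionField) :
    f ∈ (algebraMap (X.presheaf.stalk z) X.functionField).range ↔
      ∃ r d : X.presheaf.stalk x, d ∉ idealOfSpecializes h ∧
        algebraMap (X.presheaf.stalk x) X.functionField d * f =
          algebraMap (X.presheaf.stalk x) X.functionField r := by
  constructor
  · rintro ⟨c, rfl⟩
    let _ := (X.presheaf.stalkSpecializes h).hom.toAlgebra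
    have := isLocalization_stalkSpecializes h
    obtain ⟨⟨r, d⟩, hrd⟩ := IsLocalization.surj (idealOfSpecializes h).primeCompl c
    refine ⟨r, d.1, d.2, ?_⟩
    rw [← algebraMap_stalkSpecializes h, ← algebraMap_stalkSpecializes h, ← map_mul, mul_comm]
    exact congrArg _ hrd
  · rintro ⟨r, d, hd, hrd⟩
    obtain ⟨u, hu⟩ := (isUnit_stalkSpecializes_iff h d).mpr hd
    refine ⟨↑u⁻¹ * X.presheaf.stalkSpecializes h r, ?_⟩
    rw [map_mul, algebraMap_stalkSpecializes h, ← hrd, ← algebraMap_stalkSpecializes h, ← hu,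
      ← mul_assoc, ← map_mul, Units.inv_mul, map_one, one_mul]

/-- If the local ring at `x` is factorial, then a rational function which is regular at all points
of codimension one that specialize to `x` is regular at `x`. -/
theorem mem_range_stalk_of_forall_coheight_eq_one [IsLocallyNoetherian X] {x : X}
    [UniqueFactorizationMonoid (X.presheaf.stalk x)] {f : X.functionField}
    (hf : ∀ z : X, z ⤳ x → Order.coheight z = 1 →
      f ∈ (algebraMap (X.presheaf.stalk z) X.functionField).range) :
    f ∈ (algebraMap (X.presheaf.stalk x) X.functionField).range := by
  obtain ⟨n, d, hnd, rfl⟩ := IsFractionRing.exists_reduced_fraction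
    (A := X.presheaf.stalk x) (K := X.functionField) f
  have hd0 : (d : X.presheaf.stalk x) ≠ 0 := nonZeroDivisors.ne_zero d.2
  have hd : IsUnit (d : X.presheaf.stalk x) := by
    by_contra hdu
    obtain ⟨p, hp, hpd⟩ := WfDvdMonoid.exists_irreducible_factor hdu hd0
    have hp : Prime p := UniqueFactorizationMonoid.irreducible_iff_prime.mp hp
    have hP : (Ideal.span {p}).IsPrime := (Ideal.span_singleton_prime hp.ne_zero).mpr hp
    obtain ⟨z, h, hz⟩ := exists_idealOfSpecializes_eq (Ideal.span {p})
    have hz1 : Order.coheight z = 1 := by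
      rw [← height_idealOfSpecializes h, hz]
      exact Ideal.height_span_singleton_eq_one_of_mem_nonZeroDivisors
        (mem_nonZeroDivisors_of_ne_zero hp.ne_zero) hp.not_isUnit
    obtain ⟨r, e, he, hre⟩ := (mem_range_stalk_iff h _).mp (hf z h hz1)
    rw [hz, Ideal.mem_span_singleton] at he
    have h1 : e * n = r * d := by
      apply IsFractionRing.injective (X.presheaf.stalk x) X.functionField
      rw [map_mul, map_mul, ← hre, mul_assoc, IsLocalization.mk'_spec]
    have h2 : p ∣ e * n := h1 ▸ hpd.mul_left r
    rcases hp.dvd_or_dvd h2 with h3 | h3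
    · exact he h3
    · exact hp.not_isUnit (hnd h3 hpd)
  refine ⟨↑hd.unit⁻¹ * n, ?_⟩
  rw [IsLocalization.eq_mk'_iff_mul_eq, ← map_mul]
  congr 1
  rw [mul_right_comm, hd.val_inv_mul, one_mul]

/-- If the local ring at `x` is factorial, then the prime ideal corresponding to a point of
codimension one is generated by a prime element. -/
theorem exists_prime_idealOfSpecializes_eq {z x : X}
    [UniqueFactorizationMonoid (X.presheaf.stalk x)] (h : z ⤳ x) (hz : Order.coheight z = 1) :
    ∃ f : X.presheaf.stalk x, Prime f ∧ idealOfSpecializes h = Ideal.span {f} := by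
  have h1 := height_idealOfSpecializes h
  rw [hz] at h1
  have hne : idealOfSpecializes h ≠ ⊥ := by
    intro h0
    rw [h0, Ideal.height_bot] at h1
    exact absurd h1 (by decide)
  obtain ⟨f, hf, hfp⟩ := Ideal.IsPrime.exists_mem_prime_of_ne_bot inferInstance hne
  exact ⟨f, hfp, Ideal.eq_span_singleton_of_height_eq_one h1 hf hfp⟩

theorem maximalIdeal_stalk_eq {z x : X} (h : z ⤳ x) {f : X.presheaf.stalk x}
    (hf : idealOfSpecializes h = Ideal.span {f}) :
    IsLocalRing.maximalIdeal (X.presheaf.stalk z) =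
      Ideal.span {X.presheaf.stalkSpecializes h f} := by
  let _ := (X.presheaf.stalkSpecializes h).hom.toAlgebra
  have := isLocalization_stalkSpecializes h
  rw [← IsLocalization.AtPrime.map_eq_maximalIdeal (idealOfSpecializes h), hf, Ideal.map_span,
    Set.image_singleton]
  rfl

theorem isDiscreteValuationRing_stalk [IsLocallyNoetherian X] {z x : X}
    [UniqueFactorizationMonoid (X.presheaf.stalk x)] (h : z ⤳ x) (hz : Order.coheight z = 1) :
    IsDiscreteValuationRing (X.presheaf.stalk z) := by
  obtain ⟨f, -, hf⟩ := exists_prime_idealOfSpecializes_eq h hz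
  have hF : ¬ IsField (X.presheaf.stalk z) := by
    intro hF
    have h1 := ringKrullDim_eq_zero_of_isField hF
    rw [ringKrullDim_stalk_eq_coheight, hz] at h1
    exact absurd h1 (by decide)
  have h1 := (IsDiscreteValuationRing.TFAE (X.presheaf.stalk z) hF).out 0 4
  exact h1.mpr ⟨_, maximalIdeal_stalk_eq h hf⟩

theorem irreducible_stalkSpecializes {z x : X} [IsDiscreteValuationRing (X.presheaf.stalk z)]
    (h : z ⤳ x) {f : X.presheaf.stalk x} (hf : idealOfSpecializes h = Ideal.span {f}) :
    Irreducible (X.presheaf.stalkSpecializes h f) :=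
  (IsDiscreteValuationRing.irreducible_iff_uniformizer _).mpr (maximalIdeal_stalk_eq h hf)

end AlgebraicGeometry.Scheme

/-! ### Local rings of a smooth surface -/

namespace SmoothSurface

variable {k : Type u} [Field k] (X : SmoothSurface k)

/-- At a closed point `x` of a smooth surface over an algebraically closed field, a neighbourhood
of `x` is étale over the affine plane. -/
theorem hasPrimeParameters_stalk [IsAlgClosed k] {x : X.toScheme} (hx : IsClosed {x}) :
    HasPrimeParameters (X.toScheme.presheaf.stalk x) := by
  obtain ⟨U, hU, V, hV, hxV, e, hf⟩ :=
    X.smooth.exists_isStandardSmoothOfRelativeDimension x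
  obtain ⟨g, -, hg⟩ := hf.exists_etale_mvPolynomial
  obtain rfl : U = ⊤ := by
    refine top_le_iff.mp fun y _ => ?_
    have h1 : X.structureMap x ∈ U := e hxV
    rwa [Subsingleton.elim y (X.structureMap x)]
  let ε : k ≃+* Γ(Spec (CommRingCat.of k), ⊤) :=
    (Scheme.ΓSpecIso (CommRingCat.of k)).commRingCatIsoToRingEquiv.symm
  let g' : MvPolynomial (Fin 2) k →+* Γ(X.toScheme, V) :=
    g.comp (MvPolynomial.mapEquiv (Fin 2) ε).toRingHom
  have hg' : g'.Etale := RingHom.Etale.stableUnderComposition _ _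
    (RingHom.Etale.of_bijective (MvPolynomial.mapEquiv (Fin 2) ε).bijective) hg
  let _ := g'.toAlgebra
  have : Algebra.Etale (MvPolynomial (Fin 2) k) Γ(X.toScheme, V) := hg'
  have := hV.primeIdealOf_isMaximal_of_isClosed ⟨x, hxV⟩ hx
  have hP := HasPrimeParameters.of_etale (F := k) (hV.primeIdealOf ⟨x, hxV⟩).asIdeal
  let _ := X.toScheme.presheaf.algebra_section_stalk ⟨x, hxV⟩
  have := hV.isLocalization_stalk ⟨x, hxV⟩
  have hne : Nonempty V := ⟨⟨x, hxV⟩⟩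
  exact hP.of_ringEquiv (IsLocalization.algEquiv
    (hV.primeIdealOf ⟨x, hxV⟩).asIdeal.primeCompl
    (Localization.AtPrime (hV.primeIdealOf ⟨x, hxV⟩).asIdeal)
    (X.toScheme.presheaf.stalk x)).toRingEquiv

theorem uniqueFactorizationMonoid_stalk [IsAlgClosed k] {x : X.toScheme} (hx : IsClosed {x}) :
    UniqueFactorizationMonoid (X.toScheme.presheaf.stalk x) :=
  (X.hasPrimeParameters_stalk hx).uniqueFactorizationMonoid

/-- An open subset contains closed specializations of its points. -/
theorem exists_isClosed_specializes {W : X.toScheme.Opens} {x : X.toScheme} (hx : x ∈ W) :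
    ∃ y ∈ W, IsClosed {y} ∧ x ⤳ y := by
  have := X.locallyOfFiniteType
  have : JacobsonSpace X.toScheme := LocallyOfFiniteType.jacobsonSpace X.structureMap
  obtain ⟨y, ⟨hy, hyW⟩, hyc⟩ := nonempty_inter_closedPoints (X := X.toScheme)
    (Z := closure {x} ∩ W) ⟨x, subset_closure rfl, hx⟩
    ((isClosed_closure.isLocallyClosed).inter W.isOpen.isLocallyClosed)
  exact ⟨y, hyW, hyc, specializes_iff_mem_closure.mpr hy⟩

theorem isDiscreteValuationRing_stalk [IsAlgClosed k] {z : X.toScheme}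
    (hz : Order.coheight z = 1) : IsDiscreteValuationRing (X.toScheme.presheaf.stalk z) := by
  obtain ⟨y, -, hy, hzy⟩ := X.exists_isClosed_specializes (W := ⊤) (x := z) trivial
  have := X.uniqueFactorizationMonoid_stalk hy
  exact Scheme.isDiscreteValuationRing_stalk hzy hz

/-- A rational function which is regular in codimension one on an open subset is regular there. -/
theorem mem_range_stalk_of_forall_coheight_eq_one [IsAlgClosed k] {W : X.toScheme.Opens}
    {f : X.functionField}
    (hf : ∀ z ∈ W, Order.coheight z = 1 →
      f ∈ (algebraMap (X.toScheme.presheaf.stalk z) X.functionField).range)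
    {x : X.toScheme} (hx : x ∈ W) :
    f ∈ (algebraMap (X.toScheme.presheaf.stalk x) X.functionField).range := by
  obtain ⟨y, hyW, hy, hxy⟩ := X.exists_isClosed_specializes hx
  have := X.uniqueFactorizationMonoid_stalk hy
  exact Scheme.mem_range_stalk_of_specializes hxy
    (Scheme.mem_range_stalk_of_forall_coheight_eq_one fun z hz hz1 =>
      hf z (hz.mem_open W.isOpen hyW) hz1)

end SmoothSurface

/-! ### Regular rational functions and sections of the structure sheaf -/

namespace AlgebraicGeometry.Scheme

variable {X : Scheme.{u}} [IsIntegral X]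

theorem germToFunctionField_mem_range_stalk {W : X.Opens} [Nonempty W] (s : Γ(X, W)) {x : X}
    (hx : x ∈ W) :
    X.germToFunctionField W s ∈ (algebraMap (X.presheaf.stalk x) X.functionField).range :=
  ⟨_, algebraMap_germ_eq_germToFunctionField X hx s⟩

theorem germToFunctionField_map {W V : X.Opens} [Nonempty W] [Nonempty V] (h : V ≤ W)
    (s : Γ(X, W)) : X.germToFunctionField V (X.presheaf.map (homOfLE h).op s) =
      X.germToFunctionField W s :=
  X.presheaf.germ_res_apply (homOfLE h) _ _ s

/-- A rational function which is regular at `x` is regular in a neighbourhood of `x`. -/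
theorem exists_opens_germToFunctionField_eq {x : X} {f : X.functionField}
    (hf : f ∈ (algebraMap (X.presheaf.stalk x) X.functionField).range) :
    ∃ (W : X.Opens) (_ : x ∈ W) (_ : Nonempty W) (s : Γ(X, W)), X.germToFunctionField W s = f := by
  obtain ⟨r, rfl⟩ := hf
  obtain ⟨W, hW, s, rfl⟩ := X.presheaf.exists_germ_eq r
  have : Nonempty W := ⟨⟨x, hW⟩⟩
  exact ⟨W, hW, this, s, (algebraMap_germ_eq_germToFunctionField X hW s).symm⟩

theorem exists_germToFunctionField_eq {W : X.Opens} [Nonempty W] {f : X.functionField}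
    (hf : ∀ x ∈ W, f ∈ (algebraMap (X.presheaf.stalk x) X.functionField).range) :
    ∃ s : Γ(X, W), X.germToFunctionField W s = f := by
  choose V hxV hne s hs using fun x : W => exists_opens_germToFunctionField_eq (hf x.1 x.2)
  have hcover : W ≤ iSup V := fun x hx => Opens.mem_iSup.mpr ⟨⟨x, hx⟩, hxV _⟩
  have hcompat : TopCat.Presheaf.IsCompatible X.presheaf V s := by
    intro i j
    have hg : ∀ l : W, genericPoint X ∈ V l := fun l =>
      ((genericPoint_spec X).mem_open_set_iff (V l).isOpen).mpr ⟨_, trivial, hxV l⟩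
    have hne' : Nonempty (V i ⊓ V j : X.Opens) := ⟨⟨genericPoint X, hg i, hg j⟩⟩
    apply germToFunctionField_injective X (V i ⊓ V j)
    exact (germToFunctionField_map _ _).trans ((hs i).trans
      ((germToFunctionField_map _ _).trans (hs j)).symm)
  obtain ⟨t, ht, -⟩ := X.sheaf.existsUnique_gluing V s hcompat
  obtain ⟨x⟩ := ‹Nonempty W›
  have hne' : Nonempty (iSup V : X.Opens) := ⟨⟨x.1, hcover x.2⟩⟩
  refine ⟨X.presheaf.map (homOfLE hcover).op t, ?_⟩
  have : Nonempty (V x) := hne x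
  refine (germToFunctionField_map hcover _).trans (Eq.trans ?_ (hs x))
  rw [← ht x]
  exact (germToFunctionField_map (le_iSup V x) _).symm

end AlgebraicGeometry.Scheme

/-! ### Orders of vanishing on a smooth surface -/

namespace AlgebraicGeometry.Scheme

variable {X : Scheme.{u}} [IsIntegral X] [IsLocallyNoetherian X]

theorem ord_zpow {f : X.functionField} (hf : f ≠ 0) (n : ℤ) (z : X) :
    ord (f ^ n) z = n * ord f z := by
  by_cases hz : Order.coheight z = 1
  · rw [ord_eq_iff hz (zpow_ne_zero n hf), map_zpow₀, (ord_eq_iff hz hf).mp rfl]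
    rw [← WithZero.coe_zpow, ← ofAdd_zsmul, smul_eq_mul]
  · simp [hz]

theorem ord_algebraMap_of_irreducible {z : X} (hz : Order.coheight z = 1)
    [IsDiscreteValuationRing (X.presheaf.stalk z)] {π : X.presheaf.stalk z} (hπ : Irreducible π) :
    ord (algebraMap (X.presheaf.stalk z) X.functionField π) z = 1 := by
  rw [ord_eq_iff hz (algebraMap_uniformizer_ne_zero hπ)]
  exact Ring.ordFrac_irreducible hπ

theorem exists_eq_unit_mul_zpow {z : X} (hz : Order.coheight z = 1)
    [IsDiscreteValuationRing (X.presheaf.stalk z)] {π : X.presheaf.stalk z} (hπ : Irreducible π)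
    {f : X.functionField} (hf : f ≠ 0) : ∃ u : (X.presheaf.stalk z)ˣ,
      f = algebraMap (X.presheaf.stalk z) X.functionField u *
        algebraMap (X.presheaf.stalk z) X.functionField π ^ ord f z := by
  have hπ0 := algebraMap_uniformizer_ne_zero (K := X.functionField) hπ
  have h : ord (algebraMap (X.presheaf.stalk z) X.functionField π ^ ord f z) z = ord f z := by
    rw [ord_zpow hπ0, ord_algebraMap_of_irreducible hz hπ, mul_one]
  rw [ord_eq_iff hz (zpow_ne_zero _ hπ0), ← (ord_eq_iff hz hf).mp rfl] at h
  obtain ⟨u, hu⟩ := Ring.associated_of_ordFrac_eq (R := X.presheaf.stalk z) _ _ h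
  refine ⟨u, hu.symm.trans ?_⟩
  rw [Units.smul_def, Algebra.smul_def]

end AlgebraicGeometry.Scheme

namespace SmoothSurface

variable {k : Type u} [Field k] (X : SmoothSurface k)

theorem eq_of_specializes_of_coheight_eq_one {z w : X.toScheme} (h : z ⤳ w)
    (hz : Order.coheight z = 1) (hw : Order.coheight w = 1) : z = w := by
  by_contra hne
  have hlt : w < z := lt_of_le_not_ge h fun h' => hne (Specializes.antisymm h h').eq
  have h1 := Order.coheight_add_one_le hlt
  rw [hz, hw] at h1
  exact absurd h1 (by decide)

section Units

variable [IsAlgClosed k] {W : X.toScheme.Opens} {f : X.functionField}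

/-- A rational function without zeros and poles in codimension one on an open subset is a unit in
the local rings at the points of this subset. -/
theorem exists_units_stalk (hf0 : f ≠ 0)
    (hf : ∀ z ∈ W, Order.coheight z = 1 → Scheme.ord f z = 0) {x : X.toScheme} (hx : x ∈ W) :
    ∃ u : (X.toScheme.presheaf.stalk x)ˣ,
      algebraMap (X.toScheme.presheaf.stalk x) X.functionField u = f := by
  have hz : ∀ z ∈ W, Order.coheight z = 1 → ∃ u : (X.toScheme.presheaf.stalk z)ˣ,
      algebraMap (X.toScheme.presheaf.stalk z) X.functionField u = f := fun z hzW hz => by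
    have := X.isDiscreteValuationRing_stalk hz
    obtain ⟨π, hπ⟩ := IsDiscreteValuationRing.exists_irreducible (X.toScheme.presheaf.stalk z)
    obtain ⟨u, hu⟩ := Scheme.exists_eq_unit_mul_zpow hz hπ hf0
    rw [hf z hzW hz, zpow_zero, mul_one] at hu
    exact ⟨u, hu.symm⟩
  have h1 := X.mem_range_stalk_of_forall_coheight_eq_one (f := f) (fun z hzW hz1 => by
    obtain ⟨u, hu⟩ := hz z hzW hz1
    exact ⟨u, hu⟩) hx
  have h2 := X.mem_range_stalk_of_forall_coheight_eq_one (f := f⁻¹) (fun z hzW hz1 => by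
    obtain ⟨u, hu⟩ := hz z hzW hz1
    refine ⟨↑u⁻¹, ?_⟩
    refine eq_inv_of_mul_eq_one_left ?_
    rw [← hu, ← map_mul, Units.inv_mul, map_one]) hx
  obtain ⟨r, hr⟩ := h1
  obtain ⟨s, hs⟩ := h2
  have hrs : r * s = 1 := by
    apply IsFractionRing.injective (X.toScheme.presheaf.stalk x) X.functionField
    rw [map_mul, hr, hs, map_one, mul_inv_cancel₀ hf0]
  exact ⟨⟨r, s, hrs, (mul_comm _ _).trans hrs⟩, hr⟩

theorem exists_units_germToFunctionField_eq [Nonempty W] (hf0 : f ≠ 0)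
    (hf : ∀ z ∈ W, Order.coheight z = 1 → Scheme.ord f z = 0) :
    ∃ s : Γ(X.toScheme, W)ˣ, X.toScheme.germToFunctionField W s = f := by
  obtain ⟨r, hr⟩ := Scheme.exists_germToFunctionField_eq (W := W) (f := f) fun x hx => by
    obtain ⟨u, hu⟩ := X.exists_units_stalk hf0 hf hx
    exact ⟨u, hu⟩
  obtain ⟨s, hs⟩ := Scheme.exists_germToFunctionField_eq (W := W) (f := f⁻¹) fun x hx => by
    obtain ⟨u, hu⟩ := X.exists_units_stalk hf0 hf hx
    refine ⟨↑u⁻¹, ?_⟩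
    refine eq_inv_of_mul_eq_one_left ?_
    rw [← hu, ← map_mul, Units.inv_mul, map_one]
  have hrs : r * s = 1 := by
    apply Scheme.germToFunctionField_injective X.toScheme W
    rw [map_mul, hr, hs, map_one, mul_inv_cancel₀ hf0]
  exact ⟨⟨r, s, hrs, (mul_comm _ _).trans hrs⟩, hr⟩

end Units

section ZeroPoleLocus

variable {a b : X.functionField}

theorem ord_eq_zero_of_mem_regularLocus {z : X.toScheme} (hz : Order.coheight z = 1)
    (hzU : z ∈ X.regularLocus a b) : Scheme.ord a z = 0 ∧ Scheme.ord b z = 0 := by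
  by_contra h
  refine hzU (Set.mem_iUnion₂.mpr ⟨z, ⟨hz, ?_⟩, subset_closure rfl⟩)
  by_contra! h'
  exact h h'

/-- The components of the locus of zeros and poles are the closures of the points of codimension
one at which `a` or `b` has a zero or a pole. -/
theorem coheight_genericPoint_of_maximal {C : Set X.toScheme}
    (hC : Maximal (fun Z : Set X.toScheme => IsIrreducible Z ∧ Z ⊆ X.zeroPoleLocus a b) C)
    {η : X.toScheme} (hη : IsGenericPoint η C) :
    Order.coheight η = 1 ∧ (Scheme.ord a η ≠ 0 ∨ Scheme.ord b η ≠ 0) := by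
  obtain ⟨z, hz, hηz⟩ := Set.mem_iUnion₂.mp (hC.prop.2 hη.mem)
  have hle : C ⊆ closure {z} := by
    rw [← hη.def]
    exact closure_minimal (Set.singleton_subset_iff.mpr hηz) isClosed_closure
  have hge := hC.le_of_ge (y := closure {z})
    ⟨isIrreducible_singleton.closure, fun w hw => Set.mem_iUnion₂.mpr ⟨z, hz, hw⟩⟩ hle
  have hηz' : η = z :=
    (inseparable_iff_closure_eq.mpr (hη.def.trans (subset_antisymm hle hge))).eq
  rw [hηz']
  exact hz

variable {η : X.toScheme}

theorem notMem_regularLocus (hη : Order.coheight η = 1)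
    (hη' : Scheme.ord a η ≠ 0 ∨ Scheme.ord b η ≠ 0) : η ∉ X.regularLocus a b := fun h => by
  obtain ⟨h1, h2⟩ := X.ord_eq_zero_of_mem_regularLocus hη h
  exact hη'.elim (fun h => h h1) (fun h => h h2)

/-- The curves of zeros and poles other than the one with generic point `η` do not contain `η`. -/
theorem mem_regularLocusUnion (hη : Order.coheight η = 1) :
    η ∈ X.regularLocusUnion a b (closure {η}) := by
  let T : Set X.toScheme := {z | (Order.coheight z = 1 ∧
    (Scheme.ord a z ≠ 0 ∨ Scheme.ord b z ≠ 0)) ∧ z ≠ η}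
  have hT : T.Finite := by
    refine ((X.finite_ord_ne_zero a).union (X.finite_ord_ne_zero b)).subset ?_
    rintro z ⟨⟨h, h' | h'⟩, -⟩
    · exact Or.inl ⟨h, h'⟩
    · exact Or.inr ⟨h, h'⟩
  have hcl : IsClosed (⋃ z ∈ T, closure {z}) := hT.isClosed_biUnion fun _ _ => isClosed_closure
  refine mem_interior.mpr ⟨(⋃ z ∈ T, closure {z})ᶜ, fun w hw => ?_, hcl.isOpen_compl, fun h => ?_⟩
  · by_cases hwU : w ∈ X.regularLocus a b
    · exact Or.inl hwU
    · have hwV : w ∈ X.zeroPoleLocus a b := not_not.mp hwU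
      obtain ⟨z, hz, hwz⟩ := Set.mem_iUnion₂.mp hwV
      by_cases hzη : z = η
      · exact Or.inr (hzη ▸ hwz)
      · exact absurd (Set.mem_iUnion₂.mpr ⟨z, ⟨hz, hzη⟩, hwz⟩) hw
  · obtain ⟨z, ⟨⟨hz, -⟩, hzη⟩, h⟩ := Set.mem_iUnion₂.mp h
    exact hzη (X.eq_of_specializes_of_coheight_eq_one (specializes_iff_mem_closure.mpr h) hz hη)

/-- The only point of codimension one of `U_C` outside `U` is the generic point of `C`. -/
theorem mem_regularLocus_of_coheight_eq_one (hη : Order.coheight η = 1) {z : X.toScheme}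
    (hz : Order.coheight z = 1) (hzW : z ∈ X.regularLocusUnion a b (closure {η})) (hne : z ≠ η) :
    z ∈ X.regularLocus a b := by
  rcases interior_subset hzW with h | h
  · exact h
  · exact absurd (X.eq_of_specializes_of_coheight_eq_one
      (specializes_iff_mem_closure.mpr h) hη hz).symm hne

/-- Near a closed point `y` of the component with generic point `η`, this component is the only
zero of a local equation `f` of it, and `a` and `b` are powers of `f` up to units. -/
theorem exists_opens_of_specializes [IsAlgClosed k] (hη : Order.coheight η = 1)
    (hη' : Scheme.ord a η ≠ 0 ∨ Scheme.ord b η ≠ 0) (ha : a ≠ 0) (hb : b ≠ 0) {y : X.toScheme}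
    (hy : IsClosed {y}) (hyW : y ∈ X.regularLocusUnion a b (closure {η})) (h : η ⤳ y) :
    ∃ (f : X.toScheme.presheaf.stalk y) (W : X.toScheme.Opens), Prime f ∧
      Scheme.idealOfSpecializes h = Ideal.span {f} ∧ y ∈ W ∧
      W ≤ X.regularLocusUnion a b (closure {η}) ∧
      (∃ u : (X.toScheme.presheaf.stalk y)ˣ, a =
        algebraMap (X.toScheme.presheaf.stalk y) X.functionField u *
        algebraMap (X.toScheme.presheaf.stalk y) X.functionField f ^ Scheme.ord a η) ∧
      (∃ w : (X.toScheme.presheaf.stalk y)ˣ, b =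
        algebraMap (X.toScheme.presheaf.stalk y) X.functionField w *
        algebraMap (X.toScheme.presheaf.stalk y) X.functionField f ^ Scheme.ord b η) ∧
      ∀ x ∈ W, x ∈ X.regularLocus a b → ∃ u : (X.toScheme.presheaf.stalk x)ˣ,
        algebraMap (X.toScheme.presheaf.stalk x) X.functionField u =
          algebraMap (X.toScheme.presheaf.stalk y) X.functionField f := by
  have := X.uniqueFactorizationMonoid_stalk hy
  have := X.isDiscreteValuationRing_stalk hη
  obtain ⟨f, hf, hfη⟩ := Scheme.exists_prime_idealOfSpecializes_eq h hη
  set F := algebraMap (X.toScheme.presheaf.stalk y) X.functionField f with hF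
  have hF0 : F ≠ 0 := by
    rw [hF, Ne, map_eq_zero_iff _ (IsFractionRing.injective _ _)]; exact hf.ne_zero
  have hordη : Scheme.ord F η = 1 := by
    rw [hF, ← Scheme.algebraMap_stalkSpecializes h]
    exact Scheme.ord_algebraMap_of_irreducible hη (Scheme.irreducible_stalkSpecializes h hfη)
  let T : Set X.toScheme := {z | (Order.coheight z = 1 ∧ Scheme.ord F z ≠ 0) ∧ z ≠ η}
  have hT : T.Finite := (X.finite_ord_ne_zero F).subset fun z hz => hz.1
  have hcl : IsClosed (⋃ z ∈ T, closure {z}) := hT.isClosed_biUnion fun _ _ => isClosed_closure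
  let W : X.toScheme.Opens :=
    X.regularLocusUnion a b (closure {η}) ⊓ ⟨(⋃ z ∈ T, closure {z})ᶜ, hcl.isOpen_compl⟩
  have hyW' : y ∈ W := by
    refine ⟨hyW, fun hyT => ?_⟩
    obtain ⟨z, ⟨⟨hz, hzF⟩, hzη⟩, hyz⟩ := Set.mem_iUnion₂.mp hyT
    have hzy : z ⤳ y := specializes_iff_mem_closure.mpr hyz
    refine hzη (Scheme.eq_of_idealOfSpecializes_eq hzy h ?_)
    rw [hfη]
    refine Ideal.eq_span_singleton_of_height_eq_one
      ((Scheme.height_idealOfSpecializes hzy).trans hz) ?_ hf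
    by_contra hfz
    have hu := (Scheme.isUnit_stalkSpecializes_iff hzy f).mpr hfz
    have : Ring.KrullDimLE 1 (X.toScheme.presheaf.stalk z) :=
      krullDimLE_of_coheight_le hz.le
    refine hzF ?_
    rw [Scheme.ord_eq_iff hz hF0, hF, ← Scheme.algebraMap_stalkSpecializes hzy]
    exact Ring.ordFrac_of_isUnit hu
  have hWord : ∀ z ∈ W, Order.coheight z = 1 → z ≠ η → Scheme.ord F z = 0 := by
    intro z hzW hz hne
    by_contra h0
    exact hzW.2 (Set.mem_iUnion₂.mpr ⟨z, ⟨⟨hz, h0⟩, hne⟩, subset_closure rfl⟩)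
  have key : ∀ c : X.functionField, c ≠ 0 →
      (∀ z, Order.coheight z = 1 → z ∈ X.regularLocus a b → Scheme.ord c z = 0) →
      ∃ u : (X.toScheme.presheaf.stalk y)ˣ, c =
        algebraMap (X.toScheme.presheaf.stalk y) X.functionField u * F ^ Scheme.ord c η := by
    intro c hc hcU
    obtain ⟨u, hu⟩ := X.exists_units_stalk (W := W) (f := c * F ^ (-Scheme.ord c η))
      (mul_ne_zero hc (zpow_ne_zero _ hF0)) (fun z hzW hz => by
        rw [Scheme.ord_mul hc (zpow_ne_zero _ hF0), Scheme.ord_zpow hF0]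
        by_cases hne : z = η
        · rw [hne, hordη]; ring
        · rw [hWord z hzW hz hne,
            hcU z hz (X.mem_regularLocus_of_coheight_eq_one hη hz hzW.1 hne)]; ring) hyW'
    refine ⟨u, ?_⟩
    rw [hu, mul_assoc, ← zpow_add₀ hF0, neg_add_cancel, zpow_zero, mul_one]
  refine ⟨f, W, hf, hfη, hyW', fun _ h => h.1, ?_, ?_, fun x hxW hxU => ?_⟩
  · exact key a ha fun z hz hzU => (X.ord_eq_zero_of_mem_regularLocus hz hzU).1
  · exact key b hb fun z hz hzU => (X.ord_eq_zero_of_mem_regularLocus hz hzU).2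
  · refine X.exists_units_stalk (W := W ⊓ X.regularLocus a b) hF0 (fun z hzW hz => ?_) ⟨hxW, hxU⟩
    refine hWord z hzW.1 hz ?_
    rintro rfl
    exact X.notMem_regularLocus hη hη' hzW.2

end ZeroPoleLocus

end SmoothSurface

/-! ### Extension of a sheaf of algebras along an open immersion -/

namespace SheafOfAlgebras

variable {Y Z : Scheme.{u}}

theorem res_res (A : SheafOfAlgebras Y) {W'' W' W : Y.Opens} (h' : W'' ≤ W') (h : W' ≤ W)
    (s : A.sections W) : A.res h' (A.res h s) = A.res (h'.trans h) s := by
  change (A.presheaf.map (homOfLE h).op ≫ A.presheaf.map (homOfLE h').op) s = _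
  rw [← Functor.map_comp]
  rfl

theorem res_refl (A : SheafOfAlgebras Y) {W : Y.Opens} (s : A.sections W) :
    A.res le_rfl s = s := by
  change A.presheaf.map (𝟙 _) s = s
  rw [A.presheaf.map_id]
  rfl

theorem res_algebraMap (A : SheafOfAlgebras Y) {W' W : Y.Opens} (h : W' ≤ W) (r : Γ(Y, W)) :
    A.res h (algebraMap Γ(Y, W) (A.sections W) r) =
      algebraMap Γ(Y, W') (A.sections W') (Y.presheaf.map (homOfLE h).op r) :=
  (ConcreteCategory.congr_hom (A.structureHom.naturality (homOfLE h).op) r).symm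

/-- A compatible choice of subrings of the rings of sections of the direct image of a sheaf of
algebras `A`, containing the image of the structure sheaf and defined by a local condition. -/
structure DirectImageSubring (A : SheafOfAlgebras Z) (j : Z ⟶ Y) where
  /-- the subring over an open subset -/
  subring : ∀ W : Y.Opens, Subring (A.sections (j ⁻¹ᵁ W))
  res_mem : ∀ {W' W : Y.Opens} (h : W' ≤ W), ∀ s ∈ subring W,
    A.res (j.preimage_mono h) s ∈ subring W'
  mem_of_local : ∀ (W : Y.Opens) (s : A.sections (j ⁻¹ᵁ W)),
    (∀ y ∈ W, ∃ (W' : Y.Opens) (h : W' ≤ W), y ∈ W' ∧ A.res (j.preimage_mono h) s ∈ subring W') →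
      s ∈ subring W
  algebraMap_mem : ∀ (W : Y.Opens) (r : Γ(Y, W)),
    algebraMap Γ(Z, j ⁻¹ᵁ W) (A.sections (j ⁻¹ᵁ W)) (j.app W r) ∈ subring W

namespace DirectImageSubring

variable {A : SheafOfAlgebras Z} {j : Z ⟶ Y} (P : DirectImageSubring A j)

/-- The presheaf of rings defined by subrings of the direct image. -/
noncomputable def presheaf : TopCat.Presheaf RingCat.{u} Y where
  obj W := RingCat.of (P.subring W.unop)
  map {W W'} i := RingCat.ofHom
    ((A.res (j.preimage_mono i.unop.le)).restrict (P.subring W.unop) (P.subring W'.unop)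
      (P.res_mem i.unop.le))
  map_id _ := RingCat.hom_ext (RingHom.ext fun s => Subtype.ext (A.res_refl s.1))
  map_comp _ _ := RingCat.hom_ext (RingHom.ext fun s => Subtype.ext (A.res_res _ _ s.1).symm)

theorem isSheaf_presheaf : P.presheaf.IsSheaf := by
  rw [TopCat.Presheaf.isSheaf_iff_isSheafUniqueGluing]
  intro ι U sf hsf
  have hB := (TopCat.Presheaf.isSheaf_iff_isSheafUniqueGluing _).mp
    (TopCat.Sheaf.pushforward_sheaf_of_sheaf j.base A.isSheaf)
  obtain ⟨s, hs, hu⟩ := hB U (fun i => (sf i).1) fun i l => congrArg Subtype.val (hsf i l)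
  have hs' : ∀ i, A.res (j.preimage_mono (le_iSup U i)) s = (sf i).1 := hs
  refine ⟨⟨s, P.mem_of_local _ _ fun y hy => ?_⟩, fun i => Subtype.ext (hs i), fun t ht => ?_⟩
  · obtain ⟨i, hi⟩ := Opens.mem_iSup.mp hy
    refine ⟨U i, le_iSup U i, hi, ?_⟩
    rw [hs']
    exact (sf i).2
  · exact Subtype.ext (hu t.1 fun i => congrArg Subtype.val (ht i))

/-- The sheaf of algebras defined by subrings of the direct image. -/
noncomputable def sheafOfAlgebras : SheafOfAlgebras Y where
  presheaf := P.presheaf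
  isSheaf := P.isSheaf_presheaf
  structureHom :=
    { app := fun W => RingCat.ofHom
        (((algebraMap Γ(Z, j ⁻¹ᵁ W.unop) (A.sections (j ⁻¹ᵁ W.unop))).comp
          (j.app W.unop).hom).codRestrict (P.subring W.unop) (P.algebraMap_mem W.unop))
      naturality := by
        intro V W i
        refine RingCat.hom_ext (RingHom.ext fun r => Subtype.ext ?_)
        change algebraMap _ (A.sections (j ⁻¹ᵁ W.unop)) (j.app W.unop (Y.presheaf.map i r)) =
          A.res (j.preimage_mono i.unop.le)
            (algebraMap _ (A.sections (j ⁻¹ᵁ V.unop)) (j.app V.unop r))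
        rw [res_algebraMap]
        congr 1
        exact ConcreteCategory.congr_hom (j.naturality i) r }
  central W r x := Subtype.ext (A.central _ (j.app W r) x.1)

/-- If the subrings are everything on open subsets of `Z`, then the resulting sheaf of algebras
extends `A`. -/
theorem nonempty_iso [IsOpenImmersion j] (h : ∀ V : Z.Opens, P.subring (j ''ᵁ V) = ⊤) :
    Nonempty (Iso (P.sheafOfAlgebras.restrict j) A) := by
  have hle : ∀ V : Z.Opens, V ≤ j ⁻¹ᵁ (j ''ᵁ V) := fun V => (j.preimage_image_eq V).ge
  let φ : (P.sheafOfAlgebras.restrict j).presheaf ⟶ A.presheaf :=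
    { app := fun V => RingCat.ofHom ((A.res (hle V.unop)).comp (P.subring _).subtype)
      naturality := by
        intro V W i
        refine RingCat.hom_ext (RingHom.ext fun s => ?_)
        change A.res (hle W.unop) (A.res _ s.1) = A.res i.unop.le (A.res (hle V.unop) s.1)
        rw [res_res, res_res] }
  have hφ : ∀ V, IsIso (φ.app V) := by
    intro V
    rw [ConcreteCategory.isIso_iff_bijective]
    have hge := (j.preimage_image_eq V.unop).le
    constructor
    · intro s t hst
      apply Subtype.ext
      have h1 := congrArg (A.res hge)
        (show A.res (hle V.unop) s.1 = A.res (hle V.unop) t.1 from hst)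
      rwa [res_res, res_res, res_refl, res_refl] at h1
    · intro t
      refine ⟨⟨A.res hge t, ?_⟩, ?_⟩
      · change _ ∈ P.subring (j ''ᵁ V.unop)
        rw [h]; trivial
      change A.res (hle V.unop) (A.res hge t) = t
      rw [res_res, res_refl]
  have : IsIso φ := (NatTrans.isIso_iff_isIso_app φ).mpr hφ
  refine ⟨⟨asIso φ, ?_⟩⟩
  refine NatTrans.ext (funext fun V => RingCat.hom_ext (RingHom.ext fun r => ?_))
  have key : ∀ r : Γ(Z, V.unop), Z.presheaf.map (homOfLE (hle V.unop)).op
      (j.app _ ((j.appIso V.unop).inv r)) = r := fun r => by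
    have h1 := ConcreteCategory.congr_hom (j.appIso V.unop).inv_hom_id r
    rw [Scheme.Hom.appIso_hom] at h1
    exact h1
  change A.res (hle V.unop) (algebraMap _ (A.sections (j ⁻¹ᵁ (j ''ᵁ V.unop)))
    (j.app _ ((j.appIso V.unop).inv r))) = algebraMap Γ(Z, V.unop) (A.sections V.unop) r
  rw [res_algebraMap]
  exact congrArg _ (key r)

end DirectImageSubring

end SheafOfAlgebras

/-! ### Sections of the quaternion sheaf as quaternions over the function field -/

theorem quaternionMap_injective {R S : Type u} [CommRing R] [CommRing S] {φ : R →+* S}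
    (hφ : Function.Injective φ) {a b : R} {a' b' : S} (ha : φ a = a') (hb : φ b = b') :
    Function.Injective (quaternionMap φ ha hb) := fun _ _ h =>
  QuaternionAlgebra.ext (hφ (congrArg QuaternionAlgebra.re h))
    (hφ (congrArg QuaternionAlgebra.imI h)) (hφ (congrArg QuaternionAlgebra.imJ h))
    (hφ (congrArg QuaternionAlgebra.imK h))

namespace SmoothSurface

variable {k : Type u} [Field k] (X : SmoothSurface k)

theorem mem_image_ι_preimage_homOfLE {U W : X.toScheme.Opens} (h : U ≤ W)
    (V : W.toScheme.Opens) (x : X.toScheme) :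
    x ∈ U.ι ''ᵁ (X.toScheme.homOfLE h ⁻¹ᵁ V) ↔ x ∈ U ∧ x ∈ W.ι ''ᵁ V := by
  rw [Scheme.ι_image_homOfLE_eq_ι_image_inf]
  exact and_comm

theorem genericPoint_mem {W : X.toScheme.Opens} {x : X.toScheme} (hx : x ∈ W) :
    genericPoint X.toScheme ∈ W :=
  ((genericPoint_spec X.toScheme).mem_open_set_iff W.isOpen).mpr ⟨x, trivial, hx⟩

/-- Sections of the structure sheaf of an open subscheme, as rational functions. -/
noncomputable def germOpens (U : X.toScheme.Opens) (V : U.toScheme.Opens)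
    (hV : genericPoint X.toScheme ∈ U.ι ''ᵁ V) : Γ(U.toScheme, V) →+* X.functionField :=
  (X.toScheme.presheaf.germ (U.ι ''ᵁ V) (genericPoint X.toScheme) hV).hom

variable {U : X.toScheme.Opens} {V : U.toScheme.Opens}
  (hV : genericPoint X.toScheme ∈ U.ι ''ᵁ V)

theorem germOpens_injective : Function.Injective (X.germOpens U V hV) :=
  germ_injective_of_isIntegral X.toScheme _ hV

theorem germOpens_map {V' : U.toScheme.Opens} (hV' : genericPoint X.toScheme ∈ U.ι ''ᵁ V')
    (h : V' ≤ V) (r : Γ(U.toScheme, V)) :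
    X.germOpens U V' hV' (U.toScheme.presheaf.map (homOfLE h).op r) = X.germOpens U V hV r :=
  X.toScheme.presheaf.germ_res_apply (homOfLE (U.ι.image_mono h)) _ hV' r

theorem germOpens_topIso_inv (r : Γ(X.toScheme, U)) (hU : genericPoint X.toScheme ∈ U) :
    X.germOpens U V hV (U.toScheme.presheaf.map (homOfLE le_top).op (U.topIso.inv r)) =
      X.toScheme.presheaf.germ U (genericPoint X.toScheme) hU r := by
  have h1 : genericPoint X.toScheme ∈ U.ι ''ᵁ ⊤ := by
    obtain ⟨x, -, hx⟩ := hV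
    exact ⟨x, trivial, hx⟩
  rw [X.germOpens_map h1]
  exact X.toScheme.presheaf.germ_res_apply _ _ h1 r

theorem germOpens_homOfLE {U W : X.toScheme.Opens} (h : U ≤ W) (V : W.toScheme.Opens)
    (hV : genericPoint X.toScheme ∈ W.ι ''ᵁ V)
    (hV' : genericPoint X.toScheme ∈ U.ι ''ᵁ (X.toScheme.homOfLE h ⁻¹ᵁ V)) (r : Γ(W.toScheme, V)) :
    X.germOpens U _ hV' ((X.toScheme.homOfLE h).app V r) = X.germOpens W V hV r := by
  rw [Scheme.homOfLE_app]
  exact X.toScheme.presheaf.germ_res_apply _ _ hV' r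

theorem germOpens_mem_range_stalk (r : Γ(U.toScheme, V)) {x : X.toScheme} (hx : x ∈ U.ι ''ᵁ V) :
    X.germOpens U V hV r ∈ (algebraMap (X.toScheme.presheaf.stalk x) X.functionField).range := by
  have : Nonempty (U.ι ''ᵁ V) := ⟨⟨x, hx⟩⟩
  exact Scheme.germToFunctionField_mem_range_stalk (X := X.toScheme) (W := U.ι ''ᵁ V) r hx

theorem exists_germOpens_eq {f : X.functionField} (hf : ∀ x ∈ U.ι ''ᵁ V,
      f ∈ (algebraMap (X.toScheme.presheaf.stalk x) X.functionField).range) :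
    ∃ r : Γ(U.toScheme, V), X.germOpens U V hV r = f := by
  have : Nonempty (U.ι ''ᵁ V) := ⟨⟨_, hV⟩⟩
  exact Scheme.exists_germToFunctionField_eq hf

variable {aU bU : Γ(X.toScheme, U)} {a b : X.functionField}

section

variable (hU : genericPoint X.toScheme ∈ U)
  (ha : X.toScheme.presheaf.germ U (genericPoint X.toScheme) hU aU = a)
  (hb : X.toScheme.presheaf.germ U (genericPoint X.toScheme) hU bU = b)

/-- Sections of the quaternion sheaf, as elements of the quaternion algebra over the function
field. -/
noncomputable def quatGerm : (X.quaternionSheafOn U aU bU).sections V →+*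
    ℍ[X.functionField, a, 0, b] :=
  quaternionMap (X.germOpens U V hV) ((X.germOpens_topIso_inv hV aU hU).trans ha)
    ((X.germOpens_topIso_inv hV bU hU).trans hb)

theorem quatGerm_injective : Function.Injective (X.quatGerm hV hU ha hb) :=
  quaternionMap_injective (X.germOpens_injective hV) _ _

theorem quatGerm_res {V' : U.toScheme.Opens} (hV' : genericPoint X.toScheme ∈ U.ι ''ᵁ V')
    (h : V' ≤ V) (s : (X.quaternionSheafOn U aU bU).sections V) :
    X.quatGerm hV' hU ha hb ((X.quaternionSheafOn U aU bU).res h s) = X.quatGerm hV hU ha hb s :=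
  QuaternionAlgebra.ext (X.germOpens_map hV hV' h _) (X.germOpens_map hV hV' h _)
    (X.germOpens_map hV hV' h _) (X.germOpens_map hV hV' h _)

theorem quatGerm_algebraMap (r : Γ(U.toScheme, V)) :
    X.quatGerm hV hU ha hb (algebraMap _ ((X.quaternionSheafOn U aU bU).sections V) r) =
      algebraMap X.functionField _ (X.germOpens U V hV r) :=
  QuaternionAlgebra.ext rfl (map_zero (X.germOpens U V hV)) (map_zero (X.germOpens U V hV))
    (map_zero (X.germOpens U V hV))

theorem quatGerm_mem_quatLattice (s : (X.quaternionSheafOn U aU bU).sections V) {x : X.toScheme}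
    (hx : x ∈ U.ι ''ᵁ V) :
    X.quatGerm hV hU ha hb s ∈ quatLattice (X.toScheme.presheaf.stalk x) a b :=
  ⟨X.germOpens_mem_range_stalk hV _ hx, X.germOpens_mem_range_stalk hV _ hx,
    X.germOpens_mem_range_stalk hV _ hx, X.germOpens_mem_range_stalk hV _ hx⟩

theorem exists_quatGerm_eq {q : ℍ[X.functionField, a, 0, b]} (hq : ∀ x ∈ U.ι ''ᵁ V,
      q ∈ quatLattice (X.toScheme.presheaf.stalk x) a b) :
    ∃ s, X.quatGerm (aU := aU) (bU := bU) hV hU ha hb s = q := by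
  obtain ⟨r₀, h₀⟩ := X.exists_germOpens_eq hV fun x hx => (hq x hx).1
  obtain ⟨r₁, h₁⟩ := X.exists_germOpens_eq hV fun x hx => (hq x hx).2.1
  obtain ⟨r₂, h₂⟩ := X.exists_germOpens_eq hV fun x hx => (hq x hx).2.2.1
  obtain ⟨r₃, h₃⟩ := X.exists_germOpens_eq hV fun x hx => (hq x hx).2.2.2
  exact ⟨(⟨r₀, r₁, r₂, r₃⟩ : QuaternionAlgebra _ _ _ _), QuaternionAlgebra.ext h₀ h₁ h₂ h₃⟩

end

end SmoothSurface

/-! ### Local dual bases of the extension -/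

theorem inv_algebraMap_unit_mem_range {R K : Type*} [CommRing R] [Field K] [Algebra R K]
    (u : Rˣ) : (algebraMap R K u)⁻¹ ∈ (algebraMap R K).range :=
  ⟨↑u⁻¹, eq_inv_of_mul_eq_one_left (by rw [← map_mul, Units.inv_mul, map_one])⟩

theorem smul_mem_quatLattice {R K : Type*} [CommRing R] [Field K] [Algebra R K] {a b c : K}
    (hc : c ∈ (algebraMap R K).range) {q : ℍ[K, a, 0, b]} (hq : q ∈ quatLattice R a b) :
    c • q ∈ quatLattice R a b := by
  obtain ⟨r, rfl⟩ := hc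
  rw [algebraMap_smul]
  exact Submodule.smul_mem _ _ hq

/-- If `a` and `b` are in `R`, then so are the traces of products of quaternions with coordinates
in `R`. -/
theorem two_mul_re_mul_mem_range {R K : Type*} [CommRing R] [Field K] [Algebra R K] {a b : K}
    (ha : a ∈ (algebraMap R K).range) (hb : b ∈ (algebraMap R K).range) {p q : ℍ[K, a, 0, b]}
    (hp : p ∈ quatLattice R a b) (hq : q ∈ quatLattice R a b) :
    2 * (p * q).re ∈ (algebraMap R K).range := by
  have h : 2 * (p * q).re = 2 * (p.re * q.re + a * (p.imI * q.imI) + b * (p.imJ * q.imJ) -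
      a * b * (p.imK * q.imK)) := by
    rw [QuaternionAlgebra.re_mul]; ring
  rw [h]
  exact mul_mem (ofNat_mem _ 2) (sub_mem (add_mem (add_mem (mul_mem hp.1 hq.1)
    (mul_mem ha (mul_mem hp.2.1 hq.2.1))) (mul_mem hb (mul_mem hp.2.2.1 hq.2.2.1)))
    (mul_mem (mul_mem ha hb) (mul_mem hp.2.2.2 hq.2.2.2)))

namespace SmoothSurface

variable {k : Type u} [Field k] (X : SmoothSurface k)

theorem isUnit_two_stalk [CharZero k] (x : X.toScheme) :
    IsUnit (2 : X.toScheme.presheaf.stalk x) := by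
  have h : IsUnit (2 : k) := (two_ne_zero).isUnit
  have h1 := h.map ((X.toScheme.presheaf.germ ⊤ x trivial).hom.comp
    (X.structureMap.appTop.hom.comp (Scheme.ΓSpecIso (CommRingCat.of k)).inv.hom))
  rwa [map_ofNat] at h1

theorem eventually_mem_quatLattice {a b : X.functionField} {x : X.toScheme}
    {q : ℍ[X.functionField, a, 0, b]}
    (hq : q ∈ quatLattice (X.toScheme.presheaf.stalk x) a b) :
    ∀ᶠ y in nhds x, q ∈ quatLattice (X.toScheme.presheaf.stalk y) a b := by
  have key : ∀ f : X.functionField,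
      f ∈ (algebraMap (X.toScheme.presheaf.stalk x) X.functionField).range →
      ∀ᶠ y in nhds x, f ∈ (algebraMap (X.toScheme.presheaf.stalk y) X.functionField).range := by
    intro f hf
    obtain ⟨W, hxW, _, s, rfl⟩ := Scheme.exists_opens_germToFunctionField_eq hf
    filter_upwards [W.isOpen.mem_nhds hxW] with y hy
    exact Scheme.germToFunctionField_mem_range_stalk s hy
  filter_upwards [key _ hq.1, key _ hq.2.1, key _ hq.2.2.1, key _ hq.2.2.2] with y h₀ h₁ h₂ h₃
  exact ⟨h₀, h₁, h₂, h₃⟩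

variable [IsAlgClosed k] {a b : X.functionField}

theorem exists_units_of_mem_regularLocus (ha : a ≠ 0) (hb : b ≠ 0) {x : X.toScheme}
    (hx : x ∈ X.regularLocus a b) :
    (∃ u : (X.toScheme.presheaf.stalk x)ˣ,
      algebraMap (X.toScheme.presheaf.stalk x) X.functionField u = a) ∧
    ∃ w : (X.toScheme.presheaf.stalk x)ˣ,
      algebraMap (X.toScheme.presheaf.stalk x) X.functionField w = b :=
  ⟨X.exists_units_stalk ha (fun _ hz h => (X.ord_eq_zero_of_mem_regularLocus h hz).1) hx,
    X.exists_units_stalk hb (fun _ hz h => (X.ord_eq_zero_of_mem_regularLocus h hz).2) hx⟩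

/-- Locally on the surface, there are dual bases of the quaternion algebra consisting of sections
of the quaternion sheaf which belong to a given self-dual order at `η`. On `U`, one takes the basis
`1, i, j, l`; near a point of the curve, `IsSelfDualOrder.exists_dualBasis_lattice` is applied at a
closed specialization. -/
theorem exists_opens_isQuatDualBasis [CharZero k] {η : X.toScheme} (hη : Order.coheight η = 1)
    (hη' : Scheme.ord a η ≠ 0 ∨ Scheme.ord b η ≠ 0) (ha : a ≠ 0) (hb : b ≠ 0)
    {D : Subalgebra (X.toScheme.presheaf.stalk η) ℍ[X.functionField, a, 0, b]}
    (hD : IsSelfDualOrder D) {y : X.toScheme}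
    (hy : y ∈ X.regularLocusUnion a b (closure {η})) :
    ∃ W : X.toScheme.Opens, y ∈ W ∧ ∃ (n : ℕ) (e e' : Fin n → ℍ[X.functionField, a, 0, b]),
      IsQuatDualBasis e e' ∧
      (∀ i, ∀ x ∈ W, x ∈ X.regularLocus a b →
        e i ∈ quatLattice (X.toScheme.presheaf.stalk x) a b ∧
        e' i ∈ quatLattice (X.toScheme.presheaf.stalk x) a b) ∧
      (η ∈ W → ∀ i, e i ∈ D ∧ e' i ∈ D) := by
  by_cases hyU : y ∈ X.regularLocus a b
  · have h2 : (2 : X.functionField) ≠ 0 := by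
      have := ((X.isUnit_two_stalk y).map
        (algebraMap (X.toScheme.presheaf.stalk y) X.functionField)).ne_zero
      rwa [map_ofNat] at this
    refine ⟨X.regularLocus a b, hyU, 4, _, _, isQuatDualBasis_standard h2 ha hb, ?_,
      fun h => absurd h (X.notMem_regularLocus hη hη')⟩
    intro i x hx _
    obtain ⟨⟨u, hu⟩, ⟨w, hw⟩⟩ := X.exists_units_of_mem_regularLocus ha hb hx
    have hi2 : (2 : X.functionField)⁻¹ ∈
        (algebraMap (X.toScheme.presheaf.stalk x) X.functionField).range := by
      have := inv_algebraMap_unit_mem_range (K := X.functionField) (X.isUnit_two_stalk x).unit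
      rwa [IsUnit.unit_spec, map_ofNat] at this
    have hia : a⁻¹ ∈ (algebraMap (X.toScheme.presheaf.stalk x) X.functionField).range :=
      hu ▸ inv_algebraMap_unit_mem_range u
    have hib : b⁻¹ ∈ (algebraMap (X.toScheme.presheaf.stalk x) X.functionField).range :=
      hw ▸ inv_algebraMap_unit_mem_range w
    have h0 := zero_mem (algebraMap (X.toScheme.presheaf.stalk x) X.functionField).range
    have h1 := one_mem (algebraMap (X.toScheme.presheaf.stalk x) X.functionField).range
    fin_cases i
    · exact ⟨⟨h1, h0, h0, h0⟩, ⟨hi2, h0, h0, h0⟩⟩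
    · exact ⟨⟨h0, h1, h0, h0⟩, ⟨h0, by simpa [mul_inv] using mul_mem hia hi2, h0, h0⟩⟩
    · exact ⟨⟨h0, h0, h1, h0⟩, ⟨h0, h0, by simpa [mul_inv] using mul_mem hib hi2, h0⟩⟩
    · refine ⟨⟨h0, h0, h0, h1⟩, ⟨h0, h0, h0, ?_⟩⟩
      have := mul_mem (mul_mem hib hia) hi2
      simpa [mul_inv, mul_assoc] using this
  · have hyC : y ∈ closure {η} := (interior_subset hy).resolve_left hyU
    obtain ⟨z, hzW, hz, hyz⟩ := X.exists_isClosed_specializes hy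
    have h : η ⤳ z := (specializes_iff_mem_closure.mpr hyC).trans hyz
    obtain ⟨f, W, hf, hfη, hzW', -, ⟨u, hu⟩, ⟨w, hw⟩, hunit⟩ :=
      X.exists_opens_of_specializes hη hη' ha hb hz hzW h
    obtain ⟨n, e, e', hee', heD, heD', N, hN, hN'⟩ :=
      hD.exists_dualBasis_lattice (X.hasPrimeParameters_stalk hz) (X.isUnit_two_stalk z) hf
        (fun c => by
          rw [Scheme.mem_range_stalk_iff h]
          simp only [hfη, Ideal.mem_span_singleton]) hu hw
    have hev : ∀ᶠ x in nhds z, (∀ i, f ^ N • e i ∈ quatLattice (X.toScheme.presheaf.stalk x) a b ∧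
        f ^ N • e' i ∈ quatLattice (X.toScheme.presheaf.stalk x) a b) :=
      Filter.eventually_all.mpr fun i =>
        (X.eventually_mem_quatLattice (hN i)).and (X.eventually_mem_quatLattice (hN' i))
    obtain ⟨T, hT, hTo, hzT⟩ := eventually_nhds_iff.mp hev
    refine ⟨W ⊓ ⟨T, hTo⟩, hyz.mem_open (W ⊓ ⟨T, hTo⟩ : X.toScheme.Opens).isOpen ⟨hzW', hzT⟩,
      n, e, e', hee', fun i x hx hxU => ?_, fun _ i => ⟨heD i, heD' i⟩⟩
    obtain ⟨v, hv⟩ := hunit x hx.1 hxU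
    have hinv : (algebraMap (X.toScheme.presheaf.stalk z) X.functionField (f ^ N))⁻¹ ∈
        (algebraMap (X.toScheme.presheaf.stalk x) X.functionField).range := by
      rw [map_pow, ← hv, ← map_pow, ← Units.val_pow_eq_pow_val]
      exact inv_algebraMap_unit_mem_range _
    have hne : algebraMap (X.toScheme.presheaf.stalk z) X.functionField (f ^ N) ≠ 0 := by
      rw [Ne, map_eq_zero_iff _ (IsFractionRing.injective _ _)]
      exact pow_ne_zero N hf.ne_zero
    have key : ∀ q : ℍ[X.functionField, a, 0, b],
        f ^ N • q ∈ quatLattice (X.toScheme.presheaf.stalk x) a b →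
        q ∈ quatLattice (X.toScheme.presheaf.stalk x) a b := by
      intro q hq
      have h1 : q = (algebraMap (X.toScheme.presheaf.stalk z) X.functionField (f ^ N))⁻¹ •
          (f ^ N • q) := by
        rw [← algebraMap_smul X.functionField (f ^ N) q, inv_smul_smul₀ hne]
      rw [h1]
      exact smul_mem_quatLattice hinv hq
    exact ⟨key _ (hT x hx.2 i).1, key _ (hT x hx.2 i).2⟩

end SmoothSurface

/-! ### A self-dual order at a point of codimension one defines an extension -/

namespace SmoothSurface

variable {k : Type u} [Field k] (X : SmoothSurface k)

section

variable {U W : X.toScheme.Opens} (h : U ≤ W) {aU bU : Γ(X.toScheme, U)}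
  {a b : X.functionField} (hU : genericPoint X.toScheme ∈ U)
  (ha : X.toScheme.presheaf.germ U (genericPoint X.toScheme) hU aU = a)
  (hb : X.toScheme.presheaf.germ U (genericPoint X.toScheme) hU bU = b)

include hU in
theorem genericPoint_mem_image_preimage {V : W.toScheme.Opens} {x : X.toScheme}
    (hx : x ∈ W.ι ''ᵁ V) :
    genericPoint X.toScheme ∈ U.ι ''ᵁ (X.toScheme.homOfLE h ⁻¹ᵁ V) :=
  (X.mem_image_ι_preimage_homOfLE h V _).mpr ⟨hU, X.genericPoint_mem hx⟩

/-- The sections of the direct image of the quaternion sheaf whose germ at the point `η`, if they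
are defined there, belongs to a given subalgebra. -/
noncomputable def quatSubring {η : X.toScheme}
    (D : Subalgebra (X.toScheme.presheaf.stalk η) ℍ[X.functionField, a, 0, b]) :
    SheafOfAlgebras.DirectImageSubring (X.quaternionSheafOn U aU bU) (X.toScheme.homOfLE h) where
  subring V := ⨅ hη : η ∈ W.ι ''ᵁ V, D.toSubring.comap
    (X.quatGerm (X.genericPoint_mem_image_preimage h hU hη) hU ha hb)
  res_mem {V' V} hV s hs := by
    rw [Subring.mem_iInf] at hs ⊢
    intro hη
    have := hs (W.ι.image_mono hV hη)
    rw [Subring.mem_comap] at this ⊢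
    rwa [X.quatGerm_res]
  mem_of_local V s hs := by
    rw [Subring.mem_iInf]
    rintro ⟨y, hy, rfl⟩
    obtain ⟨V', hV', hy', hs'⟩ := hs y hy
    rw [Subring.mem_iInf] at hs'
    have := hs' ⟨y, hy', rfl⟩
    rw [Subring.mem_comap] at this ⊢
    rwa [X.quatGerm_res (X.genericPoint_mem_image_preimage h hU ⟨y, hy, rfl⟩)] at this
  algebraMap_mem V r := by
    rw [Subring.mem_iInf]
    intro hη
    rw [Subring.mem_comap, X.quatGerm_algebraMap, X.germOpens_homOfLE h V (X.genericPoint_mem hη)]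
    obtain ⟨t, ht⟩ := X.germOpens_mem_range_stalk (X.genericPoint_mem hη) r hη
    rw [← ht, ← IsScalarTower.algebraMap_apply]
    exact D.algebraMap_mem t

theorem mem_quatSubring {η : X.toScheme}
    {D : Subalgebra (X.toScheme.presheaf.stalk η) ℍ[X.functionField, a, 0, b]}
    {V : W.toScheme.Opens}
    {s : (X.quaternionSheafOn U aU bU).sections (X.toScheme.homOfLE h ⁻¹ᵁ V)} :
    s ∈ (X.quatSubring h hU ha hb D).subring V ↔ ∀ hη : η ∈ W.ι ''ᵁ V,
      X.quatGerm (X.genericPoint_mem_image_preimage h hU hη) hU ha hb s ∈ D := by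
  change s ∈ (⨅ _, _ : Subring _) ↔ _
  rw [Subring.mem_iInf]
  rfl

/-- There is no condition on the sections over open subsets which do not contain `η`. -/
theorem quatSubring_image_eq_top {η : X.toScheme} (hηU : η ∉ U)
    (D : Subalgebra (X.toScheme.presheaf.stalk η) ℍ[X.functionField, a, 0, b])
    (V : U.toScheme.Opens) :
    (X.quatSubring h hU ha hb D).subring (X.toScheme.homOfLE h ''ᵁ V) = ⊤ := by
  refine eq_top_iff.mpr fun s _ => (X.mem_quatSubring h hU ha hb).mpr ?_
  rintro ⟨_, ⟨x, hx, rfl⟩, rfl⟩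
  refine absurd x.2 ?_
  convert hηU
  exact (Scheme.homOfLE_apply h x).symm

end

variable [IsAlgClosed k] [CharZero k] {a b : X.functionField}

/-- The coordinates of sections with respect to the local dual bases are reduced traces, which are
regular at `η` because `D` is self-dual, and at the other points of codimension one because these
are in `U`. -/
theorem isAzumayaAlgebra_quatSubring {aU bU : Γ(X.toScheme, X.regularLocus a b)}
    (hU : genericPoint X.toScheme ∈ X.regularLocus a b)
    (haU : X.toScheme.presheaf.germ _ (genericPoint X.toScheme) hU aU = a)
    (hbU : X.toScheme.presheaf.germ _ (genericPoint X.toScheme) hU bU = b)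
    {η : X.toScheme} (hη : Order.coheight η = 1)
    (hη' : Scheme.ord a η ≠ 0 ∨ Scheme.ord b η ≠ 0) (ha : a ≠ 0) (hb : b ≠ 0)
    {D : Subalgebra (X.toScheme.presheaf.stalk η) ℍ[X.functionField, a, 0, b]}
    (hD : IsSelfDualOrder D) :
    (X.quatSubring (X.regularLocus_le a b (closure {η})) hU haU hbU
      D).sheafOfAlgebras.IsAzumayaAlgebra := by
  set W := X.regularLocusUnion a b (closure {η}) with hW
  set h := X.regularLocus_le a b (closure {η})
  set P := X.quatSubring h hU haU hbU D
  intro y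
  obtain ⟨W₀, hyW₀, n, e, e', hee', heU, heη⟩ :=
    X.exists_opens_isQuatDualBasis hη hη' ha hb hD y.2
  have h2 : (2 : X.functionField) ≠ 0 := by
    have := ((X.isUnit_two_stalk η).map
      (algebraMap (X.toScheme.presheaf.stalk η) X.functionField)).ne_zero
    rwa [map_ofNat] at this
  set V₀ : W.toScheme.Opens := W.ι ⁻¹ᵁ W₀ with hV₀
  have hyV₀ : y.1 ∈ W.ι ''ᵁ V₀ := ⟨y, hyW₀, rfl⟩
  have hle : ∀ x ∈ W.ι ''ᵁ V₀, x ∈ W₀ := by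
    rintro _ ⟨x, hx, rfl⟩
    exact hx
  have hgen := X.genericPoint_mem_image_preimage h hU hyV₀
  -- sections of the extension with a given germ at the generic point
  have hex : ∀ q : ℍ[X.functionField, a, 0, b],
      (∀ x ∈ W₀, x ∈ X.regularLocus a b → q ∈ quatLattice (X.toScheme.presheaf.stalk x) a b) →
      (η ∈ W₀ → q ∈ D) →
      ∃ s : P.sheafOfAlgebras.sections V₀, X.quatGerm hgen hU haU hbU s.1 = q := by
    intro q hq hqη
    obtain ⟨s, hs⟩ := X.exists_quatGerm_eq (aU := aU) (bU := bU) hgen hU haU hbU (q := q) (by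
      intro x hx
      obtain ⟨hxU, hxV⟩ := (X.mem_image_ι_preimage_homOfLE h V₀ x).mp hx
      exact hq x (hle x hxV) hxU)
    refine ⟨⟨s, (X.mem_quatSubring h hU haU hbU).mpr fun hη => ?_⟩, hs⟩
    rw [hs]
    exact hqη (hle _ hη)
  let ψ (V : W.toScheme.Opens) (x : X.toScheme) (hx : x ∈ W.ι ''ᵁ V) :
      P.sheafOfAlgebras.sections V →+* ℍ[X.functionField, a, 0, b] :=
    (X.quatGerm (X.genericPoint_mem_image_preimage h hU hx) hU haU hbU).comp (P.subring V).subtype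
  choose s hs using fun i => hex (e i) (fun x hx hxU => (heU i x hx hxU).1) fun hη => (heη hη i).1
  choose s' hs' using fun i => hex (e' i) (fun x hx hxU => (heU i x hx hxU).2)
    fun hη => (heη hη i).2
  -- the situation over a nonempty open subset
  have key : ∀ (V : W.toScheme.Opens) (hV : V ≤ V₀) (x : X.toScheme) (hx : x ∈ W.ι ''ᵁ V),
      (∀ r, ψ V x hx (algebraMap Γ(W.toScheme, V) (P.sheafOfAlgebras.sections V) r) =
          algebraMap _ _ (X.germOpens W V (X.genericPoint_mem hx) r)) ∧
      IsQuatDualBasis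
        (fun i => ψ V x hx (P.sheafOfAlgebras.res hV (s i)))
        (fun i => ψ V x hx (P.sheafOfAlgebras.res hV (s' i))) ∧
      ∀ (q : P.sheafOfAlgebras.sections V) i, ∃ r, X.germOpens W V (X.genericPoint_mem hx) r =
        2 * (ψ V x hx q *
          ψ V x hx (P.sheafOfAlgebras.res hV (s' i))).re := by
    intro V hV x hx
    set hg := X.genericPoint_mem_image_preimage h hU hx
    have hsV : ∀ i, ψ V x hx (P.sheafOfAlgebras.res hV (s i)) = e i := fun i =>
      (X.quatGerm_res hgen hU haU hbU hg _ (s i).1).trans (hs i)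
    have hsV' : ∀ i, ψ V x hx (P.sheafOfAlgebras.res hV (s' i)) = e' i := fun i =>
      (X.quatGerm_res hgen hU haU hbU hg _ (s' i).1).trans (hs' i)
    refine ⟨fun r => ?_, ?_, fun q i => ?_⟩
    · exact (X.quatGerm_algebraMap hg hU haU hbU _).trans
        (congrArg _ (X.germOpens_homOfLE h V (X.genericPoint_mem hx) hg r))
    · simpa only [hsV, hsV'] using hee'
    · rw [hsV']
      refine X.exists_germOpens_eq _ fun z hz => ?_
      refine X.mem_range_stalk_of_forall_coheight_eq_one (W := W.ι ''ᵁ V) (fun z hz hz1 => ?_) hz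
      have hzW : z ∈ W := by
        obtain ⟨z, -, rfl⟩ := hz
        exact z.2
      by_cases hzη : z = η
      · subst hzη
        exact (hD.mem_iff _).mp ((X.mem_quatSubring h hU haU hbU).mp q.2 hz) _
          (heη (hle z (W.ι.image_mono hV hz)) i).2
      · have hzU := X.mem_regularLocus_of_coheight_eq_one hη hz1 hzW hzη
        obtain ⟨⟨u, hu⟩, ⟨w, hw⟩⟩ := X.exists_units_of_mem_regularLocus ha hb hzU
        exact two_mul_re_mul_mem_range ⟨_, hu⟩ ⟨_, hw⟩
          (X.quatGerm_mem_quatLattice hg hU haU hbU q.1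
            ((X.mem_image_ι_preimage_homOfLE h V z).mpr ⟨hzU, hz⟩))
          (heU i z (hle z (W.ι.image_mono hV hz)) hzU).2
  have hinj : ∀ (V : W.toScheme.Opens) (x : X.toScheme) (hx : x ∈ W.ι ''ᵁ V),
      Function.Injective (ψ V x hx) := fun V x hx =>
    (X.quatGerm_injective _ hU haU hbU).comp Subtype.val_injective
  refine ⟨V₀, hyW₀, ⟨n, s, fun V hV => ?_⟩, ?_⟩
  · by_cases hne : ∃ x, x ∈ V
    · obtain ⟨x, hx⟩ := hne
      have hx' : x.1 ∈ W.ι ''ᵁ V := ⟨x, hx, rfl⟩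
      obtain ⟨h₁, h₂, h₃⟩ := key V hV x.1 hx'
      exact linearIndependent_and_span_eq_top_of_isQuatDualBasis (X.germOpens_injective _)
        (hinj V x.1 hx') h₁ h₂ h₃
    · -- over the empty set, all rings of sections are zero
      have hbot : V = ⊥ := by
        ext x
        exact ⟨fun hx => hne ⟨x, hx⟩, fun hx => hx.elim⟩
      have hsub : Subsingleton Γ(W.toScheme, V) := by rw [hbot]; infer_instance
      have := Module.subsingleton Γ(W.toScheme, V) (P.sheafOfAlgebras.sections V)
      exact ⟨linearIndependent_of_subsingleton, Subsingleton.elim _ _⟩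
  · obtain ⟨h₁, h₂, h₃⟩ := key V₀ le_rfl y.1 hyV₀
    exact isAzumaya_of_isQuatDualBasis h2 ha hb (X.germOpens_injective _) (hinj V₀ y.1 hyV₀)
      h₁ h₂ h₃

theorem extendsToAzumaya_of_isSelfDualOrder {aU bU : Γ(X.toScheme, X.regularLocus a b)}
    (hU : genericPoint X.toScheme ∈ X.regularLocus a b)
    (haU : X.toScheme.presheaf.germ _ (genericPoint X.toScheme) hU aU = a)
    (hbU : X.toScheme.presheaf.germ _ (genericPoint X.toScheme) hU bU = b)
    {η : X.toScheme} (hη : Order.coheight η = 1)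
    (hη' : Scheme.ord a η ≠ 0 ∨ Scheme.ord b η ≠ 0) (ha : a ≠ 0) (hb : b ≠ 0)
    {D : Subalgebra (X.toScheme.presheaf.stalk η) ℍ[X.functionField, a, 0, b]}
    (hD : IsSelfDualOrder D) :
    SheafOfAlgebras.ExtendsToAzumaya (X.regularLocus_le a b (closure {η}))
      (X.quaternionSheafOn (X.regularLocus a b) aU bU) :=
  ⟨_, X.isAzumayaAlgebra_quatSubring hU haU hbU hη hη' ha hb hD,
    SheafOfAlgebras.DirectImageSubring.nonempty_iso _
      (X.quatSubring_image_eq_top _ hU haU hbU (X.notMem_regularLocus hη hη') D)⟩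

end SmoothSurface

/-! ### The stalk of an extension is an order -/

open scoped TensorProduct in
/-- Base change of an Azumaya algebra `B` to a local ring `R`, realized inside an algebra over the
fraction field of `R` that it spans. For the simplicity modulo the maximal ideal: a coordinate of
`q` with respect to a basis of `B` has the form `∑ xᵣ q yᵣ`, as every endomorphism of `B` does. -/
theorem exists_isAzumayaOrder_of_isAzumaya {Γ B R K Q : Type*} [CommRing Γ] [Ring B] [Algebra Γ B]
    [IsAzumaya Γ B] [CommRing R] [IsDomain R] [IsLocalRing R] [Field K] [Algebra R K]
    [IsFractionRing R K] [Ring Q] [Algebra K Q] [Algebra R Q] [IsScalarTower R K Q] {π : R}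
    (hπ : IsLocalRing.maximalIdeal R = Ideal.span {π}) {n : ℕ} (e : Module.Basis (Fin n) Γ B)
    {σ : Γ →+* R} {Ψ : B →+* Q} (hσ : ∀ r, Ψ (algebraMap Γ B r) = algebraMap R Q (σ r))
    (hspan : Submodule.span K (Set.range Ψ) = ⊤) :
    ∃ S : Subalgebra R Q, IsAzumayaOrder π S := by
  have hsm : ∀ (r : Γ) (x : B), Ψ (r • x) = σ r • Ψ x := fun r x => by
    rw [Algebra.smul_def, map_mul, hσ, ← Algebra.smul_def]
  have hS : Subalgebra.toSubmodule (Algebra.adjoin R (Set.range Ψ)) =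
      Submodule.span R (Set.range fun i => Ψ (e i)) := by
    rw [Algebra.adjoin_eq_span]
    have : (Submonoid.closure (Set.range Ψ) : Set Q) = Set.range Ψ := by
      have h := Submonoid.closure_eq (MonoidHom.mrange (Ψ : B →* Q))
      exact congrArg SetLike.coe h
    rw [this]
    refine le_antisymm (Submodule.span_le.mpr ?_) (Submodule.span_mono ?_)
    · rintro _ ⟨x, rfl⟩
      rw [← e.sum_repr x, map_sum]
      refine Submodule.sum_mem _ fun i _ => ?_
      rw [hsm]
      exact Submodule.smul_mem _ _ (Submodule.subset_span ⟨i, rfl⟩)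
    · rintro _ ⟨i, rfl⟩
      exact ⟨e i, rfl⟩
  have hmem : ∀ x, Ψ x ∈ Algebra.adjoin R (Set.range Ψ) := fun x => Algebra.subset_adjoin ⟨x, rfl⟩
  refine ⟨Algebra.adjoin R (Set.range Ψ), ?_, ?_, ?_⟩
  · rw [hS]
    exact Submodule.fg_span (Set.finite_range _)
  · intro q
    have hq : q ∈ Submodule.span K (Set.range Ψ) := hspan ▸ Submodule.mem_top
    induction hq using Submodule.span_induction with
    | mem x hx => exact ⟨1, one_ne_zero, by rw [one_smul]; exact Algebra.subset_adjoin hx⟩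
    | zero => exact ⟨1, one_ne_zero, by rw [smul_zero]; exact zero_mem _⟩
    | add x y _ _ hx hy =>
      obtain ⟨r, hr, hrx⟩ := hx
      obtain ⟨s, hs, hsy⟩ := hy
      refine ⟨r * s, mul_ne_zero hr hs, ?_⟩
      rw [smul_add]
      refine add_mem ?_ ?_
      · rw [mul_comm, mul_smul]
        exact Subalgebra.smul_mem _ hrx s
      · rw [mul_smul]
        exact Subalgebra.smul_mem _ hsy r
    | smul c x _ hx =>
      obtain ⟨r, hr, hrx⟩ := hx
      obtain ⟨p, s, hs, rfl⟩ := IsFractionRing.div_surjective (A := R) c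
      have hs0 := nonZeroDivisors.ne_zero hs
      refine ⟨r * s, mul_ne_zero hr hs0, ?_⟩
      have h1 : (r * s) • (algebraMap R K p / algebraMap R K s) • x = p • r • x := by
        have hs0' : algebraMap R K s ≠ 0 := by
          rwa [Ne, map_eq_zero_iff _ (IsFractionRing.injective R K)]
        rw [← algebraMap_smul K (r * s), ← algebraMap_smul K p, ← algebraMap_smul K r, smul_smul,
          smul_smul]
        congr 1
        rw [map_mul]
        field_simp
      rw [h1]
      exact Subalgebra.smul_mem _ hrx p
  · intro q hq
    rw [← Subalgebra.mem_toSubmodule, hS, Submodule.mem_span_range_iff_exists_fun] at hq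
    obtain ⟨c, hcq⟩ := hq
    by_cases hc : ∀ i, c i ∈ IsLocalRing.maximalIdeal R
    · left
      simp only [hπ, Ideal.mem_span_singleton] at hc
      choose d hd using hc
      refine ⟨∑ i, d i • Ψ (e i), sum_mem fun i _ =>
        Subalgebra.smul_mem _ (hmem _) _, ?_⟩
      rw [← hcq, Finset.smul_sum]
      exact Finset.sum_congr rfl fun i _ => by rw [hd, mul_smul]
    · right
      push Not at hc
      obtain ⟨i, hi⟩ := hc
      rw [IsLocalRing.notMem_maximalIdeal] at hi
      obtain ⟨t, ht⟩ := (IsAzumaya.bij (R := Γ) (A := B)).2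
        (e.constr Γ fun k => if k = i then (1 : B) else 0)
      have key : ∀ (r : R) (t : B ⊗[Γ] Bᵐᵒᵖ), r • ∑ k, c k • Ψ (AlgHom.mulLeftRight Γ B t (e k)) ∈
          AddSubmonoid.closure {z : Q | ∃ s ∈ Algebra.adjoin R (Set.range Ψ),
            ∃ t ∈ Algebra.adjoin R (Set.range Ψ), z = s * q * t} := by
        intro r t
        induction t using TensorProduct.induction_on with
        | zero => simp
        | add x y hx hy =>
          simp only [map_add, LinearMap.add_apply, smul_add, Finset.sum_add_distrib] at hx hy ⊢
          exact add_mem hx hy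
        | tmul x y =>
          refine AddSubmonoid.subset_closure ⟨r • Ψ x,
            Subalgebra.smul_mem _ (hmem _) _, Ψ y.unop,
            hmem _, ?_⟩
          rw [← hcq]
          simp only [AlgHom.mulLeftRight_apply, map_mul, Finset.mul_sum, Finset.sum_mul,
            mul_smul_comm, smul_mul_assoc, Finset.smul_sum]
          exact Finset.sum_congr rfl fun k _ => smul_comm _ _ _
      have h1 := key ↑hi.unit⁻¹ t
      rw [ht, Finset.sum_eq_single i, Module.Basis.constr_basis, if_pos rfl, map_one, smul_smul,
        IsUnit.val_inv_mul, one_smul] at h1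
      · exact h1
      · intro k _ hk
        rw [Module.Basis.constr_basis, if_neg hk, map_zero, smul_zero]
      · simp

namespace SheafOfAlgebras

variable {Y Z : Scheme.{u}}

/-- The map on sections over an open subset given by an isomorphism of the restriction of `D` with
`A`. -/
noncomputable def Iso.sectionsHom {D : SheafOfAlgebras Z} {j : Y ⟶ Z} [IsOpenImmersion j]
    {A : SheafOfAlgebras Y} (I : Iso (D.restrict j) A) (V : Y.Opens) :
    D.sections (j ''ᵁ V) →+* A.sections V :=
  (I.iso.hom.app (op V)).hom

theorem Iso.sectionsHom_algebraMap {D : SheafOfAlgebras Z} {j : Y ⟶ Z} [IsOpenImmersion j]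
    {A : SheafOfAlgebras Y} (I : Iso (D.restrict j) A) (V : Y.Opens) (r : Γ(Z, j ''ᵁ V)) :
    I.sectionsHom V (algebraMap _ (D.sections (j ''ᵁ V)) r) =
      algebraMap Γ(Y, V) (A.sections V) ((j.appIso V).hom r) := by
  have h := ConcreteCategory.congr_hom (NatTrans.congr_app I.comm (op V)) ((j.appIso V).hom r)
  refine Eq.trans ?_ h
  have h1 := ConcreteCategory.congr_hom (j.appIso V).hom_inv_id r
  exact congrArg (fun r => I.sectionsHom V (algebraMap _ (D.sections (j ''ᵁ V)) r)) h1.symm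

theorem Iso.sectionsHom_surjective {D : SheafOfAlgebras Z} {j : Y ⟶ Z} [IsOpenImmersion j]
    {A : SheafOfAlgebras Y} (I : Iso (D.restrict j) A) (V : Y.Opens) :
    Function.Surjective (I.sectionsHom V) :=
  ((ConcreteCategory.isIso_iff_bijective (I.iso.hom.app (op V))).mp inferInstance).2

theorem Iso.sectionsHom_res_algebraMap {D : SheafOfAlgebras Z} {j : Y ⟶ Z} [IsOpenImmersion j]
    {A : SheafOfAlgebras Y} (I : Iso (D.restrict j) A) {V : Z.Opens} (h : j ''ᵁ (j ⁻¹ᵁ V) ≤ V)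
    (r : Γ(Z, V)) :
    I.sectionsHom (j ⁻¹ᵁ V) (D.res h (algebraMap _ (D.sections V) r)) =
      algebraMap Γ(Y, j ⁻¹ᵁ V) (A.sections (j ⁻¹ᵁ V)) (j.app V r) := by
  rw [res_algebraMap, sectionsHom_algebraMap]
  congr 1
  have h1 := ConcreteCategory.congr_hom (j.naturality (homOfLE h).op) r
  rw [Scheme.Hom.appIso_hom]
  refine (congrArg (Y.presheaf.map _) h1).trans ?_
  change (Y.presheaf.map _ ≫ Y.presheaf.map _) (j.app V r) = _
  rw [← Functor.map_comp]
  exact ConcreteCategory.congr_hom (Y.presheaf.map_id _) _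

end SheafOfAlgebras

namespace SmoothSurface

variable {k : Type u} [Field k] (X : SmoothSurface k)

/-- Sections of the quaternion sheaf span the quaternion algebra over the function field, as
`1, i, j, l` are among them. -/
theorem span_range_quatGerm {U : X.toScheme.Opens} {V : U.toScheme.Opens}
    (hV : genericPoint X.toScheme ∈ U.ι ''ᵁ V) {aU bU : Γ(X.toScheme, U)} {a b : X.functionField}
    (hU : genericPoint X.toScheme ∈ U)
    (ha : X.toScheme.presheaf.germ U (genericPoint X.toScheme) hU aU = a)
    (hb : X.toScheme.presheaf.germ U (genericPoint X.toScheme) hU bU = b) :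
    Submodule.span X.functionField (Set.range (X.quatGerm hV hU ha hb)) = ⊤ := by
  refine eq_top_iff.mpr fun q _ => ?_
  have key : ∀ p : ℍ[X.functionField, a, 0, b],
      (∀ x, p ∈ quatLattice (X.toScheme.presheaf.stalk x) a b) →
      p ∈ Submodule.span X.functionField (Set.range (X.quatGerm hV hU ha hb)) := fun p hp =>
    Submodule.subset_span (X.exists_quatGerm_eq hV hU ha hb fun x _ => hp x)
  have h0 := fun x => zero_mem (algebraMap (X.toScheme.presheaf.stalk x) X.functionField).range
  have h1 := fun x => one_mem (algebraMap (X.toScheme.presheaf.stalk x) X.functionField).range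
  have hq : q = q.re • ⟨1, 0, 0, 0⟩ + q.imI • ⟨0, 1, 0, 0⟩ + q.imJ • ⟨0, 0, 1, 0⟩ +
      q.imK • ⟨0, 0, 0, 1⟩ := by
    apply QuaternionAlgebra.ext <;> simp
  rw [hq]
  exact add_mem (add_mem (add_mem
    (Submodule.smul_mem _ _ (key _ fun x => ⟨h1 x, h0 x, h0 x, h0 x⟩))
    (Submodule.smul_mem _ _ (key _ fun x => ⟨h0 x, h1 x, h0 x, h0 x⟩)))
    (Submodule.smul_mem _ _ (key _ fun x => ⟨h0 x, h0 x, h1 x, h0 x⟩)))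
    (Submodule.smul_mem _ _ (key _ fun x => ⟨h0 x, h0 x, h0 x, h1 x⟩))

/-- The stalk at `η` of an Azumaya algebra extending the quaternion sheaf is an order in the
quaternion algebra. -/
theorem exists_isAzumayaOrder_of_extendsToAzumaya {U W : X.toScheme.Opens} (h : U ≤ W)
    {aU bU : Γ(X.toScheme, U)} {a b : X.functionField} (hU : genericPoint X.toScheme ∈ U)
    (ha : X.toScheme.presheaf.germ U (genericPoint X.toScheme) hU aU = a)
    (hb : X.toScheme.presheaf.germ U (genericPoint X.toScheme) hU bU = b)
    {η : X.toScheme} (hη : η ∈ W) {π : X.toScheme.presheaf.stalk η}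
    (hπ : IsLocalRing.maximalIdeal (X.toScheme.presheaf.stalk η) = Ideal.span {π})
    (hext : SheafOfAlgebras.ExtendsToAzumaya h (X.quaternionSheafOn U aU bU)) :
    ∃ S : Subalgebra (X.toScheme.presheaf.stalk η) ℍ[X.functionField, a, 0, b],
      IsAzumayaOrder π S := by
  obtain ⟨D, hD, ⟨I⟩⟩ := hext
  obtain ⟨V, hηV, ⟨n, e, he⟩, hAz⟩ := hD ⟨η, hη⟩
  set j := X.toScheme.homOfLE h
  have hηV' : η ∈ W.ι ''ᵁ V := ⟨⟨η, hη⟩, hηV, rfl⟩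
  have hgen := X.genericPoint_mem_image_preimage h hU hηV'
  have hle : j ''ᵁ (j ⁻¹ᵁ V) ≤ V := by
    rw [Scheme.Hom.image_preimage_eq_opensRange_inf]
    exact inf_le_right
  have hb' := he V le_rfl
  simp only [SheafOfAlgebras.res_refl] at hb'
  let Φ : D.sections (j ''ᵁ (j ⁻¹ᵁ V)) →+* ℍ[X.functionField, a, 0, b] :=
    (X.quatGerm hgen hU ha hb).comp (I.sectionsHom (j ⁻¹ᵁ V))
  refine exists_isAzumayaOrder_of_isAzumaya (K := X.functionField) hπ
    (Module.Basis.mk hb'.1 hb'.2.ge)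
    (σ := (X.toScheme.presheaf.germ (W.ι ''ᵁ V) η hηV').hom)
    (Ψ := Φ.comp (D.res hle)) (fun r => ?_) ?_
  · change X.quatGerm hgen hU ha hb (I.sectionsHom (j ⁻¹ᵁ V) (D.res hle (algebraMap _ _ r))) = _
    rw [I.sectionsHom_res_algebraMap hle, X.quatGerm_algebraMap,
      X.germOpens_homOfLE h V (X.genericPoint_mem hηV'),
      IsScalarTower.algebraMap_apply (X.toScheme.presheaf.stalk η) X.functionField]
    have : Nonempty (W.ι ''ᵁ V) := ⟨⟨η, hηV'⟩⟩
    exact congrArg _ (Scheme.algebraMap_germ_eq_germToFunctionField X.toScheme hηV' r).symm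
  · rw [eq_top_iff, ← X.span_range_quatGerm hgen hU ha hb, Submodule.span_le]
    rintro _ ⟨t, rfl⟩
    obtain ⟨t, rfl⟩ := I.sectionsHom_surjective _ t
    have ht : t ∈ Submodule.span Γ(W.toScheme, j ''ᵁ (j ⁻¹ᵁ V))
        (Set.range fun i => D.res hle (e i)) := (he _ hle).2 ▸ Submodule.mem_top
    induction ht using Submodule.span_induction with
    | mem x hx =>
      obtain ⟨i, rfl⟩ := hx
      exact Submodule.subset_span ⟨e i, rfl⟩
    | zero => rw [map_zero, map_zero]; exact zero_mem _
    | add x y _ _ hx hy => rw [map_add, map_add]; exact add_mem hx hy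
    | smul c x _ hx =>
      rw [Algebra.smul_def, map_mul, map_mul, I.sectionsHom_algebraMap, X.quatGerm_algebraMap,
        ← Algebra.smul_def]
      exact Submodule.smul_mem _ _ hx

end SmoothSurface

/-! ### The tame symbol and extensions to Azumaya algebras -/

theorem IsLocalRing.isSquare_units_map_residue_iff {R : Type*} [CommRing R] [IsLocalRing R]
    (s : Rˣ) :
    IsSquare (Units.map (IsLocalRing.residue R).toMonoidHom s) ↔
      IsSquare (IsLocalRing.residue R s) := by
  refine ⟨fun h => h.map (Units.coeHom _), ?_⟩
  rintro ⟨c, hc⟩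
  have hc0 : c ≠ 0 := by
    rintro rfl
    rw [mul_zero] at hc
    exact (s.isUnit.map (IsLocalRing.residue R)).ne_zero hc
  exact ⟨Units.mk0 c hc0, Units.ext hc⟩

theorem proposition3p2 {k : Type u} [Field k] [IsAlgClosed k] [CharZero k] (X : SmoothSurface k)
    (a b : X.functionField) (ha : a ≠ 0) (hb : b ≠ 0)
    (C : Set X.toScheme)
    (hC : Maximal (fun Z : Set X.toScheme => IsIrreducible Z ∧ Z ⊆ X.zeroPoleLocus a b) C)
    (η : X.toScheme) (hη : IsGenericPoint η C) :
    ∃ aU bU : Γ(X.toScheme, X.regularLocus a b)ˣ,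
      X.toScheme.germToFunctionField (X.regularLocus a b) aU = a ∧
      X.toScheme.germToFunctionField (X.regularLocus a b) bU = b ∧
      ∃ c : (X.toScheme.residueField η)ˣ,
        X.IsTameSymbol η a b c ∧
        (SheafOfAlgebras.ExtendsToAzumaya (X.regularLocus_le a b C)
            (X.quaternionSheafOn (X.regularLocus a b) aU bU) ↔
          IsSquare c) := by
  obtain ⟨hη1, hη2⟩ := X.coheight_genericPoint_of_maximal hC hη
  obtain rfl : closure {η} = C := hη.def
  obtain ⟨aU, haU⟩ := X.exists_units_germToFunctionField_eq (W := X.regularLocus a b) ha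
    fun z hz hz1 => (X.ord_eq_zero_of_mem_regularLocus hz1 hz).1
  obtain ⟨bU, hbU⟩ := X.exists_units_germToFunctionField_eq (W := X.regularLocus a b) hb
    fun z hz hz1 => (X.ord_eq_zero_of_mem_regularLocus hz1 hz).2
  have hU : genericPoint X.toScheme ∈ X.regularLocus a b :=
    X.genericPoint_mem (Classical.arbitrary (X.regularLocus a b)).2
  have := X.isDiscreteValuationRing_stalk hη1
  obtain ⟨π, hπ⟩ := IsDiscreteValuationRing.exists_irreducible (X.toScheme.presheaf.stalk η)
  obtain ⟨u, hu⟩ := Scheme.exists_eq_unit_mul_zpow hη1 hπ ha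
  obtain ⟨w, hw⟩ := Scheme.exists_eq_unit_mul_zpow hη1 hπ hb
  have hs := algebraMap_units_eq_tameSymbol
    (algebraMap_uniformizer_ne_zero (K := X.functionField) hπ) hu hw
  refine ⟨aU, bU, haU, hbU, Units.map (IsLocalRing.residue _).toMonoidHom _, ⟨_, hs, rfl⟩, ?_⟩
  refine Iff.trans ?_ (IsLocalRing.isSquare_units_map_residue_iff _).symm
  constructor
  · intro h
    obtain ⟨S, hS⟩ := X.exists_isAzumayaOrder_of_extendsToAzumaya _ hU haU hbU
      (X.mem_regularLocusUnion hη1) hπ.maximalIdeal_eq h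
    exact hS.isSquare_residue_tameSymbol hπ hu hw hs
  · intro h
    obtain ⟨D, hD⟩ := exists_isSelfDualOrder_of_isSquare_residue_tameSymbol
      (X.isUnit_two_stalk η) hπ hu hw hs h
    exact X.extendsToAzumaya_of_isSelfDualOrder hU haU hbU hη1 hη2 ha hb hD
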